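/- For $\lambda>1$ put $L^2(\mathbb R_+)_\lambda=L^2(\mathbb R_+,x^{1-\lambda}dx)$, and for $\lambda',\lambda''>1$ identify $L^2(\mathbb R_+)_{\lambda'}\widehat\otimes L^2(\mathbb R_+)_{\lambda''}$ with $L^2(\mathbb R_+^2)_{\lambda',\lambda''}=L^2(\mathbb R_+^2,x^{1-\lambda'}y^{1-\lambda''}dx\,dy)$ through $u\otimes v\mapsto u(x)v(y)$. Let $\widetilde G$ be the universal covering group of $SL(2,\mathbb R)$. It acts on functions on the upper half plane by $(\pi_\lambda(g)f)(z)=(cz+d)^{-\lambda}f\left(\frac{az+b}{cz+d}\right)$, where $\begin{pmatrix}a&b\\c&d\end{pmatrix}$ is the image of $g^{-1}$ in $SL(2,\mathbb R)$ and the power is taken with the branch of $\log(cz+d)$ attached to $g^{-1}$. Let $\widetilde G$ act unitarily on $L^2(\mathbb R_+)_\lambda$ so that the Fourier--Laplace transform $(\mathcal Fh)(\zeta)=\int_0^\infty h(x)e^{i\zeta x}dx$ intertwines this action with $\pi_\lambda$; this determines the action uniquely. Likewise let $\widetilde G\times\widetilde G$ act unitarily on $L^2(\mathbb R_+^2)_{\lambda',\lambda''}$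 so that $\mathcal F\otimes\mathcal F$ intertwines the action with the outer tensor product of $\pi_{\lambda'}$ and $\pi_{\lambda''}$; this is the tensor product of the two actions, and $\widetilde G$ acts through the diagonal. For $\ell\in\mathbb N=\{0,1,2,\dots\}$ let $$P_\ell^{\alpha,\beta}(t)=\sum_{j=0}^{\ell}\frac{(\alpha+\beta+\ell+1)_j(\alpha+j+1)_{\ell-j}}{(\ell-j)!\,j!}\Big(\frac{t-1}{2}\Big)^j$$ be the Jacobi polynomial, where $(x)_k=x(x+1)\cdots(x+k-1)$. Let $$c_\ell(\lambda',\lambda'')=\frac{1}{2^{\lambda'+\lambda''-1}}\int_{-1}^1|P_\ell^{\lambda'-1,\lambda''-1}(v)|^2(1-v)^{\lambda'-1}(1+v)^{\lambda''-1}dv=\frac{\Gamma(\lambda'+\ell)\Gamma(\lambda''+\ell)}{(\lambda'+\lambda''+2\ell-1)\Gamma(\lambda'+\lambda''+\ell-1)\,\ell!},$$ and, for a function $h$ on $\mathbb R_+$, $$\left(\Phi_{\lambda',\lambda''}^{\lambda'+\lambda''+2\ell}h\right)(x,y)=\frac{x^{\lambda'-1}y^{\lambda''-1}}{(x+y)^{\lambda'+\lambda''+\ell-1}}P_\ell^{\lambda'-1,\lambda''-1}\Big(\frac{y-x}{x+y}\Big)h(x+y).$$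 Let $\sum^{\oplus}_{\ell\in\mathbb N}L^2(\mathbb R_+)_{\lambda'+\lambda''+2\ell}$ be the Hilbert sum associated to the weights $c_\ell(\lambda',\lambda'')$, i.e. the space of families $h=(h_\ell)_{\ell\in\mathbb N}$ with $h_\ell\in L^2(\mathbb R_+)_{\lambda'+\lambda''+2\ell}$ and $\sum_\ell c_\ell(\lambda',\lambda'')\|h_\ell\|^2<\infty$, with the inner product $\sum_\ell c_\ell(\lambda',\lambda'')(h_\ell,h'_\ell)$ and the diagonal action of $\widetilde G$. **Theorem.** Suppose $\lambda',\lambda''>1$. Then the holographic transform $\Phi_{\lambda',\lambda''}=\bigoplus_{\ell\in\mathbb N}\Phi_{\lambda',\lambda''}^{\lambda'+\lambda''+2\ell}$, $h\mapsto\sum_\ell\Phi_{\lambda',\lambda''}^{\lambda'+\lambda''+2\ell}h_\ell$, induces a $\widetilde G$-equivariant unitary operator from the Hilbert sum $\sum^{\oplus}_{\ell\in\mathbb N}L^2(\mathbb R_+)_{\lambda'+\lambda''+2\ell}$ associated to the weights $c_\ell(\lambda',\lambda'')$ onto $L^2(\mathbb R_+)_{\lambda'}\widehat\otimes L^2(\mathbb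 R_+)_{\lambda''}$, and $$\|\Phi_{\lambda',\lambda''}h\|^2_{L^2(\mathbb R_+^2)_{\lambda',\lambda''}}=\sum_{\ell=0}^\infty c_\ell(\lambda',\lambda'')\,\|h_\ell\|^2_{L^2(\mathbb R_+)_{\lambda'+\lambda''+2\ell}}$$ for all $h=(h_\ell)_{\ell\in\mathbb N}$ in this Hilbert sum. -/

import Mathlib

open MeasureTheory Set UpperHalfPlane
open scoped TensorProduct ComplexConjugate MatrixGroups

/-! ### The universal covering group of `SL(2, ℝ)` and its action on functions on `ℍ` -/

/-- The universal covering group of `SL(2, ℝ)`, in its standard model: the points over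
`g = (a b; c d)` are the continuous branches on the upper half plane of `log (c z + d)`. -/
@[ext]
structure SLTilde where
  toSL : SL(2, ℝ)
  logDenom : ℍ → ℂ
  continuous_logDenom : Continuous logDenom
  exp_logDenom : ∀ z : ℍ, Complex.exp (logDenom z) = (toSL 1 0 : ℂ) * (z : ℂ) + (toSL 1 1 : ℂ)

namespace SLTilde

theorem denom_mul (g h : SL(2, ℝ)) (z : ℍ) :
    (((g * h) 1 0 : ℝ) : ℂ) * (z : ℂ) + (((g * h) 1 1 : ℝ) : ℂ) =
      ((g 1 0 : ℂ) * ((h • z : ℍ) : ℂ) + (g 1 1 : ℂ)) * ((h 1 0 : ℂ) * (z : ℂ) + (h 1 1 : ℂ)) := by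
  have hz := (linear_ne_zero z (cd := ![h 1 0, h 1 1]) fun h0 => by
    have hd := h.det_coe
    rw [Matrix.det_fin_two] at hd
    have e0 : h 1 0 = 0 := by simpa using congrFun h0 0
    have e1 : h 1 1 = 0 := by simpa using congrFun h0 1
    simp [e0, e1] at hd)
  simp only [Matrix.cons_val_zero, Matrix.cons_val_one] at hz
  rw [coe_specialLinearGroup_apply]
  simp only [Algebra.algebraMap_self, RingHom.id_apply, Matrix.SpecialLinearGroup.coe_mul,
    Matrix.mul_apply, Fin.sum_univ_two]
  push_cast
  field_simp
  ring

noncomputable instance : Mul SLTilde where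
  mul g h :=
    { toSL := g.toSL * h.toSL
      logDenom := fun z => g.logDenom (h.toSL • z) + h.logDenom z
      continuous_logDenom :=
        (g.continuous_logDenom.comp (continuous_const_smul h.toSL)).add h.continuous_logDenom
      exp_logDenom := fun z => by
        rw [Complex.exp_add, g.exp_logDenom, h.exp_logDenom, denom_mul] }

noncomputable instance : One SLTilde where
  one :=
    { toSL := 1
      logDenom := fun _ => 0
      continuous_logDenom := continuous_const
      exp_logDenom := fun z => by simp }

noncomputable instance : Inv SLTilde where
  inv g :=
    { toSL := g.toSL⁻¹
      logDenom := fun z => -g.logDenom (g.toSL⁻¹ • z)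
      continuous_logDenom :=
        (g.continuous_logDenom.comp (continuous_const_smul g.toSL⁻¹)).neg
      exp_logDenom := fun z => by
        rw [Complex.exp_neg]
        have h := denom_mul g.toSL g.toSL⁻¹ z
        rw [← g.exp_logDenom, mul_inv_cancel] at h
        simp only [Matrix.SpecialLinearGroup.coe_one, ne_eq, one_ne_zero, not_false_eq_true,
          Matrix.one_apply_ne, Complex.ofReal_zero, zero_mul, Matrix.one_apply_eq,
          Complex.ofReal_one, zero_add] at h
        exact inv_eq_of_mul_eq_one_right h.symm }

@[simp] theorem mul_toSL (g h : SLTilde) : (g * h).toSL = g.toSL * h.toSL := rfl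
@[simp] theorem mul_logDenom (g h : SLTilde) (z : ℍ) :
    (g * h).logDenom z = g.logDenom (h.toSL • z) + h.logDenom z := rfl
@[simp] theorem one_toSL : (1 : SLTilde).toSL = 1 := rfl
@[simp] theorem one_logDenom (z : ℍ) : (1 : SLTilde).logDenom z = 0 := rfl
@[simp] theorem inv_toSL (g : SLTilde) : g⁻¹.toSL = g.toSL⁻¹ := rfl
@[simp] theorem inv_logDenom (g : SLTilde) (z : ℍ) :
    g⁻¹.logDenom z = -g.logDenom (g.toSL⁻¹ • z) := rfl

noncomputable instance : Group SLTilde where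
  mul_assoc g h k := by
    ext1
    · simp [mul_assoc]
    · funext z; simp [mul_smul, add_assoc]
  one_mul g := by
    ext1
    · simp
    · funext z; simp
  mul_one g := by
    ext1
    · simp
    · funext z; simp
  inv_mul_cancel g := by
    ext1
    · simp
    · funext z; simp

end SLTilde

/-- The multiplier action `π_lam` on functions on the upper half plane:
`(π_lam(g) f)(z) = (c z + d) ^ (-lam) f ((a z + b) / (c z + d))` for `g⁻¹ = (a b; c d)`, the power
being taken with the branch of the logarithm carried by `g⁻¹`. -/
noncomputable def multiplierAction (lam : ℝ) (g : SLTilde) (f : ℍ → ℂ) (z : ℍ) : ℂ :=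
  Complex.exp (-(lam : ℂ) * g⁻¹.logDenom z) * f (g⁻¹.toSL • z)

/-- The outer tensor product `π_lam₁ ⊗ π_lam₂` on functions on `ℍ × ℍ`. -/
noncomputable def multiplierAction₂ (lam₁ lam₂ : ℝ) (g : SLTilde × SLTilde) (f : ℍ → ℍ → ℂ)
    (z₁ z₂ : ℍ) : ℂ :=
  Complex.exp (-(lam₁ : ℂ) * g.1⁻¹.logDenom z₁) * Complex.exp (-(lam₂ : ℂ) * g.2⁻¹.logDenom z₂) *
    f (g.1⁻¹.toSL • z₁) (g.2⁻¹.toSL • z₂)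

/-! ### The `L²`-model -/

/-- The measure `x ^ (1 - lam) dx` on the positive half line. -/
noncomputable def halfLineMeasure (lam : ℝ) : Measure ℝ :=
  (volume.restrict (Ioi (0 : ℝ))).withDensity fun x => ENNReal.ofReal (x ^ (1 - lam))

/-- The measure `x ^ (1 - lam₁) y ^ (1 - lam₂) dx dy` on the open quadrant. -/
noncomputable def quadrantMeasure (lam₁ lam₂ : ℝ) : Measure (ℝ × ℝ) :=
  (volume.restrict (Ioi (0 : ℝ) ×ˢ Ioi (0 : ℝ))).withDensity
    fun p => ENNReal.ofReal (p.1 ^ (1 - lam₁) * p.2 ^ (1 - lam₂))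

/-- The Hilbert space `L²(ℝ₊)_lam`. -/
abbrev HalfLineL2 (lam : ℝ) : Type := Lp ℂ 2 (halfLineMeasure lam)

/-- The Hilbert space `L²(ℝ₊²)_{lam₁, lam₂}`. -/
abbrev QuadrantL2 (lam₁ lam₂ : ℝ) : Type := Lp ℂ 2 (quadrantMeasure lam₁ lam₂)

/-- The Fourier--Laplace transform `(𝓕 f)(ζ) = ∫₀^∞ f(x) e^{iζx} dx`. -/
noncomputable def fourierLaplace (f : ℝ → ℂ) (ζ : ℍ) : ℂ :=
  ∫ x in Ioi (0 : ℝ), f x * Complex.exp (Complex.I * (ζ : ℂ) * (x : ℂ))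

/-- The two-variable Fourier--Laplace transform `𝓕 ⊗ 𝓕`. -/
noncomputable def fourierLaplace₂ (F : ℝ × ℝ → ℂ) (ζ₁ ζ₂ : ℍ) : ℂ :=
  ∫ p in Ioi (0 : ℝ) ×ˢ Ioi (0 : ℝ),
    F p * Complex.exp (Complex.I * ((ζ₁ : ℂ) * (p.1 : ℂ) + (ζ₂ : ℂ) * (p.2 : ℂ)))

/-- `ρ` is the representation on `L²(ℝ₊)_lam` by unitary operators that corresponds to `π_lam`
under the Fourier--Laplace transform. -/
def IsL2Model (lam : ℝ) (ρ : SLTilde →* (HalfLineL2 lam ≃ₗᵢ[ℂ] HalfLineL2 lam)) : Prop :=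
  ∀ (g : SLTilde) (f : HalfLineL2 lam),
    fourierLaplace (ρ g f) = multiplierAction lam g (fourierLaplace f)

/-- `ρ` is the representation on `L²(ℝ₊²)_{lam₁, lam₂}` by unitary operators that corresponds to
the outer tensor product of `π_lam₁` and `π_lam₂` under the Fourier--Laplace transform. -/
def IsL2Model₂ (lam₁ lam₂ : ℝ)
    (ρ : SLTilde × SLTilde →* (QuadrantL2 lam₁ lam₂ ≃ₗᵢ[ℂ] QuadrantL2 lam₁ lam₂)) : Prop :=
  ∀ (g : SLTilde × SLTilde) (F : QuadrantL2 lam₁ lam₂),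
    fourierLaplace₂ (ρ g F) = multiplierAction₂ lam₁ lam₂ g (fourierLaplace₂ F)

open Classical in
/-- The `L²`-model of `π_lam` (meaningful when `IsL2Model lam` has a unique solution). -/
noncomputable def l2Model (lam : ℝ) : SLTilde →* (HalfLineL2 lam ≃ₗᵢ[ℂ] HalfLineL2 lam) :=
  if h : ∃ ρ, IsL2Model lam ρ then h.choose else 1

open Classical in
/-- The `L²`-model of the outer tensor product of `π_lam₁` and `π_lam₂` (meaningful when
`IsL2Model₂ lam₁ lam₂` has a unique solution). -/
noncomputable def l2Model₂ (lam₁ lam₂ : ℝ) :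
    SLTilde × SLTilde →* (QuadrantL2 lam₁ lam₂ ≃ₗᵢ[ℂ] QuadrantL2 lam₁ lam₂) :=
  if h : ∃ ρ, IsL2Model₂ lam₁ lam₂ ρ then h.choose else 1

/-! ### Jacobi polynomials, the weights and the holographic operators -/

/-- The Jacobi polynomial `P_n^{α, β}(t)`. -/
noncomputable def jacobiP (n : ℕ) (α β t : ℝ) : ℝ :=
  ∑ j ∈ Finset.range (n + 1),
    (ascPochhammer ℝ j).eval (α + β + n + 1) * (ascPochhammer ℝ (n - j)).eval (α + j + 1) /
      ((n - j).factorial * j.factorial) * ((t - 1) / 2) ^ j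

/-- The weight `c_n(lam₁, lam₂)`. -/
noncomputable def planchWeight (lam₁ lam₂ : ℝ) (n : ℕ) : ℝ :=
  Real.Gamma (lam₁ + n) * Real.Gamma (lam₂ + n) /
    ((lam₁ + lam₂ + 2 * n - 1) * Real.Gamma (lam₁ + lam₂ + n - 1) * n.factorial)

theorem planchWeight_pos {lam₁ lam₂ : ℝ} (h₁ : 1 < lam₁) (h₂ : 1 < lam₂) (n : ℕ) :
    0 < planchWeight lam₁ lam₂ n := by
  have hn : (0 : ℝ) ≤ n := n.cast_nonneg
  unfold planchWeight
  have := Real.Gamma_pos_of_pos (show 0 < lam₁ + n by linarith)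
  have := Real.Gamma_pos_of_pos (show 0 < lam₂ + n by linarith)
  have := Real.Gamma_pos_of_pos (show 0 < lam₁ + lam₂ + n - 1 by linarith)
  have : 0 < lam₁ + lam₂ + 2 * n - 1 := by linarith
  positivity

/-- The holographic operator `Φ_{lam₁, lam₂}^{lam₁ + lam₂ + 2 n}` on functions. -/
noncomputable def holographic (lam₁ lam₂ : ℝ) (n : ℕ) (h : ℝ → ℂ) (p : ℝ × ℝ) : ℂ :=
  ((p.1 ^ (lam₁ - 1) * p.2 ^ (lam₂ - 1) / (p.1 + p.2) ^ (lam₁ + lam₂ + n - 1) *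
    jacobiP n (lam₁ - 1) (lam₂ - 1) ((p.2 - p.1) / (p.1 + p.2)) : ℝ) : ℂ) * h (p.1 + p.2)

/-! ### Weighted Hilbert sums -/

section WeightedHilbertSum

variable {V : ℕ → Type*} [∀ n, NormedAddCommGroup (V n)] [∀ n, InnerProductSpace ℂ (V n)]

/-- The Hilbert sum of the spaces `V n` associated to the positive weights `a n`: the families
`v` with `∑ a n ‖v n‖² < ∞`, with the inner product `∑ a n ⟪v n, w n⟫`. -/
def WeightedHilbertSum (a : ℕ → ℝ) (ha : ∀ n, 0 < a n) (V : ℕ → Type*)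
    [∀ n, NormedAddCommGroup (V n)] [∀ n, InnerProductSpace ℂ (V n)] : Type _ :=
  ↥({ carrier := {v | Summable fun n => a n * ‖v n‖ ^ 2}
      zero_mem' := by simp
      add_mem' := fun {v w} hv hw => by
        refine Summable.of_nonneg_of_le (fun n => mul_nonneg (ha n).le (sq_nonneg _)) (fun n => ?_)
          ((hv.add hw).mul_left 2)
        have h1 : ‖(v + w) n‖ ≤ ‖v n‖ + ‖w n‖ := norm_add_le _ _
        have h2 : ‖(v + w) n‖ ^ 2 ≤ 2 * (‖v n‖ ^ 2 + ‖w n‖ ^ 2) := by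
          nlinarith [norm_nonneg ((v + w) n), sq_nonneg (‖v n‖ - ‖w n‖)]
        nlinarith [mul_le_mul_of_nonneg_left h2 (ha n).le]
      smul_mem' := fun r v hv => by
        refine (Summable.mul_left (‖r‖ ^ 2) hv).congr fun n => ?_
        simp only [Pi.smul_apply, norm_smul]
        ring } : Submodule ℂ (∀ n, V n))

namespace WeightedHilbertSum

variable {a : ℕ → ℝ} {ha : ∀ n, 0 < a n}

instance : AddCommGroup (WeightedHilbertSum a ha V) := by
  unfold WeightedHilbertSum; infer_instance

instance : Module ℂ (WeightedHilbertSum a ha V) := by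
  unfold WeightedHilbertSum; infer_instance

instance : CoeFun (WeightedHilbertSum a ha V) fun _ => ∀ n, V n := ⟨fun v => v.1⟩

theorem summable_sq (v : WeightedHilbertSum a ha V) : Summable fun n => a n * ‖v n‖ ^ 2 := v.2

@[ext] theorem ext {v w : WeightedHilbertSum a ha V} (h : ∀ n, v n = w n) : v = w :=
  Subtype.ext (funext h)

@[simp] theorem add_apply (v w : WeightedHilbertSum a ha V) (n : ℕ) : (v + w) n = v n + w n := rfl
@[simp] theorem smul_apply (r : ℂ) (v : WeightedHilbertSum a ha V) (n : ℕ) :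
    (r • v) n = r • v n := rfl
@[simp] theorem zero_apply (n : ℕ) : (0 : WeightedHilbertSum a ha V) n = 0 := rfl

theorem summable_inner (v w : WeightedHilbertSum a ha V) :
    Summable fun n => (a n : ℂ) * inner ℂ (v n) (w n) := by
  refine Summable.of_norm_bounded (v.summable_sq.add w.summable_sq) fun n => ?_
  rw [norm_mul, Complex.norm_real, Real.norm_of_nonneg (ha n).le, ← mul_add]
  refine mul_le_mul_of_nonneg_left ?_ (ha n).le
  have h := norm_inner_le_norm (𝕜 := ℂ) (v n) (w n)
  nlinarith [sq_nonneg (‖v n‖ - ‖w n‖), norm_nonneg (v n), norm_nonneg (w n)]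

noncomputable instance : Inner ℂ (WeightedHilbertSum a ha V) where
  inner v w := ∑' n, (a n : ℂ) * inner ℂ (v n) (w n)

theorem inner_def (v w : WeightedHilbertSum a ha V) :
    inner ℂ v w = ∑' n, (a n : ℂ) * inner ℂ (v n) (w n) := rfl

theorem inner_self_eq (v : WeightedHilbertSum a ha V) :
    inner ℂ v v = ((∑' n, a n * ‖v n‖ ^ 2 : ℝ) : ℂ) := by
  rw [inner_def, Complex.ofReal_tsum]
  refine tsum_congr fun n => ?_
  rw [inner_self_eq_norm_sq_to_K]
  push_cast
  rfl

/-- The inner product axioms. -/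
noncomputable abbrev core : InnerProductSpace.Core ℂ (WeightedHilbertSum a ha V) where
  conj_inner_symm v w := by
    rw [inner_def, inner_def, Complex.conj_tsum]
    refine tsum_congr fun n => ?_
    rw [map_mul, Complex.conj_ofReal, inner_conj_symm]
  re_inner_nonneg v := by
    rw [inner_self_eq]
    exact tsum_nonneg fun n => mul_nonneg (ha n).le (sq_nonneg _)
  add_left u v w := by
    rw [inner_def, inner_def, inner_def, ← (summable_inner u w).tsum_add (summable_inner v w)]
    refine tsum_congr fun n => ?_
    rw [add_apply, inner_add_left, mul_add]
  smul_left v w r := by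
    rw [inner_def, inner_def, ← tsum_mul_left]
    refine tsum_congr fun n => ?_
    rw [smul_apply, inner_smul_left]
    ring
  definite v hv := by
    rw [inner_self_eq, Complex.ofReal_eq_zero] at hv
    have h := (hasSum_zero_iff_of_nonneg fun n => mul_nonneg (ha n).le (sq_nonneg ‖v n‖)).1
      (hv ▸ v.summable_sq.hasSum)
    ext n
    have hn := congrFun h n
    simpa [(ha n).ne'] using hn

noncomputable instance : NormedAddCommGroup (WeightedHilbertSum a ha V) := core.toNormedAddCommGroup

noncomputable instance : InnerProductSpace ℂ (WeightedHilbertSum a ha V) :=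
  InnerProductSpace.ofCore core.toCore

/-- The family with the single entry `u` in position `n`. -/
def single (n : ℕ) (u : V n) : WeightedHilbertSum a ha V :=
  ⟨Pi.single n u, by
    refine summable_of_ne_finset_zero (s := {n}) fun m hm => ?_
    have hm' : m ≠ n := by simpa using hm
    simp [Pi.single_eq_of_ne hm']⟩

/-- The direct sum of unitary operators `U n` on the summands. -/
def map (U : ∀ n, V n ≃ₗᵢ[ℂ] V n) (v : WeightedHilbertSum a ha V) : WeightedHilbertSum a ha V :=
  ⟨fun n => U n (v n), by
    change Summable fun n => a n * ‖U n (v n)‖ ^ 2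
    simpa only [LinearIsometryEquiv.norm_map] using v.summable_sq⟩

end WeightedHilbertSum

end WeightedHilbertSum

/-! Everything is tested against reproducing kernels. On `L²(ℝ₊)_lam` the functional `f ↦ 𝓕 f (z)`
is the inner product with a vector `laplaceKernel h z`. These vectors are total by Fourier
uniqueness, and the Gamma integral gives their Gram matrix as `Γ(lam) (-i (z - w̄)) ^ (-lam)`. The
group multiplies this kernel by the multipliers of `π_lam`. A total family whose Gram matrix is
preserved in this way carries exactly one compatible unitary representation
(`existsUnique_unitary_of_multiplier`). This settles both `L²`-models, and equivariance reduces to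
scalar identities between kernels.

Unitarity comes from the coordinates `t = x + y`, `v = (y - x) / (x + y)`. In them the inner product
of `Φ_n h` and `Φ_m h'` splits into an integral over `t` times the Jacobi inner product of `P_n` and
`P_m` over `(-1, 1)`. Orthogonality of the Jacobi polynomials makes the ranges orthogonal, and their
norms give the weights (`inner_holographicL2_self`). The ranges span: a function `F` orthogonal to
all of them is, after multiplication by `e ^ (-t)` and the Jacobian, orthogonal to every `e ^ (iξt)
v ^ m`, so its Fourier transform on the strip vanishes (`eq_zero_of_inner_holographicL2_eq_zero`).

Equivariance rests on one computation, `inner_laplaceKernel₂_holographicL2`. The integrated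
Rodrigues formula shows that `𝓕 ⊗ 𝓕` sends `Φ_n k_w` to a constant times `(z₂ - z₁) ^ n (-i (z₁ -
w̄)) ^ (-lam₁ - n) (-i (z₂ - w̄)) ^ (-lam₂ - n)`. Each factor has an explicit transformation law
under the diagonal group, and the exponents of the multipliers add up correctly. -/

/-! ### Unitary representations from total families and their Gram matrices. -/

section HilbertSpaceReconstruction

variable {X H K : Type*} [NormedAddCommGroup H] [InnerProductSpace ℂ H]
  [NormedAddCommGroup K] [InnerProductSpace ℂ K]

theorem denseRange_linearCombination {k : X → H}
    (hk : (Submodule.span ℂ (range k)).topologicalClosure = ⊤) :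
    DenseRange (Finsupp.linearCombination ℂ k) := by
  rw [DenseRange, ← LinearMap.coe_range, Finsupp.range_linearCombination]
  exact (Submodule.dense_iff_topologicalClosure_eq_top).2 hk

theorem inner_linearCombination_eq {k : X → H} {k' : X → K}
    (h : ∀ x y, inner ℂ (k' x) (k' y) = inner ℂ (k x) (k y)) (c d : X →₀ ℂ) :
    inner ℂ (Finsupp.linearCombination ℂ k' c) (Finsupp.linearCombination ℂ k' d) =
      inner ℂ (Finsupp.linearCombination ℂ k c) (Finsupp.linearCombination ℂ k d) := by
  simp only [Finsupp.linearCombination_apply, Finsupp.sum, sum_inner, inner_sum, inner_smul_left,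
    inner_smul_right, h]

/-- Two families with the same Gram matrix, the first of them total, are related by a linear
isometry. -/
theorem exists_linearIsometry_of_inner_eq [CompleteSpace K] {k : X → H} {k' : X → K}
    (hk : (Submodule.span ℂ (range k)).topologicalClosure = ⊤)
    (h : ∀ x y, inner ℂ (k' x) (k' y) = inner ℂ (k x) (k y)) :
    ∃ V : H →ₗᵢ[ℂ] K, ∀ x, V (k x) = k' x := by
  have hd := denseRange_linearCombination hk
  have hn : ∀ c, ‖Finsupp.linearCombination ℂ k' c‖ = ‖Finsupp.linearCombination ℂ k c‖ := by
    intro c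
    rw [@norm_eq_sqrt_re_inner ℂ, @norm_eq_sqrt_re_inner ℂ, inner_linearCombination_eq h]
  have hb : ∃ C, ∀ c, ‖Finsupp.linearCombination ℂ k' c‖ ≤
      C * ‖Finsupp.linearCombination ℂ k c‖ := ⟨1, fun c => by rw [hn, one_mul]⟩
  set W := (Finsupp.linearCombination ℂ k').extendOfNorm (Finsupp.linearCombination ℂ k)
  have hW : ∀ c, W (Finsupp.linearCombination ℂ k c) = Finsupp.linearCombination ℂ k' c :=
    fun c => LinearMap.extendOfNorm_eq hd hb c
  refine ⟨⟨W.toLinearMap, fun f => ?_⟩, fun x => ?_⟩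
  · refine hd.induction_on (p := fun f => ‖W f‖ = ‖f‖) f
      (isClosed_eq W.continuous.norm continuous_norm) fun c => ?_
    rw [hW, hn]
  · have := hW (Finsupp.single x 1)
    simpa using this

theorem eq_of_forall_inner_eq {k : X → H}
    (hk : (Submodule.span ℂ (range k)).topologicalClosure = ⊤) {f f' : H}
    (h : ∀ x, inner ℂ (k x) f = inner ℂ (k x) f') : f = f' := by
  refine (denseRange_linearCombination hk).eq_of_inner_left ℂ ?_
  intro c
  rw [← inner_conj_symm, ← inner_conj_symm f']
  simp only [Finsupp.linearCombination_apply, Finsupp.sum, sum_inner, inner_smul_left, h]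

theorem topologicalClosure_span_eq_top [CompleteSpace H] {k : X → H}
    (h : ∀ f, (∀ x, inner ℂ (k x) f = 0) → f = 0) :
    (Submodule.span ℂ (range k)).topologicalClosure = ⊤ := by
  rw [Submodule.topologicalClosure_eq_top_iff, Submodule.eq_bot_iff]
  refine fun f hf => h f fun x => ?_
  exact hf _ (Submodule.subset_span ⟨x, rfl⟩)

/-- A multiplier system that preserves a positive definite kernel gives a unique unitary
representation on the Hilbert space of the kernel. -/
theorem existsUnique_unitary_of_multiplier [CompleteSpace H] {G : Type*} [Group G] {k : X → H}
    (hk : (Submodule.span ℂ (range k)).topologicalClosure = ⊤) (m : G → X → ℂ) (s : G → X → X)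
    (hm1 : ∀ x, m 1 x = 1) (hs1 : ∀ x, s 1 x = x)
    (hm : ∀ g h x, m (g * h) x = m g x * m h (s g x))
    (hs : ∀ g h x, s (g * h) x = s h (s g x))
    (hG : ∀ g x y, m g x * conj (m g y) * inner ℂ (k (s g x)) (k (s g y)) = inner ℂ (k x) (k y)) :
    ∃! ρ : G →* (H ≃ₗᵢ[ℂ] H), ∀ g f x, inner ℂ (k x) (ρ g f) = m g x * inner ℂ (k (s g x)) f := by
  have hV : ∀ g, ∃ V : H →ₗᵢ[ℂ] H, ∀ x, V (k x) = conj (m g x) • k (s g x) := fun g =>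
    exists_linearIsometry_of_inner_eq hk fun x y => by
      rw [inner_smul_left, inner_smul_right, Complex.conj_conj, ← mul_assoc, hG]
  choose V hV using hV
  have ext : ∀ A B : H →ₗᵢ[ℂ] H, (∀ x, A (k x) = B (k x)) → ∀ f, A f = B f := by
    intro A B hAB f
    refine (denseRange_linearCombination hk).induction_on (p := fun f => A f = B f) f
      (isClosed_eq A.continuous B.continuous) fun c => ?_
    simp only [Finsupp.linearCombination_apply, Finsupp.sum, map_sum, map_smul, hAB]
  have hmul : ∀ g h f, V h (V g f) = V (g * h) f := fun g h f =>
    ext ((V h).comp (V g)) (V (g * h)) (fun x => by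
      change V h (V g (k x)) = V (g * h) (k x)
      simp only [hV, map_smul, hm, hs, map_mul, smul_smul]) f
  have hone : ∀ f, V 1 f = f := fun f => ext (V 1) LinearIsometry.id (fun x => by
      simp [hV, hm1, hs1]) f
  -- The required identity says that the adjoint of `ρ g` sends `k x` to `conj (m g x) • k (s g x)`,
  -- so `V g` is that adjoint. As `s` is a right action, `V` reverses products; hence `ρ g` is `V
  -- g⁻¹`.
  let U : G → (H ≃ₗᵢ[ℂ] H) := fun g =>
    { toLinearEquiv := LinearEquiv.ofLinearMap (V g⁻¹).toLinearMap (V g).toLinearMap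
        (by ext f; simp [hmul, hone]) (by ext f; simp [hmul, hone])
      norm_map' := fun f => (V g⁻¹).norm_map f }
  have hU : ∀ g f, U g f = V g⁻¹ f := fun g f => rfl
  refine ⟨⟨⟨U, ?_⟩, ?_⟩, ?_, ?_⟩
  · ext f; simp [hU, hone]
  · intro g h; ext f; simp [hU, hmul]
  · intro g f x
    change inner ℂ (k x) (V g⁻¹ f) = _
    rw [← (V g).inner_map_map, hmul, inv_mul_cancel, hone, hV, inner_smul_left, Complex.conj_conj]
  · intro ρ hρ
    ext g f
    refine eq_of_forall_inner_eq hk fun x => ?_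
    rw [hρ]
    change _ = inner ℂ (k x) (V g⁻¹ f)
    symm
    rw [← (V g).inner_map_map, hmul, inv_mul_cancel, hone, hV, inner_smul_left, Complex.conj_conj]

/-- The adjoint of `ρ g` is `ρ g⁻¹`, so the action on kernels is read off from the matrix
coefficients of the inverse element. -/
theorem unitary_apply_kernel {G : Type*} [Group G] {k : X → H}
    (hk : (Submodule.span ℂ (range k)).topologicalClosure = ⊤) {m : G → X → ℂ} {s : G → X → X}
    {ρ : G →* (H ≃ₗᵢ[ℂ] H)}
    (hρ : ∀ g f x, inner ℂ (k x) (ρ g f) = m g x * inner ℂ (k (s g x)) f) (g : G) (w : X) :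
    ρ g (k w) = conj (m g⁻¹ w) • k (s g⁻¹ w) := by
  refine eq_of_forall_inner_eq hk fun x => ?_
  have h : inner ℂ (k x) (ρ g (k w)) = inner ℂ (ρ g⁻¹ (k x)) (k w) := by
    have h1 : ρ g⁻¹ (ρ g (k w)) = k w := by
      change (ρ g⁻¹ * ρ g) (k w) = k w
      rw [← map_mul, inv_mul_cancel, map_one]
      rfl
    rw [← (ρ g⁻¹).inner_map_map, h1]
  rw [h, ← inner_conj_symm, hρ, map_mul, inner_conj_symm, inner_smul_right]

end HilbertSpaceReconstruction

/-! ### Jacobi polynomials: Rodrigues formula, orthogonality and norms. -/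

section JacobiPolynomials

/-- The coefficient of `((t - 1) / 2) ^ j` in the Jacobi polynomial `P_n^{α, β}(t)`. -/
noncomputable def jacobiCoeff (n : ℕ) (α β : ℝ) (j : ℕ) : ℝ :=
  (ascPochhammer ℝ j).eval (α + β + n + 1) * (ascPochhammer ℝ (n - j)).eval (α + j + 1) /
    ((n - j).factorial * j.factorial)

theorem jacobiP_eq_sum (n : ℕ) (α β t : ℝ) :
    jacobiP n α β t = ∑ j ∈ Finset.range (n + 1), jacobiCoeff n α β j * ((t - 1) / 2) ^ j := rfl

theorem ascPochhammer_eval_succ_left (k : ℕ) (x : ℝ) :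
    (ascPochhammer ℝ (k + 1)).eval x = x * (ascPochhammer ℝ k).eval (x + 1) := by
  rw [ascPochhammer_succ_left, Polynomial.eval_mul, Polynomial.eval_comp]
  simp

/-- This and the next two lemmas are the lowest, highest and middle coefficients of one recurrence,
`jacobiP_succ`. The extreme ones are separate because a neighbouring coefficient is then missing. -/
theorem jacobiCoeff_succ_zero (n : ℕ) (α β : ℝ) :
    (n + 1) * jacobiCoeff (n + 1) α β 0 = (α + 1) * jacobiCoeff n (α + 1) (β + 1) 0 := by
  simp only [jacobiCoeff, Nat.sub_zero, Nat.factorial_succ, Nat.cast_zero, add_zero,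
    ascPochhammer_eval_succ_left n]
  have := Nat.cast_ne_zero (R := ℝ).2 n.factorial_ne_zero
  have h : (n : ℝ) + 1 ≠ 0 := by positivity
  push_cast
  simp only [ascPochhammer_zero, Polynomial.eval_one, Nat.factorial_zero]
  field_simp

theorem jacobiCoeff_succ_self (n : ℕ) (α β : ℝ) :
    (n + 1) * jacobiCoeff (n + 1) α β (n + 1) =
      (α + β + 2 + n) * jacobiCoeff n (α + 1) (β + 1) n := by
  simp only [jacobiCoeff, Nat.sub_self, Nat.factorial_succ, ascPochhammer_eval_succ_left n]
  have := Nat.cast_ne_zero (R := ℝ).2 n.factorial_ne_zero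
  have h : (n : ℝ) + 1 ≠ 0 := by positivity
  have e : α + β + ((n + 1 : ℕ) : ℝ) + 1 + 1 = α + 1 + (β + 1) + n + 1 := by push_cast; ring
  rw [e]
  push_cast
  simp only [ascPochhammer_zero, Polynomial.eval_one, Nat.factorial_zero]
  field_simp
  ring

theorem jacobiCoeff_succ_succ {n j : ℕ} (hj : j < n) (α β : ℝ) :
    (n + 1) * jacobiCoeff (n + 1) α β (j + 1) =
      (α + 1 + (j + 1)) * jacobiCoeff n (α + 1) (β + 1) (j + 1) +
        (α + β + 2 + j) * jacobiCoeff n (α + 1) (β + 1) j := by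
  obtain ⟨r, rfl⟩ := Nat.exists_eq_add_of_lt hj
  have e1 : j + r + 1 + 1 - (j + 1) = r + 1 := by omega
  have e2 : j + r + 1 - (j + 1) = r := by omega
  have e3 : j + r + 1 - j = r + 1 := by omega
  have c1 : α + β + ((j + r + 1 + 1 : ℕ) : ℝ) + 1 + 1 =
      α + 1 + (β + 1) + ((j + r + 1 : ℕ) : ℝ) + 1 := by push_cast; ring
  have c2 : α + ((j + 1 : ℕ) : ℝ) + 1 + 1 = α + 1 + ((j + 1 : ℕ) : ℝ) + 1 := by ring
  have c3 : α + 1 + (j : ℝ) + 1 + 1 = α + 1 + ((j + 1 : ℕ) : ℝ) + 1 := by push_cast; ring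
  have d1 : (ascPochhammer ℝ (j + 1)).eval (α + 1 + (β + 1) + ((j + r + 1 : ℕ) : ℝ) + 1) =
      (ascPochhammer ℝ j).eval (α + 1 + (β + 1) + ((j + r + 1 : ℕ) : ℝ) + 1) *
        (α + 1 + (β + 1) + ((j + r + 1 : ℕ) : ℝ) + 1 + j) := ascPochhammer_succ_eval _ _
  simp only [jacobiCoeff, e1, e2, e3]
  rw [d1]
  simp only [ascPochhammer_eval_succ_left, c1, c2, c3, Nat.factorial_succ]
  have h1 := Nat.cast_ne_zero (R := ℝ).2 j.factorial_ne_zero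
  have h2 := Nat.cast_ne_zero (R := ℝ).2 r.factorial_ne_zero
  have h3 : (j : ℝ) + 1 ≠ 0 := by positivity
  have h4 : (r : ℝ) + 1 ≠ 0 := by positivity
  push_cast
  field_simp
  ring

/-- For `j = 0` the truncated exponent `j - 1` does no harm, because of the factor `j`. -/
theorem hasDerivAt_jacobiP (n : ℕ) (α β t : ℝ) :
    HasDerivAt (jacobiP n α β) (∑ j ∈ Finset.range (n + 1),
      jacobiCoeff n α β j * (j * ((t - 1) / 2) ^ (j - 1) * (1 / 2))) t := by
  have : jacobiP n α β = fun t => ∑ j ∈ Finset.range (n + 1),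
      jacobiCoeff n α β j * ((t - 1) / 2) ^ j := funext fun t => jacobiP_eq_sum n α β t
  rw [this]
  refine HasDerivAt.fun_sum fun j _ => HasDerivAt.const_mul _ ?_
  exact (((hasDerivAt_id t).sub_const 1).div_const 2).pow j

theorem continuous_jacobiP (n : ℕ) (α β : ℝ) : Continuous (jacobiP n α β) :=
  continuous_iff_continuousAt.2 fun t => (hasDerivAt_jacobiP n α β t).continuousAt

/-- With `s = (t - 1) / 2`, the last sum is the `t`-derivative of `P_n^{α+1, β+1}`. This is the
Leibniz expansion behind the raising relation of the next theorem, checked coefficientwise in powers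
of `s`. -/
theorem jacobiP_succ (n : ℕ) (α β t : ℝ) :
    (n + 1) * jacobiP (n + 1) α β t =
      (α + 1 + (α + β + 2) * ((t - 1) / 2)) * jacobiP n (α + 1) (β + 1) t +
        2 * (((t - 1) / 2) * (1 + (t - 1) / 2)) * ∑ j ∈ Finset.range (n + 1),
          jacobiCoeff n (α + 1) (β + 1) j * (j * ((t - 1) / 2) ^ (j - 1) * (1 / 2)) := by
  set s := (t - 1) / 2 with hs
  have hR : (n + 1) * jacobiP (n + 1) α β t =
      (∑ j ∈ Finset.range (n + 1), (α + 1 + j) * jacobiCoeff n (α + 1) (β + 1) j * s ^ j) +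
      ∑ j ∈ Finset.range (n + 1),
        (α + β + 2 + j) * jacobiCoeff n (α + 1) (β + 1) j * s ^ (j + 1) := by
    rw [jacobiP_eq_sum, Finset.mul_sum, Finset.sum_range_succ, Finset.sum_range_succ',
      Finset.sum_range_succ' (fun j => (α + 1 + j) * jacobiCoeff n (α + 1) (β + 1) j * s ^ j),
      Finset.sum_range_succ
        (fun j => (α + β + 2 + j) * jacobiCoeff n (α + 1) (β + 1) j * s ^ (j + 1)),
      ← hs]
    have h : ∑ j ∈ Finset.range n, ((n : ℝ) + 1) * (jacobiCoeff (n + 1) α β (j + 1) * s ^ (j + 1)) =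
        (∑ j ∈ Finset.range n, (α + 1 + ((j + 1 : ℕ) : ℝ)) *
          jacobiCoeff n (α + 1) (β + 1) (j + 1) * s ^ (j + 1)) +
        ∑ j ∈ Finset.range n,
          (α + β + 2 + j) * jacobiCoeff n (α + 1) (β + 1) j * s ^ (j + 1) := by
      rw [← Finset.sum_add_distrib]
      refine Finset.sum_congr rfl fun j hj => ?_
      rw [← mul_assoc, jacobiCoeff_succ_succ (Finset.mem_range.1 hj)]
      push_cast
      ring
    rw [h, ← mul_assoc, jacobiCoeff_succ_zero, ← mul_assoc, jacobiCoeff_succ_self]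
    push_cast
    ring
  rw [hR, jacobiP_eq_sum, ← hs, Finset.mul_sum, Finset.mul_sum, ← Finset.sum_add_distrib,
    ← Finset.sum_add_distrib]
  refine Finset.sum_congr rfl fun j _ => ?_
  rcases j with _ | j
  · simp; ring
  · simp only [Nat.add_sub_cancel]
    push_cast
    ring

/-- One step of the Rodrigues formula: differentiation lowers both exponents of the weight by one
and raises the degree by one. -/
theorem hasDerivAt_weight_mul_jacobiP (n : ℕ) (α β : ℝ) {v : ℝ} (hv : v ∈ Ioo (-1 : ℝ) 1) :
    HasDerivAt (fun v => (1 - v) ^ (α + 1) * (1 + v) ^ (β + 1) * jacobiP n (α + 1) (β + 1) v)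
      (-(2 * (n + 1)) * ((1 - v) ^ α * (1 + v) ^ β * jacobiP (n + 1) α β v)) v := by
  have h1 : 0 < 1 - v := by linarith [hv.2]
  have h2 : 0 < 1 + v := by linarith [hv.1]
  have d1 := ((hasDerivAt_id v).const_sub 1).rpow_const (p := α + 1) (Or.inl h1.ne')
  have d2 := ((hasDerivAt_id v).const_add 1).rpow_const (p := β + 1) (Or.inl h2.ne')
  refine ((d1.mul d2).mul (hasDerivAt_jacobiP n (α + 1) (β + 1) v)).congr_deriv ?_
  have e := jacobiP_succ n α β v
  have e' : -(2 * ((n : ℝ) + 1)) * ((1 - v) ^ α * (1 + v) ^ β * jacobiP (n + 1) α β v) =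
    -2 * ((1 - v) ^ α * (1 + v) ^ β) * ((n + 1) * jacobiP (n + 1) α β v) := by ring
  rw [e', e]
  simp only [id, add_sub_cancel_right, Pi.mul_apply]
  rw [Real.rpow_add_one h1.ne', Real.rpow_add_one h2.ne']
  ring

theorem continuous_jacobiWeight {α β : ℝ} (hα : 0 ≤ α) (hβ : 0 ≤ β) :
    Continuous fun v : ℝ => (1 - v) ^ α * (1 + v) ^ β :=
  ((continuous_const.sub continuous_id).rpow_const fun _ => Or.inr hα).mul
    ((continuous_const.add continuous_id).rpow_const fun _ => Or.inr hβ)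

variable {E : Type*} [NormedAddCommGroup E] [NormedSpace ℝ E] [CompleteSpace E]

theorem integral_jacobiP_succ_smul (n : ℕ) {α β : ℝ} (hα : 0 ≤ α) (hβ : 0 ≤ β) {φ φ' : ℝ → E}
    (hφ : ∀ v, HasDerivAt φ (φ' v) v) (hφ' : Continuous φ') :
    ∫ v in (-1 : ℝ)..1, ((1 - v) ^ α * (1 + v) ^ β * jacobiP (n + 1) α β v) • φ v =
      (1 / (2 * (n + 1)) : ℝ) • ∫ v in (-1 : ℝ)..1,
        ((1 - v) ^ (α + 1) * (1 + v) ^ (β + 1) * jacobiP n (α + 1) (β + 1) v) • φ' v := by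
  have cφ : Continuous φ := continuous_iff_continuousAt.2 fun v => (hφ v).continuousAt
  have cw := continuous_jacobiWeight hα hβ
  have cw' := continuous_jacobiWeight (add_nonneg hα zero_le_one) (add_nonneg hβ zero_le_one)
  have cp := continuous_jacobiP (n + 1) α β
  have cp' := continuous_jacobiP n (α + 1) (β + 1)
  have i1 : IntervalIntegrable (fun v => (-(2 * ((n : ℝ) + 1)) *
      ((1 - v) ^ α * (1 + v) ^ β * jacobiP (n + 1) α β v)) • φ v) volume (-1) 1 :=
    ((continuous_const.mul (cw.mul cp)).smul cφ).intervalIntegrable _ _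
  have i2 : IntervalIntegrable (fun v => ((1 - v) ^ (α + 1) * (1 + v) ^ (β + 1) *
      jacobiP n (α + 1) (β + 1) v) • φ' v) volume (-1) 1 :=
    ((cw'.mul cp').smul hφ').intervalIntegrable _ _
  have key := intervalIntegral.integral_eq_sub_of_hasDerivAt_of_le (a := (-1 : ℝ)) (b := 1)
    (by norm_num) ((cw'.mul cp').smul cφ).continuousOn
    (fun v hv => (hasDerivAt_weight_mul_jacobiP n α β hv).smul (hφ v)) (i2.add i1)
  have z1 : (0 : ℝ) ^ (α + 1) = 0 := Real.zero_rpow (by positivity)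
  have z2 : (0 : ℝ) ^ (β + 1) = 0 := Real.zero_rpow (by positivity)
  rw [intervalIntegral.integral_add i2 i1] at key
  -- The boundary terms vanish because the exponents `α + 1` and `β + 1` are positive.
  have hb : ∀ x : ℝ × ℝ, x = (1, -1) →
      ((1 - x.1) ^ (α + 1) * (1 + x.1) ^ (β + 1) * jacobiP n (α + 1) (β + 1) x.1) • φ x.1 -
      ((1 - x.2) ^ (α + 1) * (1 + x.2) ^ (β + 1) * jacobiP n (α + 1) (β + 1) x.2) • φ x.2 = 0 := by
    rintro _ rfl
    simp only [sub_self, add_neg_cancel, z1, z2, zero_mul, mul_zero, zero_smul]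
  replace key := key.trans (hb _ rfl)
  have hs : ∫ v in (-1 : ℝ)..1, (-(2 * ((n : ℝ) + 1)) *
      ((1 - v) ^ α * (1 + v) ^ β * jacobiP (n + 1) α β v)) • φ v =
      (-(2 * ((n : ℝ) + 1))) • ∫ v in (-1 : ℝ)..1,
        ((1 - v) ^ α * (1 + v) ^ β * jacobiP (n + 1) α β v) • φ v := by
    rw [← intervalIntegral.integral_smul]
    simp only [mul_smul]
  rw [hs] at key
  have hn : (2 * ((n : ℝ) + 1)) ≠ 0 := by positivity
  rw [eq_neg_of_add_eq_zero_left key, _root_.neg_smul, neg_neg, smul_smul, one_div, inv_mul_cancel₀ hn,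
    one_smul]

/-- Integrated Rodrigues formula. -/
theorem integral_jacobiP_smul (n : ℕ) {α β : ℝ} (hα : 0 ≤ α) (hβ : 0 ≤ β) {φ : ℕ → ℝ → E}
    (hφ : ∀ k v, HasDerivAt (φ k) (φ (k + 1) v) v) :
    ∫ v in (-1 : ℝ)..1, ((1 - v) ^ α * (1 + v) ^ β * jacobiP n α β v) • φ 0 v =
      (1 / (2 ^ n * n.factorial) : ℝ) • ∫ v in (-1 : ℝ)..1,
        ((1 - v) ^ (α + n) * (1 + v) ^ (β + n)) • φ n v := by
  induction n generalizing α β φ with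
  | zero => simp [jacobiP]
  | succ n ih =>
    have hc : Continuous (φ 1) := continuous_iff_continuousAt.2 fun v => (hφ 1 v).continuousAt
    rw [integral_jacobiP_succ_smul n hα hβ (hφ 0) hc,
      ih (α := α + 1) (β := β + 1) (by positivity) (by positivity) (φ := fun k => φ (k + 1))
        (fun k v => hφ (k + 1) v), smul_smul]
    have e1 : α + ((n + 1 : ℕ) : ℝ) = α + 1 + n := by push_cast; ring
    have e2 : β + ((n + 1 : ℕ) : ℝ) = β + 1 + n := by push_cast; ring
    rw [e1, e2]
    congr 1
    rw [Nat.factorial_succ]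
    push_cast
    have := Nat.cast_ne_zero (R := ℝ).2 n.factorial_ne_zero
    field_simp
    ring

/-- Rodrigues moves `n` derivatives onto `P_m`. They kill it if `m < n`, and leave only its leading
coefficient if `m = n`. -/
theorem integral_jacobiP_mul_jacobiP {m n : ℕ} (hmn : m ≤ n) {α β : ℝ} (hα : 0 ≤ α) (hβ : 0 ≤ β) :
    ∫ v in (-1 : ℝ)..1, (1 - v) ^ α * (1 + v) ^ β * jacobiP n α β v * jacobiP m α β v =
      if m = n then jacobiCoeff n α β n / 4 ^ n *
        ∫ v in (-1 : ℝ)..1, (1 - v) ^ (α + n) * (1 + v) ^ (β + n) else 0 := by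
  -- `φ k` is the `k`-th derivative of `P_m`; where `j - k` is truncated, the falling factorial is
  -- zero.
  let φ : ℕ → ℝ → ℝ := fun k v => ∑ j ∈ Finset.range (m + 1), jacobiCoeff m α β j *
    (j.descFactorial k * (1 / 2) ^ k * ((v - 1) / 2) ^ (j - k))
  have hφ : ∀ k v, HasDerivAt (φ k) (φ (k + 1) v) v := fun k v => by
    refine HasDerivAt.fun_sum fun j _ => HasDerivAt.const_mul _ ?_
    refine ((((hasDerivAt_id v).sub_const 1).div_const 2).pow (j - k)).const_mul _
      |>.congr_deriv ?_
    rw [Nat.descFactorial_succ, ← Nat.sub_sub, id]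
    push_cast
    ring
  have h0 : ∀ v, φ 0 v = jacobiP m α β v := fun v => by simp [φ, jacobiP_eq_sum]
  have key := integral_jacobiP_smul n hα hβ hφ
  simp only [h0, smul_eq_mul] at key
  rw [key]
  split_ifs with h
  · subst h
    have hm : ∀ v, φ m v = jacobiCoeff m α β m * (m.factorial * (1 / 2) ^ m) := fun v => by
      simp only [φ]
      rw [Finset.sum_range_succ, Finset.sum_eq_zero fun j hj => ?_]
      · simp [Nat.descFactorial_self]
      · rw [Nat.descFactorial_of_lt (Finset.mem_range.1 hj)]
        simp
    simp only [hm, intervalIntegral.integral_mul_const]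
    have := Nat.cast_ne_zero (R := ℝ).2 m.factorial_ne_zero
    have e : (4 : ℝ) ^ m = 2 ^ m * 2 ^ m := by rw [← mul_pow]; norm_num
    rw [e, one_div_pow]
    field_simp
  · have hz : ∀ v, φ n v = 0 := fun v => Finset.sum_eq_zero fun j hj => by
      rw [Nat.descFactorial_of_lt (by have := Finset.mem_range.1 hj; omega)]
      simp
    simp [hz]

/-- The Beta integral after the substitution `v = 2 x - 1`. -/
theorem integral_one_sub_rpow_mul_one_add_rpow {a b : ℝ} (ha : 0 ≤ a) (hb : 0 ≤ b) :
    ∫ v in (-1 : ℝ)..1, (1 - v) ^ a * (1 + v) ^ b =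
      2 ^ (a + b + 1) * (Real.Gamma (a + 1) * Real.Gamma (b + 1) / Real.Gamma (a + b + 2)) := by
  have h1 := intervalIntegral.integral_comp_mul_sub (a := 0) (b := 1)
    (fun v : ℝ => (1 - v) ^ a * (1 + v) ^ b) two_ne_zero 1
  have h2 : ∫ x in (0 : ℝ)..1, (1 - (2 * x - 1)) ^ a * (1 + (2 * x - 1)) ^ b =
      2 ^ (a + b) * ∫ x in (0 : ℝ)..1, x ^ b * (1 - x) ^ a := by
    rw [← intervalIntegral.integral_const_mul]
    refine intervalIntegral.integral_congr fun x hx => ?_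
    rw [uIcc_of_le zero_le_one] at hx
    have e1 : 1 - (2 * x - 1) = 2 * (1 - x) := by ring
    have e2 : 1 + (2 * x - 1) = 2 * x := by ring
    simp only [e1, e2]
    rw [Real.mul_rpow two_pos.le (by linarith [hx.2]), Real.mul_rpow two_pos.le hx.1,
      Real.rpow_add two_pos]
    ring
  have h3 : ((∫ x in (0 : ℝ)..1, x ^ b * (1 - x) ^ a : ℝ) : ℂ) =
      Complex.betaIntegral ((b + 1 : ℝ) : ℂ) ((a + 1 : ℝ) : ℂ) := by
    rw [Complex.betaIntegral, ← intervalIntegral.integral_ofReal]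
    refine intervalIntegral.integral_congr fun x hx => ?_
    rw [uIcc_of_le zero_le_one] at hx
    simp only [Complex.ofReal_mul]
    rw [Complex.ofReal_cpow hx.1, Complex.ofReal_cpow (by linarith [hx.2])]
    push_cast
    simp
  have h4 := Complex.Gamma_mul_Gamma_eq_betaIntegral (s := ((b + 1 : ℝ) : ℂ))
    (t := ((a + 1 : ℝ) : ℂ)) (by simpa using by linarith) (by simpa using by linarith)
  rw [← h3, ← Complex.ofReal_add, Complex.Gamma_ofReal, Complex.Gamma_ofReal,
    Complex.Gamma_ofReal] at h4
  norm_cast at h4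
  have e : b + 1 + (a + 1) = a + b + 2 := by ring
  rw [e] at h4
  have hG := (Real.Gamma_pos_of_pos (show 0 < a + b + 2 by linarith)).ne'
  rw [h2] at h1
  have e0 : (2 : ℝ) * 0 - 1 = -1 := by norm_num
  have e1 : (2 : ℝ) * 1 - 1 = 1 := by norm_num
  rw [e0, e1, smul_eq_mul] at h1
  have h5 : ∫ v in (-1 : ℝ)..1, (1 - v) ^ a * (1 + v) ^ b =
      2 * (2 ^ (a + b) * ∫ x in (0 : ℝ)..1, x ^ b * (1 - x) ^ a) := by rw [h1]; ring
  rw [h5, Real.rpow_add_one two_ne_zero, mul_comm (Real.Gamma (a + 1)), h4]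
  field_simp

theorem Gamma_add_natCast_eq_ascPochhammer_mul {x : ℝ} (hx : 0 < x) (k : ℕ) :
    Real.Gamma (x + k) = (ascPochhammer ℝ k).eval x * Real.Gamma x := by
  induction k with
  | zero => simp
  | succ k ih =>
    rw [Nat.cast_succ, ← add_assoc, Real.Gamma_add_one (by positivity), ih, ascPochhammer_succ_eval]
    ring

/-- The Pochhammer symbol in the leading coefficient cancels against `Γ(lam₁ + lam₂ + 2 n)` from the
Beta integral, leaving `Γ(lam₁ + lam₂ + n - 1)` and one linear factor. The two powers `4 ^ n` cancel
as well. -/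
theorem integral_jacobiP_sq_eq_planchWeight {lam₁ lam₂ : ℝ} (h₁ : 1 < lam₁) (h₂ : 1 < lam₂)
    (n : ℕ) :
    ∫ v in (-1 : ℝ)..1, (1 - v) ^ (lam₁ - 1) * (1 + v) ^ (lam₂ - 1) *
        jacobiP n (lam₁ - 1) (lam₂ - 1) v * jacobiP n (lam₁ - 1) (lam₂ - 1) v =
      2 ^ (lam₁ + lam₂ - 1) * planchWeight lam₁ lam₂ n := by
  have hn : (0 : ℝ) ≤ n := n.cast_nonneg
  rw [integral_jacobiP_mul_jacobiP le_rfl (by linarith) (by linarith), if_pos rfl,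
    integral_one_sub_rpow_mul_one_add_rpow (by linarith) (by linarith), jacobiCoeff, planchWeight]
  have e1 : lam₁ - 1 + n + 1 = lam₁ + n := by ring
  have e2 : lam₂ - 1 + n + 1 = lam₂ + n := by ring
  have e3 : lam₁ - 1 + n + (lam₂ - 1 + n) + 2 = (lam₁ + lam₂ + n - 1 + n) + 1 := by ring
  have e4 : lam₁ - 1 + (lam₂ - 1) + n + 1 = lam₁ + lam₂ + n - 1 := by ring
  have e5 : (2 : ℝ) ^ (lam₁ - 1 + n + (lam₂ - 1 + n) + 1) = 2 ^ (lam₁ + lam₂ - 1) * 4 ^ n := by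
    rw [show lam₁ - 1 + n + (lam₂ - 1 + n) + 1 = (lam₁ + lam₂ - 1) + ((2 * n : ℕ) : ℝ) by
      push_cast; ring, Real.rpow_add_natCast two_ne_zero, pow_mul]
    norm_num
  have hp : 0 < lam₁ + lam₂ + n - 1 := by linarith
  rw [e1, e2, e3, e4, e5, Real.Gamma_add_one (by positivity),
    Gamma_add_natCast_eq_ascPochhammer_mul hp]
  have hG := (Real.Gamma_pos_of_pos hp).ne'
  have hA := (ascPochhammer_pos n _ hp).ne'
  have := Nat.cast_ne_zero (R := ℝ).2 n.factorial_ne_zero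
  have h6 : lam₁ + lam₂ + 2 * n - 1 ≠ 0 := by linarith
  have h7 : lam₁ + lam₂ + n - 1 + n = lam₁ + lam₂ + 2 * n - 1 := by ring
  rw [h7]
  simp only [Nat.sub_self, ascPochhammer_zero, Polynomial.eval_one, Nat.factorial_zero]
  push_cast
  field_simp

end JacobiPolynomials

/-! ### Uniqueness of the Fourier transform of integrable functions. -/

section FourierUniqueness

variable {E : Type*} [NormedAddCommGroup E] [NormedSpace ℝ E] [MeasurableSpace E] [BorelSpace E]
  {μ : Measure E}

theorem norm_cexp_ofReal_mul_I_mul (a : ℝ) (z : ℂ) :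
    ‖Complex.exp (a * Complex.I) * z‖ = ‖z‖ := by
  rw [norm_mul, Complex.norm_exp_ofReal_mul_I, one_mul]

theorem integrable_cexp_mul {g : E → ℂ} (hg : Integrable g μ) (L : StrongDual ℝ E) :
    Integrable (fun x => Complex.exp (L x * Complex.I) * g x) μ := by
  refine hg.congr' ?_ (Filter.Eventually.of_forall fun x => (norm_cexp_ofReal_mul_I_mul _ _).symm)
  refine AEStronglyMeasurable.mul (Continuous.aestronglyMeasurable ?_) hg.1
  fun_prop

variable [CompleteSpace E] [SecondCountableTopology E]

/-- The finite measures with densities `r⁺` and `r⁻` have the same characteristic function, so they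
coincide. Then `r⁺ = r⁻` almost everywhere, which forces both to vanish. -/
theorem ae_eq_zero_of_forall_integral_cexp_real {r : E → ℝ} (hr : Integrable r μ)
    (h : ∀ L : StrongDual ℝ E, ∫ x, Complex.exp (L x * Complex.I) * (r x : ℂ) ∂μ = 0) :
    r =ᵐ[μ] 0 := by
  have hm : AEMeasurable (fun x => ENNReal.ofReal (r x)) μ := hr.1.aemeasurable.ennreal_ofReal
  have hm' : AEMeasurable (fun x => ENNReal.ofReal (-r x)) μ := hr.neg.1.aemeasurable.ennreal_ofReal
  have hf : ∫⁻ x, ENNReal.ofReal (r x) ∂μ ≠ ⊤ := hr.lintegral_lt_top.ne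
  have hf' : ∫⁻ x, ENNReal.ofReal (-r x) ∂μ ≠ ⊤ := hr.neg.lintegral_lt_top.ne
  have := isFiniteMeasure_withDensity hf
  have := isFiniteMeasure_withDensity hf'
  have key : μ.withDensity (fun x => ENNReal.ofReal (r x)) =
      μ.withDensity (fun x => ENNReal.ofReal (-r x)) := by
    refine Measure.ext_of_charFunDual (funext fun L => ?_)
    rw [charFunDual_apply, charFunDual_apply,
      integral_withDensity_eq_integral_toReal_smul₀ hm (by simp),
      integral_withDensity_eq_integral_toReal_smul₀ hm' (by simp), ← sub_eq_zero, ← integral_sub]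
    · rw [← h L]
      refine integral_congr_ae (Filter.Eventually.of_forall fun x => ?_)
      simp only [ENNReal.toReal_ofReal', Complex.real_smul, ← sub_mul]
      rw [mul_comm, ← Complex.ofReal_sub]
      congr 2
      rcases le_total (r x) 0 with h0 | h0
      · rw [max_eq_right h0, max_eq_left (by linarith)]; ring
      · rw [max_eq_left h0, max_eq_right (by linarith)]; ring
    · refine (integrable_cexp_mul (g := fun x => ((ENNReal.ofReal (r x)).toReal : ℂ)) ?_ L).congr
        (Filter.Eventually.of_forall fun x => ?_)
      · exact (integrable_toReal_of_lintegral_ne_top hm hf).ofReal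
      · simp only [Complex.real_smul]; ring
    · refine (integrable_cexp_mul (g := fun x => ((ENNReal.ofReal (-r x)).toReal : ℂ)) ?_ L).congr
        (Filter.Eventually.of_forall fun x => ?_)
      · exact (integrable_toReal_of_lintegral_ne_top hm' hf').ofReal
      · simp only [Complex.real_smul]; ring
  filter_upwards [(withDensity_eq_iff hm hm' hf).1 key] with x hx
  rcases le_total (r x) 0 with h0 | h0
  · rw [ENNReal.ofReal_of_nonpos h0] at hx
    have := ENNReal.ofReal_eq_zero.1 hx.symm
    simp only [Pi.zero_apply]
    linarith
  · rw [ENNReal.ofReal_of_nonpos (show -r x ≤ 0 by linarith)] at hx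
    have := ENNReal.ofReal_eq_zero.1 hx
    simp only [Pi.zero_apply]
    linarith

/-- An integrable function whose Fourier transform vanishes is zero almost everywhere. -/
theorem ae_eq_zero_of_forall_integral_cexp {g : E → ℂ} (hg : Integrable g μ)
    (h : ∀ L : StrongDual ℝ E, ∫ x, Complex.exp (L x * Complex.I) * g x ∂μ = 0) :
    g =ᵐ[μ] 0 := by
  -- Conjugating the hypothesis at `-L` gives it for `conj g`, hence for the real and imaginary
  -- parts of `g`.
  have hc : ∀ L : StrongDual ℝ E, ∫ x, Complex.exp (L x * Complex.I) * conj (g x) ∂μ = 0 := by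
    intro L
    have := congrArg conj (h (-L))
    rw [← integral_conj, map_zero] at this
    rw [← this]
    refine integral_congr_ae (Filter.Eventually.of_forall fun x => ?_)
    simp only [map_mul, ← Complex.exp_conj]
    simp
  have hgc : Integrable (fun x => conj (g x)) μ :=
    hg.congr' (Complex.continuous_conj.comp_aestronglyMeasurable hg.1)
      (Filter.Eventually.of_forall fun x => (RCLike.norm_conj _).symm)
  have hre : (fun x => (g x).re) =ᵐ[μ] 0 := by
    refine ae_eq_zero_of_forall_integral_cexp_real hg.re fun L => ?_
    have := integral_add (integrable_cexp_mul hg L) (integrable_cexp_mul hgc L)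
    rw [h, hc, add_zero] at this
    rw [← mul_right_inj' (two_ne_zero (α := ℂ)), mul_zero, ← this, ← integral_const_mul]
    refine integral_congr_ae (Filter.Eventually.of_forall fun x => ?_)
    simp only [← mul_add, Complex.add_conj]
    push_cast
    ring
  have him : (fun x => (g x).im) =ᵐ[μ] 0 := by
    refine ae_eq_zero_of_forall_integral_cexp_real hg.im fun L => ?_
    have := integral_sub (integrable_cexp_mul hg L) (integrable_cexp_mul hgc L)
    rw [h, hc, sub_zero] at this
    rw [← mul_right_inj' (mul_ne_zero (two_ne_zero (α := ℂ)) Complex.I_ne_zero), mul_zero, ← this,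
      ← integral_const_mul]
    refine integral_congr_ae (Filter.Eventually.of_forall fun x => ?_)
    simp only [← mul_sub, Complex.sub_conj]
    push_cast
    ring
  filter_upwards [hre, him] with x h1 h2
  exact Complex.ext h1 h2

end FourierUniqueness

/-! ### The Gamma integral on the right half plane. -/

section GammaIntegral

theorem integrableOn_rpow_mul_exp_neg_mul {a r : ℝ} (ha : 0 < a) (hr : 0 < r) :
    IntegrableOn (fun x : ℝ => x ^ (a - 1) * Real.exp (-r * x)) (Ioi 0) := by
  simpa using integrableOn_rpow_mul_exp_neg_mul_rpow (s := a - 1) (by linarith) one_pos hr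

theorem norm_rpow_mul_cexp {x : ℝ} (hx : 0 < x) (s : ℝ) (A : ℂ) :
    ‖((x ^ s : ℝ) : ℂ) * Complex.exp (-A * x)‖ = x ^ s * Real.exp (-A.re * x) := by
  rw [norm_mul, Complex.norm_real, Complex.norm_exp, Real.norm_of_nonneg (by positivity)]
  simp

theorem aestronglyMeasurable_rpow_mul_cexp (s : ℝ) (A : ℂ) :
    AEStronglyMeasurable (fun x : ℝ => ((x ^ s : ℝ) : ℂ) * Complex.exp (-A * x))
      (volume.restrict (Ioi 0)) := by
  apply Measurable.aestronglyMeasurable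
  fun_prop

theorem integrableOn_rpow_mul_cexp_neg_mul {a : ℝ} (ha : 0 < a) {A : ℂ} (hA : 0 < A.re) :
    IntegrableOn (fun x : ℝ => ((x ^ (a - 1) : ℝ) : ℂ) * Complex.exp (-A * x)) (Ioi 0) := by
  refine (integrableOn_rpow_mul_exp_neg_mul ha hA).congr' (aestronglyMeasurable_rpow_mul_cexp _ _) ?_
  filter_upwards [ae_restrict_mem measurableSet_Ioi] with x hx
  rw [norm_rpow_mul_cexp hx, Real.norm_of_nonneg]
  have : 0 < x := hx
  positivity

theorem differentiableOn_integral_rpow_mul_cexp {a : ℝ} (ha : 0 < a) :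
    DifferentiableOn ℂ (fun A : ℂ => ∫ x in Ioi (0 : ℝ),
      ((x ^ (a - 1) : ℝ) : ℂ) * Complex.exp (-A * x)) {A | 0 < A.re} := by
  intro A hA
  have hA' : 0 < A.re := hA
  -- On this neighbourhood one exponential bound dominates; differentiation in `A` produces a factor
  -- `x`, hence the exponent `a + 1` in the bound.
  have hs : {B : ℂ | A.re / 2 < B.re} ∈ nhds A :=
    (isOpen_lt continuous_const Complex.continuous_re).mem_nhds (by
      simp only [mem_ofPred_eq]; linarith)
  refine (hasDerivAt_integral_of_dominated_loc_of_deriv_le (μ := volume.restrict (Ioi (0 : ℝ)))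
    (F := fun B x => ((x ^ (a - 1) : ℝ) : ℂ) * Complex.exp (-B * x))
    (F' := fun B x => ((x ^ (a - 1) : ℝ) : ℂ) * (Complex.exp (-B * x) * (-1 * x)))
    (bound := fun x => x ^ ((a + 1) - 1) * Real.exp (-(A.re / 2) * x)) hs
    (Filter.Eventually.of_forall fun B => aestronglyMeasurable_rpow_mul_cexp _ _)
    (integrableOn_rpow_mul_cexp_neg_mul ha hA) ?_ ?_
    (integrableOn_rpow_mul_exp_neg_mul (by linarith) (by linarith))
    ?_).2.differentiableAt.differentiableWithinAt
  · apply Measurable.aestronglyMeasurable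
    fun_prop
  · filter_upwards [ae_restrict_mem measurableSet_Ioi] with x hx B hB
    have hx' : 0 < x := hx
    rw [← mul_assoc, norm_mul, norm_rpow_mul_cexp hx', neg_one_mul, norm_neg, Complex.norm_real,
      Real.norm_of_nonneg hx'.le, show a + 1 - 1 = (a - 1) + 1 by ring, Real.rpow_add_one hx'.ne']
    have : Real.exp (-B.re * x) ≤ Real.exp (-(A.re / 2) * x) := by
      apply Real.exp_le_exp.2
      have : A.re / 2 < B.re := hB
      nlinarith
    have h2 : 0 ≤ x ^ (a - 1) * x := by positivity
    nlinarith [mul_le_mul_of_nonneg_left this h2]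
  · refine Filter.Eventually.of_forall fun x B _ => ?_
    exact ((((hasDerivAt_id B).neg).mul_const (x : ℂ)).cexp).const_mul _

/-- The Gamma integral `∫₀^∞ x ^ (a - 1) e ^ (-A x) dx` for complex `A` with positive real part. -/
theorem integral_rpow_mul_cexp_neg_mul {a : ℝ} (ha : 0 < a) {A : ℂ} (hA : 0 < A.re) :
    ∫ x in Ioi (0 : ℝ), ((x ^ (a - 1) : ℝ) : ℂ) * Complex.exp (-A * x) =
      Real.Gamma a * Complex.exp (-a * Complex.log A) := by
  have ho : IsOpen {A : ℂ | 0 < A.re} := isOpen_lt continuous_const Complex.continuous_re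
  have hc : IsPreconnected {A : ℂ | 0 < A.re} := (convex_halfSpace_re_gt 0).isPreconnected
  have d1 := (differentiableOn_integral_rpow_mul_cexp ha).analyticOnNhd ho
  have d2 : AnalyticOnNhd ℂ (fun A => Real.Gamma a * Complex.exp (-a * Complex.log A))
      {A : ℂ | 0 < A.re} := by
    refine DifferentiableOn.analyticOnNhd (fun A hA => ?_) ho
    have : A ∈ Complex.slitPlane := Or.inl hA
    exact ((((Complex.differentiableAt_log this).const_mul (-(a : ℂ))).cexp).const_mul
      (Real.Gamma a : ℂ)).differentiableWithinAt
  -- Identity theorem: both sides are analytic on the half plane and agree at the positive reals,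
  -- which accumulate at `1`.
  refine d1.eqOn_of_preconnected_of_frequently_eq d2 hc (z₀ := 1) (by simp) ?_ hA
  have hreal : ∀ r : ℝ, 0 < r → ∫ x in Ioi (0 : ℝ), ((x ^ (a - 1) : ℝ) : ℂ) *
      Complex.exp (-(r : ℂ) * x) = Real.Gamma a * Complex.exp (-a * Complex.log r) := by
    intro r hr
    have h := Real.integral_rpow_mul_exp_neg_mul_Ioi ha hr
    have e : ∀ x : ℝ, ((x ^ (a - 1) : ℝ) : ℂ) * Complex.exp (-(r : ℂ) * x) =
        ((x ^ (a - 1) * Real.exp (-(r * x)) : ℝ) : ℂ) := fun x => by push_cast; simp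
    simp only [e]
    rw [integral_complex_ofReal, h, ← Complex.ofReal_log hr.le, one_div, Real.inv_rpow hr.le,
      Real.rpow_def_of_pos hr, ← Real.exp_neg, mul_comm (Real.log r), mul_comm, Complex.ofReal_mul,
      Complex.ofReal_exp]
    push_cast
    simp
  have ht : Filter.Tendsto (fun r : ℝ => (r : ℂ)) (nhdsWithin 1 {1}ᶜ) (nhdsWithin 1 {1}ᶜ) := by
    refine Filter.Tendsto.inf ?_ (Filter.tendsto_principal_principal.2 fun r hr => ?_)
    · exact Complex.continuous_ofReal.tendsto' 1 1 (by simp)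
    · simpa using hr
  refine ht.frequently (Filter.Eventually.frequently ?_)
  filter_upwards [nhdsWithin_le_nhds (lt_mem_nhds (zero_lt_one' ℝ))] with r hr
  exact hreal r hr

end GammaIntegral

/-! ### The weighted measures compared with Lebesgue measure. -/

section WeightedMeasures

theorem integral_withDensity_ofReal {α E : Type*} [MeasurableSpace α] [NormedAddCommGroup E]
    [NormedSpace ℝ E] {μ : Measure α} {w : α → ℝ} (hw : Measurable w) (h0 : ∀ᵐ x ∂μ, 0 ≤ w x)
    (f : α → E) :
    ∫ x, f x ∂(μ.withDensity fun x => ENNReal.ofReal (w x)) = ∫ x, w x • f x ∂μ := by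
  rw [integral_withDensity_eq_integral_toReal_smul hw.ennreal_ofReal (by simp)]
  refine integral_congr_ae ?_
  filter_upwards [h0] with x hx
  rw [ENNReal.toReal_ofReal hx]

theorem integrable_withDensity_ofReal_iff {α E : Type*} [MeasurableSpace α] [NormedAddCommGroup E]
    [NormedSpace ℝ E] {μ : Measure α} {w : α → ℝ} (hw : Measurable w) (h0 : ∀ᵐ x ∂μ, 0 ≤ w x)
    {f : α → E} :
    Integrable f (μ.withDensity fun x => ENNReal.ofReal (w x)) ↔
      Integrable (fun x => w x • f x) μ := by
  rw [integrable_withDensity_iff_integrable_smul' hw.ennreal_ofReal (by simp)]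
  refine integrable_congr ?_
  filter_upwards [h0] with x hx
  rw [ENNReal.toReal_ofReal hx]

theorem absolutelyContinuous_withDensity_ofReal {α : Type*} [MeasurableSpace α]
    {μ : Measure α} {w : α → ℝ} (hw : Measurable w) (h0 : ∀ᵐ x ∂μ, 0 < w x) :
    μ ≪ μ.withDensity fun x => ENNReal.ofReal (w x) := by
  refine withDensity_absolutelyContinuous' hw.ennreal_ofReal.aemeasurable ?_
  filter_upwards [h0] with x hx
  simpa using hx

theorem measurable_halfLineDensity (lam : ℝ) : Measurable fun x : ℝ => x ^ (1 - lam) := by fun_prop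

theorem halfLineDensity_pos (lam : ℝ) : ∀ᵐ x ∂(volume.restrict (Ioi (0 : ℝ))), 0 < x ^ (1 - lam) := by
  filter_upwards [ae_restrict_mem measurableSet_Ioi] with x hx
  have : 0 < x := hx
  positivity

theorem integral_halfLineMeasure (lam : ℝ) (f : ℝ → ℂ) :
    ∫ x, f x ∂(halfLineMeasure lam) = ∫ x in Ioi (0 : ℝ), ((x ^ (1 - lam) : ℝ) : ℂ) * f x := by
  rw [halfLineMeasure, integral_withDensity_ofReal (measurable_halfLineDensity lam)
    ((halfLineDensity_pos lam).mono fun _ h => h.le)]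
  simp only [Complex.real_smul]

theorem integrable_halfLineMeasure_iff {lam : ℝ} {f : ℝ → ℂ} :
    Integrable f (halfLineMeasure lam) ↔
      IntegrableOn (fun x => ((x ^ (1 - lam) : ℝ) : ℂ) * f x) (Ioi (0 : ℝ)) := by
  rw [halfLineMeasure, integrable_withDensity_ofReal_iff (measurable_halfLineDensity lam)
    ((halfLineDensity_pos lam).mono fun _ h => h.le)]
  simp only [Complex.real_smul, IntegrableOn]

theorem integrable_halfLineMeasure_iff_real {lam : ℝ} {f : ℝ → ℝ} :
    Integrable f (halfLineMeasure lam) ↔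
      IntegrableOn (fun x => x ^ (1 - lam) * f x) (Ioi (0 : ℝ)) := by
  rw [halfLineMeasure, integrable_withDensity_ofReal_iff (measurable_halfLineDensity lam)
    ((halfLineDensity_pos lam).mono fun _ h => h.le)]
  simp only [smul_eq_mul, IntegrableOn]

theorem halfLineMeasure_absolutelyContinuous (lam : ℝ) :
    halfLineMeasure lam ≪ volume.restrict (Ioi (0 : ℝ)) := withDensity_absolutelyContinuous _ _

/-- The density is positive, so the null sets are those of Lebesgue measure whatever `lam` is. This
lets almost-everywhere statements pass between different parameters. -/
theorem absolutelyContinuous_halfLineMeasure (lam : ℝ) :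
    volume.restrict (Ioi (0 : ℝ)) ≪ halfLineMeasure lam :=
  absolutelyContinuous_withDensity_ofReal (measurable_halfLineDensity lam) (halfLineDensity_pos lam)

instance sigmaFinite_halfLineMeasure (lam : ℝ) : SigmaFinite (halfLineMeasure lam) := by
  unfold halfLineMeasure
  infer_instance

theorem quadrantMeasure_eq_prod (lam₁ lam₂ : ℝ) :
    quadrantMeasure lam₁ lam₂ = (halfLineMeasure lam₁).prod (halfLineMeasure lam₂) := by
  rw [halfLineMeasure, halfLineMeasure, prod_withDensity
    (measurable_halfLineDensity lam₁).ennreal_ofReal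
    (measurable_halfLineDensity lam₂).ennreal_ofReal, Measure.prod_restrict, quadrantMeasure,
    ← Measure.volume_eq_prod]
  refine withDensity_congr_ae ?_
  filter_upwards [ae_restrict_mem (measurableSet_Ioi.prod measurableSet_Ioi)] with p hp
  have : 0 < p.1 := hp.1
  rw [ENNReal.ofReal_mul (by positivity)]

theorem measurable_quadrantDensity (lam₁ lam₂ : ℝ) :
    Measurable fun p : ℝ × ℝ => p.1 ^ (1 - lam₁) * p.2 ^ (1 - lam₂) := by fun_prop

theorem quadrantDensity_pos (lam₁ lam₂ : ℝ) :
    ∀ᵐ p ∂(volume.restrict (Ioi (0 : ℝ) ×ˢ Ioi (0 : ℝ))),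
      0 < p.1 ^ (1 - lam₁) * p.2 ^ (1 - lam₂) := by
  filter_upwards [ae_restrict_mem (measurableSet_Ioi.prod measurableSet_Ioi)] with p hp
  have : 0 < p.1 := hp.1
  have : 0 < p.2 := hp.2
  positivity

theorem integral_quadrantMeasure (lam₁ lam₂ : ℝ) (f : ℝ × ℝ → ℂ) :
    ∫ p, f p ∂(quadrantMeasure lam₁ lam₂) = ∫ p in Ioi (0 : ℝ) ×ˢ Ioi (0 : ℝ),
      ((p.1 ^ (1 - lam₁) * p.2 ^ (1 - lam₂) : ℝ) : ℂ) * f p := by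
  rw [quadrantMeasure, integral_withDensity_ofReal (measurable_quadrantDensity lam₁ lam₂)
    ((quadrantDensity_pos lam₁ lam₂).mono fun _ h => h.le)]
  simp only [Complex.real_smul]

theorem integrable_quadrantMeasure_iff {lam₁ lam₂ : ℝ} {f : ℝ × ℝ → ℂ} :
    Integrable f (quadrantMeasure lam₁ lam₂) ↔
      IntegrableOn (fun p => ((p.1 ^ (1 - lam₁) * p.2 ^ (1 - lam₂) : ℝ) : ℂ) * f p)
        (Ioi (0 : ℝ) ×ˢ Ioi (0 : ℝ)) := by
  rw [quadrantMeasure, integrable_withDensity_ofReal_iff (measurable_quadrantDensity lam₁ lam₂)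
    ((quadrantDensity_pos lam₁ lam₂).mono fun _ h => h.le)]
  simp only [Complex.real_smul, IntegrableOn]

theorem quadrantMeasure_absolutelyContinuous (lam₁ lam₂ : ℝ) :
    quadrantMeasure lam₁ lam₂ ≪ volume.restrict (Ioi (0 : ℝ) ×ˢ Ioi (0 : ℝ)) :=
  withDensity_absolutelyContinuous _ _

theorem absolutelyContinuous_quadrantMeasure (lam₁ lam₂ : ℝ) :
    volume.restrict (Ioi (0 : ℝ) ×ˢ Ioi (0 : ℝ)) ≪ quadrantMeasure lam₁ lam₂ :=
  absolutelyContinuous_withDensity_ofReal (measurable_quadrantDensity lam₁ lam₂)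
    (quadrantDensity_pos lam₁ lam₂)

end WeightedMeasures

/-! ### Products `u(x) v(y)` in the `L²`-space of the quadrant. -/

section TensorProductOfFunctions

variable {α β : Type*} [MeasurableSpace α] [MeasurableSpace β] {μ : Measure α} {ν : Measure β}

theorem memLp_two_mul_prod {u : α → ℂ} {v : β → ℂ} (hu : MemLp u 2 μ) (hv : MemLp v 2 ν) :
    MemLp (fun p : α × β => u p.1 * v p.2) 2 (μ.prod ν) := by
  have hm : AEStronglyMeasurable (fun p : α × β => u p.1 * v p.2) (μ.prod ν) :=
    hu.1.comp_fst.mul hv.1.comp_snd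
  rw [memLp_two_iff_integrable_sq_norm hm]
  simp only [norm_mul, mul_pow]
  exact ((memLp_two_iff_integrable_sq_norm hu.1).1 hu).mul_prod
    ((memLp_two_iff_integrable_sq_norm hv.1).1 hv)

end TensorProductOfFunctions

section QuadrantTensor

variable {lam₁ lam₂ : ℝ}

theorem memLp_quadrant_mul {u v : ℝ → ℂ} (hu : MemLp u 2 (halfLineMeasure lam₁))
    (hv : MemLp v 2 (halfLineMeasure lam₂)) :
    MemLp (fun p : ℝ × ℝ => u p.1 * v p.2) 2 (quadrantMeasure lam₁ lam₂) := by
  rw [quadrantMeasure_eq_prod]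
  exact memLp_two_mul_prod hu hv

/-- The function `(x, y) ↦ u(x) v(y)` as an element of `L²(ℝ₊²)_{lam₁, lam₂}`. -/
noncomputable def quadrantTensor (u : HalfLineL2 lam₁) (v : HalfLineL2 lam₂) :
    QuadrantL2 lam₁ lam₂ := (memLp_quadrant_mul (Lp.memLp u) (Lp.memLp v)).toLp _

theorem coeFn_quadrantTensor (u : HalfLineL2 lam₁) (v : HalfLineL2 lam₂) :
    quadrantTensor u v =ᵐ[quadrantMeasure lam₁ lam₂] fun p => u p.1 * v p.2 :=
  MemLp.coeFn_toLp _

theorem ae_quadrantMeasure_fst {P : ℝ → Prop} (h : ∀ᵐ x ∂(halfLineMeasure lam₁), P x) :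
    ∀ᵐ p ∂(quadrantMeasure lam₁ lam₂), P p.1 := by
  rw [quadrantMeasure_eq_prod]
  exact Measure.quasiMeasurePreserving_fst.ae h

theorem ae_quadrantMeasure_snd {P : ℝ → Prop} (h : ∀ᵐ x ∂(halfLineMeasure lam₂), P x) :
    ∀ᵐ p ∂(quadrantMeasure lam₁ lam₂), P p.2 := by
  rw [quadrantMeasure_eq_prod]
  exact Measure.quasiMeasurePreserving_snd.ae h

theorem inner_quadrantTensor (u u' : HalfLineL2 lam₁) (v v' : HalfLineL2 lam₂) :
    inner ℂ (quadrantTensor u v) (quadrantTensor u' v') = inner ℂ u u' * inner ℂ v v' := by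
  rw [L2.inner_def, L2.inner_def, L2.inner_def, ← integral_prod_mul, ← quadrantMeasure_eq_prod]
  refine integral_congr_ae ?_
  filter_upwards [coeFn_quadrantTensor u v, coeFn_quadrantTensor u' v'] with p h h'
  simp only [h, h', RCLike.inner_apply, map_mul]
  ring

/-- The bilinear map `(u, v) ↦ u(x) v(y)`. -/
noncomputable def quadrantTensorBilin (lam₁ lam₂ : ℝ) :
    HalfLineL2 lam₁ →ₗ[ℂ] HalfLineL2 lam₂ →ₗ[ℂ] QuadrantL2 lam₁ lam₂ :=
  LinearMap.mk₂ ℂ quadrantTensor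
    (fun u u' v => by
      apply Lp.ext
      filter_upwards [coeFn_quadrantTensor (u + u') v, coeFn_quadrantTensor u v,
        coeFn_quadrantTensor u' v, Lp.coeFn_add (quadrantTensor u v) (quadrantTensor u' v),
        ae_quadrantMeasure_fst (Lp.coeFn_add u u')] with p h1 h2 h3 h4 h5
      rw [h1, h4, Pi.add_apply, h2, h3, h5, Pi.add_apply, add_mul])
    (fun c u v => by
      apply Lp.ext
      filter_upwards [coeFn_quadrantTensor (c • u) v, coeFn_quadrantTensor u v,
        Lp.coeFn_smul c (quadrantTensor u v),
        ae_quadrantMeasure_fst (Lp.coeFn_smul c u)] with p h1 h2 h4 h5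
      rw [h1, h4, Pi.smul_apply, h2, h5, Pi.smul_apply, smul_mul_assoc])
    (fun u v v' => by
      apply Lp.ext
      filter_upwards [coeFn_quadrantTensor u (v + v'), coeFn_quadrantTensor u v,
        coeFn_quadrantTensor u v', Lp.coeFn_add (quadrantTensor u v) (quadrantTensor u v'),
        ae_quadrantMeasure_snd (Lp.coeFn_add v v')] with p h1 h2 h3 h4 h5
      rw [h1, h4, Pi.add_apply, h2, h3, h5, Pi.add_apply, mul_add])
    (fun c u v => by
      apply Lp.ext
      filter_upwards [coeFn_quadrantTensor u (c • v), coeFn_quadrantTensor u v,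
        Lp.coeFn_smul c (quadrantTensor u v),
        ae_quadrantMeasure_snd (Lp.coeFn_smul c v)] with p h1 h2 h4 h5
      rw [h1, h4, Pi.smul_apply, h2, h5, Pi.smul_apply, mul_smul_comm])

end QuadrantTensor

/-! ### Reproducing kernels for the Fourier–Laplace transform. -/

section LaplaceKernels

/-- The function representing `f ↦ 𝓕 f (z)` on `L²(ℝ₊)_lam`. -/
noncomputable def laplaceKernelFun (lam : ℝ) (z : ℍ) (x : ℝ) : ℂ :=
  ((x ^ (lam - 1) : ℝ) : ℂ) * Complex.exp (-(Complex.I * conj (z : ℂ)) * x)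

theorem re_I_mul_conj (z : ℍ) : (Complex.I * conj (z : ℂ)).re = z.im := by
  simp [Complex.mul_re]

theorem memLp_laplaceKernelFun {lam : ℝ} (h : 0 < lam) (z : ℍ) :
    MemLp (laplaceKernelFun lam z) 2 (halfLineMeasure lam) := by
  have hm : AEStronglyMeasurable (laplaceKernelFun lam z) (halfLineMeasure lam) :=
    (aestronglyMeasurable_rpow_mul_cexp _ _).mono_ac (halfLineMeasure_absolutelyContinuous lam)
  rw [memLp_two_iff_integrable_sq_norm hm, integrable_halfLineMeasure_iff_real]
  have hz := z.im_pos
  refine (integrableOn_rpow_mul_exp_neg_mul h (show 0 < 2 * z.im by linarith)).congr_fun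
    (fun x hx => ?_) measurableSet_Ioi
  have hx' : 0 < x := hx
  simp only [laplaceKernelFun]
  rw [norm_rpow_mul_cexp hx', re_I_mul_conj, mul_pow, ← Real.exp_nat_mul, ← mul_assoc]
  have e : x ^ (1 - lam) * (x ^ (lam - 1)) ^ 2 = x ^ (lam - 1) := by
    rw [pow_two, ← mul_assoc, ← Real.rpow_add hx']
    simp
  rw [e]
  congr 2
  push_cast
  ring

/-- The element of `L²(ℝ₊)_lam` representing `f ↦ 𝓕 f (z)`. -/
noncomputable def laplaceKernel {lam : ℝ} (h : 0 < lam) (z : ℍ) : HalfLineL2 lam :=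
  (memLp_laplaceKernelFun h z).toLp _

theorem coeFn_laplaceKernel {lam : ℝ} (h : 0 < lam) (z : ℍ) :
    laplaceKernel h z =ᵐ[halfLineMeasure lam] laplaceKernelFun lam z := MemLp.coeFn_toLp _

theorem rpow_mul_conj_laplaceKernelFun {lam x : ℝ} (hx : 0 < x) (z : ℍ) :
    ((x ^ (1 - lam) : ℝ) : ℂ) * conj (laplaceKernelFun lam z x) =
      Complex.exp (Complex.I * (z : ℂ) * (x : ℂ)) := by
  rw [laplaceKernelFun, map_mul, Complex.conj_ofReal, ← mul_assoc, ← Complex.ofReal_mul,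
    ← Real.rpow_add hx, ← Complex.exp_conj]
  simp

theorem inner_laplaceKernel {lam : ℝ} (h : 0 < lam) (z : ℍ) (f : HalfLineL2 lam) :
    inner ℂ (laplaceKernel h z) f = fourierLaplace f z := by
  rw [L2.inner_def, fourierLaplace]
  have : ∫ x, inner ℂ (laplaceKernel h z x) (f x) ∂(halfLineMeasure lam) =
      ∫ x, conj (laplaceKernelFun lam z x) * f x ∂(halfLineMeasure lam) := by
    refine integral_congr_ae ?_
    filter_upwards [coeFn_laplaceKernel h z] with x hx
    rw [hx, RCLike.inner_apply']
  rw [this, integral_halfLineMeasure]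
  refine setIntegral_congr_fun measurableSet_Ioi fun x hx => ?_
  rw [← mul_assoc, rpow_mul_conj_laplaceKernelFun hx, mul_comm]

/-- The integrand is that of an inner product of two `L²` functions. -/
theorem integrableOn_mul_cexp {lam : ℝ} (h : 0 < lam) (z : ℍ) (f : HalfLineL2 lam) :
    IntegrableOn (fun x => f x * Complex.exp (Complex.I * (z : ℂ) * (x : ℂ))) (Ioi 0) := by
  have h1 := L2.integrable_inner (𝕜 := ℂ) (laplaceKernel h z) f
  have h2 : Integrable (fun x => conj (laplaceKernelFun lam z x) * f x) (halfLineMeasure lam) := by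
    refine h1.congr ?_
    filter_upwards [coeFn_laplaceKernel h z] with x hx
    rw [hx, RCLike.inner_apply']
  rw [integrable_halfLineMeasure_iff] at h2
  refine h2.congr_fun (fun x hx => ?_) measurableSet_Ioi
  simp only
  rw [← mul_assoc, rpow_mul_conj_laplaceKernelFun hx, mul_comm]

/-- On the line `Im z = 1` the transform of `f` is the Fourier transform of the integrable function
`f(x) e ^ (-x)`. -/
theorem eq_zero_of_fourierLaplace_eq_zero {lam : ℝ} (h : 0 < lam) (f : HalfLineL2 lam)
    (hf : ∀ z, fourierLaplace f z = 0) : f = 0 := by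
  have key : (fun x => f x * Complex.exp (Complex.I * (UpperHalfPlane.I : ℂ) * (x : ℂ)))
      =ᵐ[volume.restrict (Ioi 0)] 0 := by
    refine ae_eq_zero_of_forall_integral_cexp (integrableOn_mul_cexp h UpperHalfPlane.I f)
      fun L => ?_
    have hL : ∀ x, L x = x * L 1 := fun x => by
      have := L.map_smul x 1
      simpa using this
    rw [← hf ⟨(L 1 : ℂ) + Complex.I, by simp⟩, fourierLaplace]
    refine setIntegral_congr_fun measurableSet_Ioi fun x _ => ?_
    simp only [hL x]
    rw [mul_left_comm, ← Complex.exp_add]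
    congr 2
    simp only [UpperHalfPlane.coe_I]
    push_cast
    ring
  apply Lp.ext
  have h1 := (halfLineMeasure_absolutelyContinuous lam).ae_eq key
  filter_upwards [h1, Lp.coeFn_zero ℂ 2 (halfLineMeasure lam)] with x hx h0
  rw [h0]
  simpa using hx

theorem laplaceKernel_total {lam : ℝ} (h : 0 < lam) :
    (Submodule.span ℂ (range (laplaceKernel h))).topologicalClosure = ⊤ :=
  topologicalClosure_span_eq_top fun f hf =>
    eq_zero_of_fourierLaplace_eq_zero h f fun z => by rw [← inner_laplaceKernel h, hf]

/-- The Gamma integral with `A = -i (z - w̄)`, whose real part is `Im z + Im w`. -/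
theorem inner_laplaceKernel_laplaceKernel {lam : ℝ} (h : 0 < lam) (z w : ℍ) :
    inner ℂ (laplaceKernel h z) (laplaceKernel h w) =
      Real.Gamma lam * Complex.exp (-lam * Complex.log (-Complex.I * (z - conj (w : ℂ)))) := by
  have hA : 0 < (-Complex.I * ((z : ℂ) - conj (w : ℂ))).re := by
    have := z.im_pos
    have := w.im_pos
    simp [Complex.mul_re]
    linarith
  rw [inner_laplaceKernel, ← integral_rpow_mul_cexp_neg_mul h hA, fourierLaplace]
  refine integral_congr_ae ?_
  filter_upwards [(absolutelyContinuous_halfLineMeasure lam).ae_le (coeFn_laplaceKernel h w)]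
    with x hx
  rw [hx, laplaceKernelFun, mul_assoc, ← Complex.exp_add]
  congr 2
  ring

section Quadrant

variable {lam₁ lam₂ : ℝ} (h₁ : 0 < lam₁) (h₂ : 0 < lam₂)

/-- The element of `L²(ℝ₊²)_{lam₁, lam₂}` representing `F ↦ (𝓕 ⊗ 𝓕) F (z₁, z₂)`. -/
noncomputable def laplaceKernel₂ (z : ℍ × ℍ) : QuadrantL2 lam₁ lam₂ :=
  quadrantTensor (laplaceKernel h₁ z.1) (laplaceKernel h₂ z.2)

theorem coeFn_laplaceKernel₂ (z : ℍ × ℍ) :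
    laplaceKernel₂ h₁ h₂ z =ᵐ[quadrantMeasure lam₁ lam₂]
      fun p => laplaceKernelFun lam₁ z.1 p.1 * laplaceKernelFun lam₂ z.2 p.2 := by
  filter_upwards [coeFn_quadrantTensor (laplaceKernel h₁ z.1) (laplaceKernel h₂ z.2),
    ae_quadrantMeasure_fst (coeFn_laplaceKernel h₁ z.1),
    ae_quadrantMeasure_snd (coeFn_laplaceKernel h₂ z.2)] with p h h' h''
  rw [laplaceKernel₂, h, h', h'']

theorem rpow_mul_conj_laplaceKernelFun₂ {p : ℝ × ℝ} (hp : p ∈ Ioi (0 : ℝ) ×ˢ Ioi (0 : ℝ))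
    (z : ℍ × ℍ) (c : ℂ) :
    ((p.1 ^ (1 - lam₁) * p.2 ^ (1 - lam₂) : ℝ) : ℂ) *
        (conj (laplaceKernelFun lam₁ z.1 p.1 * laplaceKernelFun lam₂ z.2 p.2) * c) =
      c * Complex.exp (Complex.I * ((z.1 : ℂ) * (p.1 : ℂ) + (z.2 : ℂ) * (p.2 : ℂ))) := by
  have e : Complex.exp (Complex.I * ((z.1 : ℂ) * (p.1 : ℂ) + (z.2 : ℂ) * (p.2 : ℂ))) =
      Complex.exp (Complex.I * (z.1 : ℂ) * (p.1 : ℂ)) *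
        Complex.exp (Complex.I * (z.2 : ℂ) * (p.2 : ℂ)) := by
    rw [← Complex.exp_add]
    congr 1
    ring
  rw [e, ← rpow_mul_conj_laplaceKernelFun (lam := lam₁) hp.1,
    ← rpow_mul_conj_laplaceKernelFun (lam := lam₂) hp.2, map_mul]
  push_cast
  ring

theorem inner_laplaceKernel₂ (z : ℍ × ℍ) (F : QuadrantL2 lam₁ lam₂) :
    inner ℂ (laplaceKernel₂ h₁ h₂ z) F = fourierLaplace₂ F z.1 z.2 := by
  rw [L2.inner_def, fourierLaplace₂]
  have : ∫ p, inner ℂ (laplaceKernel₂ h₁ h₂ z p) (F p) ∂(quadrantMeasure lam₁ lam₂) =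
      ∫ p, conj (laplaceKernelFun lam₁ z.1 p.1 * laplaceKernelFun lam₂ z.2 p.2) * F p
        ∂(quadrantMeasure lam₁ lam₂) := by
    refine integral_congr_ae ?_
    filter_upwards [coeFn_laplaceKernel₂ h₁ h₂ z] with p hp
    rw [hp, RCLike.inner_apply']
  rw [this, integral_quadrantMeasure]
  exact setIntegral_congr_fun (measurableSet_Ioi.prod measurableSet_Ioi) fun p hp =>
    rpow_mul_conj_laplaceKernelFun₂ hp z _

theorem integrableOn_mul_cexp₂ {lam₁ lam₂ : ℝ} (h₁ : 0 < lam₁) (h₂ : 0 < lam₂) (z : ℍ × ℍ) (F : QuadrantL2 lam₁ lam₂) :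
    IntegrableOn (fun p => F p *
      Complex.exp (Complex.I * ((z.1 : ℂ) * (p.1 : ℂ) + (z.2 : ℂ) * (p.2 : ℂ))))
      (Ioi (0 : ℝ) ×ˢ Ioi (0 : ℝ)) := by
  have a1 := L2.integrable_inner (𝕜 := ℂ) (laplaceKernel₂ h₁ h₂ z) F
  have a2 : Integrable (fun p => conj (laplaceKernelFun lam₁ z.1 p.1 *
      laplaceKernelFun lam₂ z.2 p.2) * F p) (quadrantMeasure lam₁ lam₂) := by
    refine a1.congr ?_
    filter_upwards [coeFn_laplaceKernel₂ h₁ h₂ z] with p hp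
    rw [hp, RCLike.inner_apply']
  rw [integrable_quadrantMeasure_iff] at a2
  exact a2.congr_fun (fun p hp => rpow_mul_conj_laplaceKernelFun₂ hp z _)
    (measurableSet_Ioi.prod measurableSet_Ioi)

theorem eq_zero_of_fourierLaplace₂_eq_zero {lam₁ lam₂ : ℝ} (h₁ : 0 < lam₁) (h₂ : 0 < lam₂) (F : QuadrantL2 lam₁ lam₂)
    (hF : ∀ z₁ z₂, fourierLaplace₂ F z₁ z₂ = 0) : F = 0 := by
  have key : (fun p : ℝ × ℝ => F p * Complex.exp (Complex.I * ((UpperHalfPlane.I : ℂ) * (p.1 : ℂ) +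
      (UpperHalfPlane.I : ℂ) * (p.2 : ℂ))))
      =ᵐ[volume.restrict (Ioi (0 : ℝ) ×ˢ Ioi (0 : ℝ))] 0 := by
    refine ae_eq_zero_of_forall_integral_cexp
      (integrableOn_mul_cexp₂ h₁ h₂ (UpperHalfPlane.I, UpperHalfPlane.I) F) fun L => ?_
    have hL : ∀ p : ℝ × ℝ, L p = p.1 * L (1, 0) + p.2 * L (0, 1) := fun p => by
      have e : p = p.1 • ((1 : ℝ), (0 : ℝ)) + p.2 • ((0 : ℝ), (1 : ℝ)) := by ext <;> simp
      conv_lhs => rw [e]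
      rw [map_add, map_smul, map_smul, smul_eq_mul, smul_eq_mul]
    rw [← hF ⟨(L (1, 0) : ℂ) + Complex.I, by simp⟩ ⟨(L (0, 1) : ℂ) + Complex.I, by simp⟩,
      fourierLaplace₂]
    refine setIntegral_congr_fun (measurableSet_Ioi.prod measurableSet_Ioi) fun p _ => ?_
    simp only [hL p]
    rw [mul_left_comm, ← Complex.exp_add]
    congr 2
    simp only [UpperHalfPlane.coe_I]
    push_cast
    ring
  apply Lp.ext
  have a1 := (quadrantMeasure_absolutelyContinuous lam₁ lam₂).ae_eq key
  filter_upwards [a1, Lp.coeFn_zero ℂ 2 (quadrantMeasure lam₁ lam₂)] with x hx h0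
  rw [h0]
  simpa using hx

theorem laplaceKernel₂_total :
    (Submodule.span ℂ (range (laplaceKernel₂ h₁ h₂))).topologicalClosure = ⊤ :=
  topologicalClosure_span_eq_top fun F hF =>
    eq_zero_of_fourierLaplace₂_eq_zero h₁ h₂ F fun z₁ z₂ => by
      rw [← hF (z₁, z₂), inner_laplaceKernel₂]

end Quadrant

end LaplaceKernels

/-! ### Transformation of the kernels under the covering group. -/

section Covariance

namespace SLTilde

theorem coe_smul_mul_exp (g : SLTilde) (z : ℍ) :
    ((g.toSL • z : ℍ) : ℂ) * Complex.exp (g.logDenom z) =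
      (g.toSL 0 0 : ℂ) * z + (g.toSL 0 1 : ℂ) := by
  have h := g.exp_logDenom z
  have h0 := Complex.exp_ne_zero (g.logDenom z)
  rw [coe_specialLinearGroup_apply]
  simp only [Algebra.algebraMap_self, RingHom.id_apply]
  rw [← h]
  field_simp

theorem det_toSL (g : SLTilde) :
    (g.toSL 0 0 : ℂ) * (g.toSL 1 1 : ℂ) - (g.toSL 0 1 : ℂ) * (g.toSL 1 0 : ℂ) = 1 := by
  have h := g.toSL.det_coe
  rw [Matrix.det_fin_two] at h
  exact_mod_cast h

/-- This is `(az + b)(cw + d) - (aw + b)(cz + d) = (ad - bc)(z - w)` with determinant one. The next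
theorem is the same identity with `w` replaced by its conjugate. -/
theorem coe_smul_sub_coe_smul (g : SLTilde) (z w : ℍ) :
    (((g.toSL • z : ℍ) : ℂ) - ((g.toSL • w : ℍ) : ℂ)) *
      (Complex.exp (g.logDenom z) * Complex.exp (g.logDenom w)) = z - w := by
  have h1 := g.coe_smul_mul_exp z
  have h2 := g.coe_smul_mul_exp w
  have e1 := g.exp_logDenom z
  have e2 := g.exp_logDenom w
  have hd := g.det_toSL
  linear_combination (Complex.exp (g.logDenom w)) * h1 - (Complex.exp (g.logDenom z)) * h2 +
    ((g.toSL 0 0 : ℂ) * z + (g.toSL 0 1 : ℂ)) * e2 -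
    ((g.toSL 0 0 : ℂ) * w + (g.toSL 0 1 : ℂ)) * e1 + ((z : ℂ) - w) * hd

theorem coe_smul_sub_conj_coe_smul (g : SLTilde) (z w : ℍ) :
    (((g.toSL • z : ℍ) : ℂ) - conj ((g.toSL • w : ℍ) : ℂ)) *
      (Complex.exp (g.logDenom z) * Complex.exp (conj (g.logDenom w))) = z - conj (w : ℂ) := by
  have h1 := g.coe_smul_mul_exp z
  have h2 := congrArg conj (g.coe_smul_mul_exp w)
  have e1 := g.exp_logDenom z
  have e2 := congrArg conj (g.exp_logDenom w)
  have hd := g.det_toSL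
  simp only [map_mul, map_add, Complex.conj_ofReal, ← Complex.exp_conj] at h2 e2
  linear_combination (Complex.exp (conj (g.logDenom w))) * h1 - (Complex.exp (g.logDenom z)) * h2 +
    ((g.toSL 0 0 : ℂ) * z + (g.toSL 0 1 : ℂ)) * e2 -
    ((g.toSL 0 0 : ℂ) * conj (w : ℂ) + (g.toSL 0 1 : ℂ)) * e1 + ((z : ℂ) - conj (w : ℂ)) * hd

end SLTilde

theorem re_neg_I_mul_sub_conj_pos (z w : ℍ) :
    0 < (-Complex.I * ((z : ℂ) - conj (w : ℂ))).re := by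
  have := z.im_pos
  have := w.im_pos
  simp [Complex.mul_re]
  linarith

/-- The logarithm of `-i (z - w̄)`. -/
noncomputable def logKernel (z w : ℍ) : ℂ := Complex.log (-Complex.I * ((z : ℂ) - conj (w : ℂ)))

theorem exp_logKernel (z w : ℍ) :
    Complex.exp (logKernel z w) = -Complex.I * ((z : ℂ) - conj (w : ℂ)) := by
  rw [logKernel, Complex.exp_log]
  intro h
  have := re_neg_I_mul_sub_conj_pos z w
  rw [h] at this
  simp at this

theorem continuous_logKernel : Continuous fun p : ℍ × ℍ => logKernel p.1 p.2 := by
  refine Continuous.clog ?_ fun p => Or.inl (re_neg_I_mul_sub_conj_pos p.1 p.2)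
  have h1 : Continuous fun p : ℍ × ℍ => (p.1 : ℂ) := UpperHalfPlane.continuous_coe.comp continuous_fst
  have h2 : Continuous fun p : ℍ × ℍ => conj (p.2 : ℂ) :=
    Complex.continuous_conj.comp (UpperHalfPlane.continuous_coe.comp continuous_snd)
  exact continuous_const.mul (h1.sub h2)

theorem logKernel_self_im (z : ℍ) : (logKernel z z).im = 0 := by
  have e : -Complex.I * ((z : ℂ) - conj (z : ℂ)) = ((2 * z.im : ℝ) : ℂ) := by
    rw [Complex.sub_conj, UpperHalfPlane.coe_im]
    push_cast
    linear_combination (-2 * (z.im : ℂ)) * Complex.I_mul_I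
  have := z.im_pos
  rw [logKernel, e, ← Complex.ofReal_log (by positivity), Complex.ofReal_im]

/-- A continuous function on a connected space all of whose values are logarithms of `1` vanishes
identically if it has a real value. -/
theorem eq_zero_of_exp_eq_one {X : Type*} [TopologicalSpace X] [PreconnectedSpace X] {D : X → ℂ}
    (hD : Continuous D) (h1 : ∀ x, Complex.exp (D x) = 1) {x₀ : X} (h0 : (D x₀).im = 0) (x : X) :
    D x = 0 := by
  choose n hn using fun x => Complex.exp_eq_one_iff.1 (h1 x)
  have him : ∀ x, (D x).im = n x * (2 * Real.pi) := fun x => by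
    rw [hn x]
    simp
  have hn' : ∀ x, (n x : ℝ) = (D x).im / (2 * Real.pi) := fun x => by
    rw [him x, mul_div_cancel_right₀ _ Real.two_pi_pos.ne']
  have hc : Continuous n := by
    rw [Int.isClosedEmbedding_coe_real.isInducing.continuous_iff]
    have : ((↑) : ℤ → ℝ) ∘ n = fun x => (D x).im / (2 * Real.pi) := funext hn'
    rw [this]
    exact (Complex.continuous_im.comp hD).div_const _
  have hx : n x = n x₀ := PreconnectedSpace.constant inferInstance hc
  have hz : n x₀ = 0 := by
    have := him x₀
    rw [h0] at this
    have h2 := Real.two_pi_pos.ne'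
    have h3 : (n x₀ : ℝ) = 0 := by
      rcases mul_eq_zero.1 this.symm with h | h
      · exact h
      · exact absurd h h2
    exact_mod_cast h3
  rw [hn x, hx, hz]
  simp

/-- The two sides exponentiate to the same number, so their difference is continuous with values in
`2πiℤ` on the connected space `ℍ × ℍ`. It is real on the diagonal, hence zero. This fixes the branch
for non-integral powers. -/
theorem logKernel_smul_smul (g : SLTilde) (z w : ℍ) :
    logKernel (g.toSL • z) (g.toSL • w) =
      logKernel z w - g.logDenom z - conj (g.logDenom w) := by
  have key := eq_zero_of_exp_eq_one (X := ℍ × ℍ) (D := fun p =>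
    logKernel (g.toSL • p.1) (g.toSL • p.2) + g.logDenom p.1 + conj (g.logDenom p.2) -
      logKernel p.1 p.2) ?_ ?_ (x₀ := (UpperHalfPlane.I, UpperHalfPlane.I)) ?_ (z, w)
  · linear_combination key
  · have c1 : Continuous fun p : ℍ × ℍ => g.toSL • p.1 :=
      (continuous_const_smul g.toSL).comp continuous_fst
    have c2 : Continuous fun p : ℍ × ℍ => g.toSL • p.2 :=
      (continuous_const_smul g.toSL).comp continuous_snd
    have a1 : Continuous fun p : ℍ × ℍ => logKernel (g.toSL • p.1) (g.toSL • p.2) :=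
      Continuous.comp (g := fun p : ℍ × ℍ => logKernel p.1 p.2)
        (f := fun p : ℍ × ℍ => (g.toSL • p.1, g.toSL • p.2)) continuous_logKernel (c1.prodMk c2)
    have a2 : Continuous fun p : ℍ × ℍ => g.logDenom p.1 := g.continuous_logDenom.comp continuous_fst
    have a3 : Continuous fun p : ℍ × ℍ => conj (g.logDenom p.2) :=
      Complex.continuous_conj.comp (g.continuous_logDenom.comp continuous_snd)
    exact ((a1.add a2).add a3).sub continuous_logKernel
  · intro p
    have h0 := Complex.exp_ne_zero (logKernel p.1 p.2)
    rw [Complex.exp_sub, Complex.exp_add, Complex.exp_add, div_eq_one_iff_eq h0, exp_logKernel,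
      exp_logKernel, ← g.coe_smul_sub_conj_coe_smul p.1 p.2]
    ring
  · simp only [Complex.sub_im, Complex.add_im, Complex.conj_im, logKernel_self_im]
    ring

/-- The kernel `(-i (z - w̄)) ^ (-a)`. -/
noncomputable def powKernel (a : ℝ) (z w : ℍ) : ℂ := Complex.exp (-a * logKernel z w)

theorem powKernel_smul_smul (a : ℝ) (g : SLTilde) (z w : ℍ) :
    powKernel a (g.toSL • z) (g.toSL • w) =
      Complex.exp (a * g.logDenom z) * Complex.exp (a * conj (g.logDenom w)) * powKernel a z w := by
  rw [powKernel, powKernel, logKernel_smul_smul, ← Complex.exp_add, ← Complex.exp_add]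
  congr 1
  ring

theorem inner_laplaceKernel_eq_powKernel {lam : ℝ} (h : 0 < lam) (z w : ℍ) :
    inner ℂ (laplaceKernel h z) (laplaceKernel h w) = Real.Gamma lam * powKernel lam z w :=
  inner_laplaceKernel_laplaceKernel h z w

end Covariance

/-! ### Existence and uniqueness of the `L²`-models. -/

section Representations

/-- The multiplier of `π_lam`. -/
noncomputable def multiplier (lam : ℝ) (g : SLTilde) (z : ℍ) : ℂ :=
  Complex.exp (-(lam : ℂ) * g⁻¹.logDenom z)

theorem multiplier_one (lam : ℝ) (z : ℍ) : multiplier lam 1 z = 1 := by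
  simp [multiplier]

theorem multiplier_mul (lam : ℝ) (g h : SLTilde) (z : ℍ) :
    multiplier lam (g * h) z = multiplier lam g z * multiplier lam h (g⁻¹.toSL • z) := by
  rw [multiplier, mul_inv_rev, SLTilde.mul_logDenom, multiplier, multiplier, ← Complex.exp_add]
  congr 1
  ring

theorem mul_inv_toSL_smul (g h : SLTilde) (z : ℍ) :
    (g * h)⁻¹.toSL • z = h⁻¹.toSL • g⁻¹.toSL • z := by
  rw [mul_inv_rev, SLTilde.mul_toSL, mul_smul]

theorem one_inv_toSL_smul (z : ℍ) : (1 : SLTilde)⁻¹.toSL • z = z := by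
  rw [inv_one, SLTilde.one_toSL, one_smul]

/-- The invariance of the Gram matrix required by `existsUnique_unitary_of_multiplier`. -/
theorem multiplier_mul_conj_mul_powKernel (lam : ℝ) (g : SLTilde) (z w : ℍ) :
    multiplier lam g z * conj (multiplier lam g w) *
      powKernel lam (g⁻¹.toSL • z) (g⁻¹.toSL • w) = powKernel lam z w := by
  rw [powKernel_smul_smul, multiplier, multiplier, ← Complex.exp_conj]
  simp only [map_mul, map_neg, Complex.conj_ofReal, neg_mul, Complex.exp_neg]
  have h1 := Complex.exp_ne_zero (lam * g⁻¹.logDenom z)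
  have h2 := Complex.exp_ne_zero (lam * conj (g⁻¹.logDenom w))
  field_simp

/-- Evaluation at `z` is an inner product with a kernel, so intertwining becomes a statement about
matrix coefficients. -/
theorem isL2Model_iff {lam : ℝ} (h : 0 < lam)
    {ρ : SLTilde →* (HalfLineL2 lam ≃ₗᵢ[ℂ] HalfLineL2 lam)} :
    IsL2Model lam ρ ↔ ∀ g f z, inner ℂ (laplaceKernel h z) (ρ g f) =
      multiplier lam g z * inner ℂ (laplaceKernel h (g⁻¹.toSL • z)) f := by
  simp only [IsL2Model, inner_laplaceKernel]
  exact forall₂_congr fun g f => funext_iff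

theorem existsUnique_isL2Model {lam : ℝ} (h : 0 < lam) : ∃! ρ, IsL2Model lam ρ := by
  simp only [isL2Model_iff h]
  refine existsUnique_unitary_of_multiplier (laplaceKernel_total h) (multiplier lam)
    (fun g z => g⁻¹.toSL • z) (multiplier_one lam) one_inv_toSL_smul (multiplier_mul lam)
    mul_inv_toSL_smul fun g z w => ?_
  rw [inner_laplaceKernel_eq_powKernel, inner_laplaceKernel_eq_powKernel, mul_left_comm,
    multiplier_mul_conj_mul_powKernel]

theorem isL2Model_l2Model {lam : ℝ} (h : 0 < lam) : IsL2Model lam (l2Model lam) := by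
  have hex : ∃ ρ, IsL2Model lam ρ := (existsUnique_isL2Model h).exists
  rw [l2Model, dif_pos hex]
  exact hex.choose_spec

theorem inner_laplaceKernel_l2Model {lam : ℝ} (h : 0 < lam) (g : SLTilde) (f : HalfLineL2 lam)
    (z : ℍ) : inner ℂ (laplaceKernel h z) (l2Model lam g f) =
      multiplier lam g z * inner ℂ (laplaceKernel h (g⁻¹.toSL • z)) f :=
  (isL2Model_iff h).1 (isL2Model_l2Model h) g f z

theorem l2Model_laplaceKernel {lam : ℝ} (h : 0 < lam) (g : SLTilde) (w : ℍ) :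
    l2Model lam g (laplaceKernel h w) =
      conj (multiplier lam g⁻¹ w) • laplaceKernel h (g.toSL • w) := by
  have := unitary_apply_kernel (laplaceKernel_total h)
    (inner_laplaceKernel_l2Model h) g w
  rwa [inv_inv] at this

variable {lam₁ lam₂ : ℝ} (h₁ : 0 < lam₁) (h₂ : 0 < lam₂)

theorem inner_laplaceKernel₂_laplaceKernel₂ (z w : ℍ × ℍ) :
    inner ℂ (laplaceKernel₂ h₁ h₂ z) (laplaceKernel₂ h₁ h₂ w) =
      (Real.Gamma lam₁ * powKernel lam₁ z.1 w.1) * (Real.Gamma lam₂ * powKernel lam₂ z.2 w.2) := by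
  rw [laplaceKernel₂, laplaceKernel₂, inner_quadrantTensor, inner_laplaceKernel_eq_powKernel,
    inner_laplaceKernel_eq_powKernel]

theorem isL2Model₂_iff
    {ρ : SLTilde × SLTilde →* (QuadrantL2 lam₁ lam₂ ≃ₗᵢ[ℂ] QuadrantL2 lam₁ lam₂)} :
    IsL2Model₂ lam₁ lam₂ ρ ↔ ∀ g F z, inner ℂ (laplaceKernel₂ h₁ h₂ z) (ρ g F) =
      multiplier lam₁ g.1 z.1 * multiplier lam₂ g.2 z.2 *
        inner ℂ (laplaceKernel₂ h₁ h₂ (g.1⁻¹.toSL • z.1, g.2⁻¹.toSL • z.2)) F := by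
  simp only [IsL2Model₂, inner_laplaceKernel₂]
  refine forall₂_congr fun g F => ⟨fun h z => congrFun (congrFun h z.1) z.2, fun h => ?_⟩
  funext z₁ z₂
  exact h (z₁, z₂)

theorem existsUnique_isL2Model₂ {lam₁ lam₂ : ℝ} (h₁ : 0 < lam₁) (h₂ : 0 < lam₂) :
    ∃! ρ, IsL2Model₂ lam₁ lam₂ ρ := by
  simp only [isL2Model₂_iff h₁ h₂]
  refine existsUnique_unitary_of_multiplier (G := SLTilde × SLTilde)
    (laplaceKernel₂_total h₁ h₂)
    (fun g z => multiplier lam₁ g.1 z.1 * multiplier lam₂ g.2 z.2)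
    (fun g z => (g.1⁻¹.toSL • z.1, g.2⁻¹.toSL • z.2)) (fun z => ?_) (fun z => ?_)
    (fun g h z => ?_) (fun g h z => ?_) fun g z w => ?_
  · simp only [Prod.fst_one, Prod.snd_one, multiplier_one, mul_one]
  · simp only [Prod.fst_one, Prod.snd_one, one_inv_toSL_smul]
  · simp only [Prod.fst_mul, Prod.snd_mul, multiplier_mul]
    ring
  · simp only [Prod.fst_mul, Prod.snd_mul, mul_inv_toSL_smul]
  · rw [inner_laplaceKernel₂_laplaceKernel₂, inner_laplaceKernel₂_laplaceKernel₂,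
      ← multiplier_mul_conj_mul_powKernel lam₁ g.1 z.1 w.1,
      ← multiplier_mul_conj_mul_powKernel lam₂ g.2 z.2 w.2, map_mul]
    ring

theorem isL2Model₂_l2Model₂ {lam₁ lam₂ : ℝ} (h₁ : 0 < lam₁) (h₂ : 0 < lam₂) :
    IsL2Model₂ lam₁ lam₂ (l2Model₂ lam₁ lam₂) := by
  have hex : ∃ ρ, IsL2Model₂ lam₁ lam₂ ρ := (existsUnique_isL2Model₂ h₁ h₂).exists
  rw [l2Model₂, dif_pos hex]
  exact hex.choose_spec

theorem inner_laplaceKernel₂_l2Model₂ (g : SLTilde × SLTilde) (F : QuadrantL2 lam₁ lam₂)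
    (z : ℍ × ℍ) : inner ℂ (laplaceKernel₂ h₁ h₂ z) (l2Model₂ lam₁ lam₂ g F) =
      multiplier lam₁ g.1 z.1 * multiplier lam₂ g.2 z.2 *
        inner ℂ (laplaceKernel₂ h₁ h₂ (g.1⁻¹.toSL • z.1, g.2⁻¹.toSL • z.2)) F :=
  (isL2Model₂_iff h₁ h₂).1 (isL2Model₂_l2Model₂ h₁ h₂) g F z

end Representations

/-! ### The completed tensor product as the `L²`-space of the quadrant. -/

section CompletedTensorProduct

variable {lam₁ lam₂ : ℝ}

theorem inner_lift_quadrantTensorBilin (s t : HalfLineL2 lam₁ ⊗[ℂ] HalfLineL2 lam₂) :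
    inner ℂ (TensorProduct.lift (quadrantTensorBilin lam₁ lam₂) s)
      (TensorProduct.lift (quadrantTensorBilin lam₁ lam₂) t) = inner ℂ s t := by
  induction s with
  | zero => simp
  | add s s' hs hs' => rw [map_add, inner_add_left, inner_add_left, hs, hs']
  | tmul u v =>
    induction t with
    | zero => simp
    | add t t' ht ht' => rw [map_add, inner_add_right, inner_add_right, ht, ht']
    | tmul u' v' =>
      rw [TensorProduct.lift.tmul, TensorProduct.lift.tmul, TensorProduct.inner_tmul]
      exact inner_quadrantTensor u u' v v'

theorem norm_lift_quadrantTensorBilin (s : HalfLineL2 lam₁ ⊗[ℂ] HalfLineL2 lam₂) :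
    ‖TensorProduct.lift (quadrantTensorBilin lam₁ lam₂) s‖ = ‖s‖ := by
  rw [@norm_eq_sqrt_re_inner ℂ, @norm_eq_sqrt_re_inner ℂ, inner_lift_quadrantTensorBilin]

/-- The completed tensor product of the spaces `L²(ℝ₊)_lam` is the `L²`-space of the quadrant. -/
theorem exists_completedTensorProduct_equiv (h₁ : 0 < lam₁) (h₂ : 0 < lam₂) :
    ∃ T : UniformSpace.Completion (HalfLineL2 lam₁ ⊗[ℂ] HalfLineL2 lam₂) ≃ₗᵢ[ℂ]
        QuadrantL2 lam₁ lam₂,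
      ∀ (u : HalfLineL2 lam₁) (v : HalfLineL2 lam₂),
        T ((u ⊗ₜ[ℂ] v : HalfLineL2 lam₁ ⊗[ℂ] HalfLineL2 lam₂) : UniformSpace.Completion _) =
          quadrantTensor u v := by
  set S := TensorProduct.lift (quadrantTensorBilin lam₁ lam₂)
  let e : (HalfLineL2 lam₁ ⊗[ℂ] HalfLineL2 lam₂) →ₗ[ℂ]
      UniformSpace.Completion (HalfLineL2 lam₁ ⊗[ℂ] HalfLineL2 lam₂) :=
    (UniformSpace.Completion.toComplₗᵢ (𝕜 := ℂ)
      (E := HalfLineL2 lam₁ ⊗[ℂ] HalfLineL2 lam₂)).toLinearMap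
  have he : ∀ s, e s = (s : UniformSpace.Completion _) := fun s => rfl
  have hd : DenseRange e := UniformSpace.Completion.denseRange_coe
  have hb : ∃ C, ∀ s, ‖S s‖ ≤ C * ‖e s‖ := ⟨1, fun s => by
    rw [norm_lift_quadrantTensorBilin, he, UniformSpace.Completion.norm_coe, one_mul]⟩
  set W := S.extendOfNorm e
  have hW : ∀ s, W (e s) = S s := fun s => LinearMap.extendOfNorm_eq hd hb s
  let I : UniformSpace.Completion (HalfLineL2 lam₁ ⊗[ℂ] HalfLineL2 lam₂) →ₗᵢ[ℂ]
      QuadrantL2 lam₁ lam₂ :=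
    ⟨W.toLinearMap, fun f => hd.induction_on (p := fun f => ‖W f‖ = ‖f‖) f
      (isClosed_eq W.continuous.norm continuous_norm) fun s => by
        rw [hW, norm_lift_quadrantTensorBilin, he, UniformSpace.Completion.norm_coe]⟩
  have hI : ∀ (u : HalfLineL2 lam₁) (v : HalfLineL2 lam₂),
      I ((u ⊗ₜ[ℂ] v : HalfLineL2 lam₁ ⊗[ℂ] HalfLineL2 lam₂) : UniformSpace.Completion _) =
        quadrantTensor u v := fun u v => (hW (u ⊗ₜ[ℂ] v)).trans (TensorProduct.lift.tmul _ _)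
  -- The range is closed, being the isometric image of a complete space, and it contains the total
  -- family `laplaceKernel₂`.
  have hs : Function.Surjective I := by
    have hc : IsClosed (LinearMap.range I.toLinearMap : Set (QuadrantL2 lam₁ lam₂)) := by
      rw [LinearMap.coe_range]
      exact I.isometry.isClosedEmbedding.isClosed_range
    have hle : Submodule.span ℂ (range (laplaceKernel₂ h₁ h₂)) ≤ LinearMap.range I.toLinearMap := by
      rw [Submodule.span_le]
      rintro _ ⟨z, rfl⟩
      exact ⟨_, hI _ _⟩
    have htop : LinearMap.range I.toLinearMap = ⊤ := by
      rw [eq_top_iff, ← laplaceKernel₂_total h₁ h₂]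
      exact Submodule.topologicalClosure_minimal _ hle hc
    exact LinearMap.range_eq_top.1 htop
  exact ⟨LinearIsometryEquiv.ofSurjective I hs, hI⟩

/-- Paired with the product kernels, both sides factor into the same one-variable matrix
coefficients. -/
theorem quadrantTensor_l2Model (h₁ : 0 < lam₁) (h₂ : 0 < lam₂) (g₁ g₂ : SLTilde)
    (u : HalfLineL2 lam₁) (v : HalfLineL2 lam₂) :
    quadrantTensor (l2Model lam₁ g₁ u) (l2Model lam₂ g₂ v) =
      l2Model₂ lam₁ lam₂ (g₁, g₂) (quadrantTensor u v) := by
  refine eq_of_forall_inner_eq (laplaceKernel₂_total h₁ h₂) fun z => ?_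
  rw [inner_laplaceKernel₂_l2Model₂, laplaceKernel₂, inner_quadrantTensor, laplaceKernel₂,
    inner_quadrantTensor, inner_laplaceKernel_l2Model, inner_laplaceKernel_l2Model]
  ring

end CompletedTensorProduct

/-! ### The coordinates `t = x + y`, `v = (y - x) / (x + y)`, with Jacobian `t / 2`. -/

section QuadrantCoordinates

/-- The coordinates `x = t (1 - v) / 2`, `y = t (1 + v) / 2` on the open quadrant. -/
noncomputable def quadrantCoord (p : ℝ × ℝ) : ℝ × ℝ := (p.1 * (1 - p.2) / 2, p.1 * (1 + p.2) / 2)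

/-- The derivative of `quadrantCoord`. -/
noncomputable def fderivQuadrantCoord (p : ℝ × ℝ) : ℝ × ℝ →L[ℝ] ℝ × ℝ :=
  (Matrix.toLin (.finTwoProd ℝ) (.finTwoProd ℝ)
    !![(1 - p.2) / 2, -p.1 / 2; (1 + p.2) / 2, p.1 / 2]).toContinuousLinearMap

theorem hasFDerivAt_quadrantCoord (p : ℝ × ℝ) :
    HasFDerivAt quadrantCoord (fderivQuadrantCoord p) p := by
  unfold fderivQuadrantCoord
  rw [Matrix.toLin_finTwoProd_toContinuousLinearMap]
  have h1 : HasFDerivAt (fun p : ℝ × ℝ => p.1 * (1 - p.2) / 2) _ p :=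
    ((hasFDerivAt_fst (𝕜 := ℝ) (p := p)).mul ((hasFDerivAt_snd (𝕜 := ℝ) (p := p)).const_sub 1)).mul_const (2⁻¹ : ℝ)
  have h2 : HasFDerivAt (fun p : ℝ × ℝ => p.1 * (1 + p.2) / 2) _ p :=
    ((hasFDerivAt_fst (𝕜 := ℝ) (p := p)).mul ((hasFDerivAt_snd (𝕜 := ℝ) (p := p)).const_add 1)).mul_const (2⁻¹ : ℝ)
  refine (h1.prodMk h2).congr_fderiv ?_
  ext <;> simp <;> ring

theorem det_fderivQuadrantCoord (p : ℝ × ℝ) : (fderivQuadrantCoord p).det = p.1 / 2 := by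
  unfold fderivQuadrantCoord
  simp only [LinearMap.det_toContinuousLinearMap, LinearMap.det_toLin, Matrix.det_fin_two_of]
  ring

theorem quadrantCoord_fst_add_snd (p : ℝ × ℝ) :
    (quadrantCoord p).1 + (quadrantCoord p).2 = p.1 := by
  simp only [quadrantCoord]
  ring

theorem quadrantCoord_snd_sub_fst (p : ℝ × ℝ) :
    (quadrantCoord p).2 - (quadrantCoord p).1 = p.1 * p.2 := by
  simp only [quadrantCoord]
  ring

theorem measurableSet_strip : MeasurableSet (Ioi (0 : ℝ) ×ˢ Ioo (-1 : ℝ) 1) :=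
  measurableSet_Ioi.prod measurableSet_Ioo

theorem measurableSet_quadrant : MeasurableSet (Ioi (0 : ℝ) ×ˢ Ioi (0 : ℝ)) :=
  measurableSet_Ioi.prod measurableSet_Ioi

theorem injOn_quadrantCoord : InjOn quadrantCoord (Ioi (0 : ℝ) ×ˢ Ioo (-1 : ℝ) 1) := by
  intro p hp q _ h
  have h1 : p.1 = q.1 := by rw [← quadrantCoord_fst_add_snd p, h, quadrantCoord_fst_add_snd]
  have h2 : p.1 * p.2 = q.1 * q.2 := by
    rw [← quadrantCoord_snd_sub_fst p, h, quadrantCoord_snd_sub_fst]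
  have hp1 : 0 < p.1 := hp.1
  rw [← h1] at h2
  exact Prod.ext h1 (mul_left_cancel₀ hp1.ne' h2)

theorem image_quadrantCoord :
    quadrantCoord '' (Ioi (0 : ℝ) ×ˢ Ioo (-1 : ℝ) 1) = Ioi (0 : ℝ) ×ˢ Ioi (0 : ℝ) := by
  ext q
  constructor
  · rintro ⟨p, ⟨h1, h2, h3⟩, rfl⟩
    have h1' : 0 < p.1 := h1
    have a : 0 < 1 - p.2 := by linarith
    have b : 0 < 1 + p.2 := by linarith
    exact ⟨show 0 < p.1 * (1 - p.2) / 2 by positivity, show 0 < p.1 * (1 + p.2) / 2 by positivity⟩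
  · rintro ⟨h1, h2⟩
    have h1' : 0 < q.1 := h1
    have h2' : 0 < q.2 := h2
    have h0 : 0 < q.1 + q.2 := by positivity
    refine ⟨(q.1 + q.2, (q.2 - q.1) / (q.1 + q.2)), ⟨h0, ?_, ?_⟩, ?_⟩
    · change -1 < (q.2 - q.1) / (q.1 + q.2)
      rw [lt_div_iff₀ h0]
      linarith
    · change (q.2 - q.1) / (q.1 + q.2) < 1
      rw [div_lt_one h0]
      linarith
    · ext
      · simp only [quadrantCoord]
        field_simp
        ring
      · simp only [quadrantCoord]
        field_simp
        ring

variable {E : Type*} [NormedAddCommGroup E] [NormedSpace ℝ E]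

theorem integral_quadrant (f : ℝ × ℝ → E) :
    ∫ p in Ioi (0 : ℝ) ×ˢ Ioi (0 : ℝ), f p =
      ∫ p in Ioi (0 : ℝ) ×ˢ Ioo (-1 : ℝ) 1, (p.1 / 2) • f (quadrantCoord p) := by
  rw [← image_quadrantCoord, integral_image_eq_integral_abs_det_fderiv_smul volume
    measurableSet_strip (fun p _ => (hasFDerivAt_quadrantCoord p).hasFDerivWithinAt)
    injOn_quadrantCoord]
  refine setIntegral_congr_fun measurableSet_strip fun p hp => ?_
  have : 0 < p.1 := hp.1
  rw [det_fderivQuadrantCoord, abs_of_pos (by positivity)]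

theorem integrableOn_quadrant_iff {f : ℝ × ℝ → E} :
    IntegrableOn f (Ioi (0 : ℝ) ×ˢ Ioi (0 : ℝ)) ↔
      IntegrableOn (fun p => (p.1 / 2) • f (quadrantCoord p)) (Ioi (0 : ℝ) ×ˢ Ioo (-1 : ℝ) 1) := by
  rw [← image_quadrantCoord, integrableOn_image_iff_integrableOn_abs_det_fderiv_smul volume
    measurableSet_strip (fun p _ => (hasFDerivAt_quadrantCoord p).hasFDerivWithinAt)
    injOn_quadrantCoord]
  refine integrableOn_congr_fun (fun p hp => ?_) measurableSet_strip
  have : 0 < p.1 := hp.1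
  rw [det_fderivQuadrantCoord, abs_of_pos (by positivity)]

theorem ae_quadrant_add {P : ℝ → Prop} (h : ∀ᵐ x ∂(volume.restrict (Ioi (0 : ℝ))), P x) :
    ∀ᵐ p ∂(volume.restrict (Ioi (0 : ℝ) ×ˢ Ioi (0 : ℝ))), P (p.1 + p.2) := by
  rw [ae_restrict_iff' measurableSet_Ioi] at h
  rw [ae_restrict_iff' measurableSet_quadrant]
  -- Addition is the measure preserving shear `(x, y) ↦ (x, x + y)` followed by a projection, so
  -- null sets pull back to null sets.
  have hq : Measure.QuasiMeasurePreserving (fun p : ℝ × ℝ => p.1 + p.2) volume volume :=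
    Measure.quasiMeasurePreserving_snd.comp
      (measurePreserving_prod_add (volume : Measure ℝ) (volume : Measure ℝ)).quasiMeasurePreserving
  filter_upwards [hq.ae h] with p hp hpq
  exact hp (show 0 < p.1 + p.2 from add_pos hpq.1 hpq.2)

theorem volume_restrict_strip : (volume : Measure (ℝ × ℝ)).restrict (Ioi (0 : ℝ) ×ˢ Ioo (-1 : ℝ) 1) =
    (volume.restrict (Ioi (0 : ℝ))).prod (volume.restrict (Ioo (-1 : ℝ) 1)) := by
  rw [Measure.prod_restrict, Measure.volume_eq_prod]

theorem integral_Ioo_eq_intervalIntegral (f : ℝ → E) :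
    ∫ v in Ioo (-1 : ℝ) 1, f v = ∫ v in (-1 : ℝ)..1, f v := by
  rw [intervalIntegral.integral_of_le (by norm_num), integral_Ioc_eq_integral_Ioo]

end QuadrantCoordinates

/-! ### The holographic operators in the coordinates `(t, v)`. -/

section HolographicOperator

variable {lam₁ lam₂ : ℝ}

theorem holographic_quadrantCoord (n : ℕ) (h : ℝ → ℂ) {p : ℝ × ℝ}
    (hp : p ∈ Ioi (0 : ℝ) ×ˢ Ioo (-1 : ℝ) 1) :
    holographic lam₁ lam₂ n h (quadrantCoord p) =
      ((((1 - p.2) ^ (lam₁ - 1) * (1 + p.2) ^ (lam₂ - 1) * jacobiP n (lam₁ - 1) (lam₂ - 1) p.2) /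
        (2 ^ (lam₁ + lam₂ - 2) * p.1 ^ (n + 1)) : ℝ) : ℂ) * h p.1 := by
  have h0 : 0 < p.1 := hp.1
  have h1 : 0 < 1 - p.2 := by linarith [hp.2.2]
  have h2 : 0 < 1 + p.2 := by linarith [hp.2.1]
  rw [holographic, quadrantCoord_fst_add_snd, quadrantCoord_snd_sub_fst,
    mul_div_cancel_left₀ _ h0.ne']
  congr 2
  simp only [quadrantCoord]
  rw [mul_div_assoc p.1 (1 - p.2), mul_div_assoc p.1 (1 + p.2), Real.mul_rpow h0.le (by positivity),
    Real.mul_rpow h0.le (by positivity), Real.div_rpow h1.le two_pos.le,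
    Real.div_rpow h2.le two_pos.le,
    show lam₁ + lam₂ + n - 1 = (lam₁ - 1) + (lam₂ - 1) + ((n + 1 : ℕ) : ℝ) by push_cast; ring,
    show lam₁ + lam₂ - 2 = (lam₁ - 1) + (lam₂ - 1) by ring,
    Real.rpow_add_natCast h0.ne', Real.rpow_add h0, Real.rpow_add two_pos]
  have := Real.rpow_pos_of_pos h0 (lam₁ - 1)
  have := Real.rpow_pos_of_pos h0 (lam₂ - 1)
  field_simp

theorem quadrantDensity_quadrantCoord {p : ℝ × ℝ} (hp : p ∈ Ioi (0 : ℝ) ×ˢ Ioo (-1 : ℝ) 1) :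
    (quadrantCoord p).1 ^ (1 - lam₁) * (quadrantCoord p).2 ^ (1 - lam₂) =
      2 ^ (lam₁ + lam₂ - 2) * p.1 ^ (2 - lam₁ - lam₂) /
        ((1 - p.2) ^ (lam₁ - 1) * (1 + p.2) ^ (lam₂ - 1)) := by
  have h0 : 0 < p.1 := hp.1
  have h1 : 0 < 1 - p.2 := by linarith [hp.2.2]
  have h2 : 0 < 1 + p.2 := by linarith [hp.2.1]
  simp only [quadrantCoord]
  rw [mul_div_assoc p.1 (1 - p.2), mul_div_assoc p.1 (1 + p.2), Real.mul_rpow h0.le (by positivity),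
    Real.mul_rpow h0.le (by positivity), Real.div_rpow h1.le two_pos.le,
    Real.div_rpow h2.le two_pos.le,
    show (1 - lam₁) = -(lam₁ - 1) by ring, show (1 - lam₂) = -(lam₂ - 1) by ring,
    show lam₁ + lam₂ - 2 = (lam₁ - 1) + (lam₂ - 1) by ring,
    show 2 - lam₁ - lam₂ = -(lam₁ - 1) + -(lam₂ - 1) by ring,
    Real.rpow_add h0, Real.rpow_add two_pos, Real.rpow_neg two_pos.le, Real.rpow_neg two_pos.le,
    Real.rpow_neg h1.le, Real.rpow_neg h2.le]
  field_simp

theorem measurable_holographic (n : ℕ) {h : ℝ → ℂ} (hh : Measurable h) :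
    Measurable (holographic lam₁ lam₂ n h) := by
  have hj := (continuous_jacobiP n (lam₁ - 1) (lam₂ - 1)).measurable
  unfold holographic
  fun_prop

/-- The Jacobi weight inside the operator is inverse to the density of the quadrant, so only the
polynomial remains in `v`. -/
theorem density_mul_conj_holographic_mul (n : ℕ) (h : ℝ → ℂ) (F : ℝ × ℝ → ℂ) {p : ℝ × ℝ}
    (hp : p ∈ Ioi (0 : ℝ) ×ˢ Ioo (-1 : ℝ) 1) :
    (p.1 / 2) • ((((quadrantCoord p).1 ^ (1 - lam₁) * (quadrantCoord p).2 ^ (1 - lam₂) : ℝ) : ℂ) *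
      (conj (holographic lam₁ lam₂ n h (quadrantCoord p)) * F (quadrantCoord p))) =
    ((p.1 ^ (2 - lam₁ - lam₂ - n) / 2 * jacobiP n (lam₁ - 1) (lam₂ - 1) p.2 : ℝ) : ℂ) *
      (conj (h p.1) * F (quadrantCoord p)) := by
  have h0 : 0 < p.1 := hp.1
  have h1 : 0 < 1 - p.2 := by linarith [hp.2.2]
  have h2 : 0 < 1 + p.2 := by linarith [hp.2.1]
  rw [holographic_quadrantCoord n h hp, quadrantDensity_quadrantCoord hp, map_mul,
    Complex.conj_ofReal, Complex.real_smul, mul_assoc (Complex.ofReal _) (conj (h p.1)), ← mul_assoc,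
    ← mul_assoc, ← Complex.ofReal_mul, ← Complex.ofReal_mul, Real.rpow_sub_natCast h0.ne']
  congr 2
  have := Real.rpow_pos_of_pos h1 (lam₁ - 1)
  have := Real.rpow_pos_of_pos h2 (lam₂ - 1)
  have := Real.rpow_pos_of_pos two_pos (lam₁ + lam₂ - 2)
  rw [pow_succ]
  field_simp

/-- The variables separate. For `m = n` the power of `t` is the density of `L²(ℝ₊)` with parameter
`lam₁ + lam₂ + 2 n`. -/
theorem density_mul_conj_holographic_mul_holographic (m n : ℕ) (h h' : ℝ → ℂ) {p : ℝ × ℝ}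
    (hp : p ∈ Ioi (0 : ℝ) ×ˢ Ioo (-1 : ℝ) 1) :
    (p.1 / 2) • ((((quadrantCoord p).1 ^ (1 - lam₁) * (quadrantCoord p).2 ^ (1 - lam₂) : ℝ) : ℂ) *
      (conj (holographic lam₁ lam₂ n h (quadrantCoord p)) *
        holographic lam₁ lam₂ m h' (quadrantCoord p))) =
    (((p.1 ^ (1 - (lam₁ + lam₂ + n + m)) : ℝ) : ℂ) * (conj (h p.1) * h' p.1)) *
      ((((1 - p.2) ^ (lam₁ - 1) * (1 + p.2) ^ (lam₂ - 1) *
        jacobiP n (lam₁ - 1) (lam₂ - 1) p.2 * jacobiP m (lam₁ - 1) (lam₂ - 1) p.2) /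
          2 ^ (lam₁ + lam₂ - 1) : ℝ) : ℂ) := by
  have h0 : 0 < p.1 := hp.1
  rw [density_mul_conj_holographic_mul n h _ hp, holographic_quadrantCoord m h' hp,
    show 1 - (lam₁ + lam₂ + n + m) = 2 - lam₁ - lam₂ - n - ((m + 1 : ℕ) : ℝ) by push_cast; ring,
    show lam₁ + lam₂ - 1 = lam₁ + lam₂ - 2 + 1 by ring,
    Real.rpow_sub_natCast h0.ne' (2 - lam₁ - lam₂ - n) (m + 1), Real.rpow_add_one two_ne_zero]
  have := Real.rpow_pos_of_pos two_pos (lam₁ + lam₂ - 2)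
  push_cast
  ring

theorem integral_conj_holographic_mul_holographic (m n : ℕ) (h h' : ℝ → ℂ) :
    ∫ p, conj (holographic lam₁ lam₂ n h p) * holographic lam₁ lam₂ m h' p
        ∂(quadrantMeasure lam₁ lam₂) =
      (∫ t in Ioi (0 : ℝ), ((t ^ (1 - (lam₁ + lam₂ + n + m)) : ℝ) : ℂ) * (conj (h t) * h' t)) *
      (((∫ v in (-1 : ℝ)..1, (1 - v) ^ (lam₁ - 1) * (1 + v) ^ (lam₂ - 1) *
        jacobiP n (lam₁ - 1) (lam₂ - 1) v * jacobiP m (lam₁ - 1) (lam₂ - 1) v) /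
          2 ^ (lam₁ + lam₂ - 1) : ℝ) : ℂ) := by
  rw [integral_quadrantMeasure, integral_quadrant,
    setIntegral_congr_fun measurableSet_strip fun p hp =>
      density_mul_conj_holographic_mul_holographic m n h h' hp, volume_restrict_strip,
    integral_prod_mul (fun t : ℝ => ((t ^ (1 - (lam₁ + lam₂ + n + m)) : ℝ) : ℂ) *
      (conj (h t) * h' t)) (fun v : ℝ => ((((1 - v) ^ (lam₁ - 1) * (1 + v) ^ (lam₂ - 1) *
        jacobiP n (lam₁ - 1) (lam₂ - 1) v * jacobiP m (lam₁ - 1) (lam₂ - 1) v) /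
          2 ^ (lam₁ + lam₂ - 1) : ℝ) : ℂ)), integral_complex_ofReal, integral_div,
    integral_Ioo_eq_intervalIntegral]

theorem memLp_holographic (h₁ : 1 < lam₁) (h₂ : 1 < lam₂) (n : ℕ)
    (h : HalfLineL2 (lam₁ + lam₂ + 2 * n)) :
    MemLp (holographic lam₁ lam₂ n h) 2 (quadrantMeasure lam₁ lam₂) := by
  have hm : AEStronglyMeasurable (holographic lam₁ lam₂ n h) (quadrantMeasure lam₁ lam₂) :=
    (measurable_holographic n (Lp.stronglyMeasurable h).measurable).aestronglyMeasurable
  rw [memLp_two_iff_integrable_sq_norm hm]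
  have key : Integrable (fun p => conj (holographic lam₁ lam₂ n h p) *
      holographic lam₁ lam₂ n h p) (quadrantMeasure lam₁ lam₂) := by
    rw [integrable_quadrantMeasure_iff, integrableOn_quadrant_iff, integrableOn_congr_fun
      (fun p hp => density_mul_conj_holographic_mul_holographic n n h h hp) measurableSet_strip,
      IntegrableOn, volume_restrict_strip]
    have i1 : IntegrableOn (fun t : ℝ => ((t ^ (1 - (lam₁ + lam₂ + n + n)) : ℝ) : ℂ) *
        (conj (h t) * h t)) (Ioi 0) := by
      have := (L2.integrable_inner (𝕜 := ℂ) h h)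
      rw [integrable_halfLineMeasure_iff] at this
      refine this.congr_fun (fun t _ => ?_) measurableSet_Ioi
      simp only [RCLike.inner_apply']
      congr 4
      ring
    have i2 : IntegrableOn (fun v : ℝ => ((((1 - v) ^ (lam₁ - 1) * (1 + v) ^ (lam₂ - 1) *
        jacobiP n (lam₁ - 1) (lam₂ - 1) v * jacobiP n (lam₁ - 1) (lam₂ - 1) v) /
          2 ^ (lam₁ + lam₂ - 1) : ℝ) : ℂ)) (Ioo (-1) 1) := by
      have c := ((((continuous_jacobiWeight (show 0 ≤ lam₁ - 1 by linarith)
        (show 0 ≤ lam₂ - 1 by linarith)).mul (continuous_jacobiP n (lam₁ - 1) (lam₂ - 1))).mul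
        (continuous_jacobiP n (lam₁ - 1) (lam₂ - 1))).div_const (2 ^ (lam₁ + lam₂ - 1)))
      exact ((Complex.continuous_ofReal.comp c).continuousOn.integrableOn_Icc).mono_set
        Ioo_subset_Icc_self
    exact i1.mul_prod i2
  refine key.norm.congr (Filter.Eventually.of_forall fun p => ?_)
  simp only [norm_mul, RCLike.norm_conj, pow_two]

end HolographicOperator

/-! ### Orthogonality, norms and completeness of the holographic operators. -/

section HolographicOperatorL2

variable {lam₁ lam₂ : ℝ}

/-- Well-definedness on classes: `h` enters only through `h(x + y)`, and addition pulls null sets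
back to null sets. -/
theorem holographic_congr_ae (n : ℕ) {lam : ℝ} {h h' : ℝ → ℂ}
    (hh : h =ᵐ[halfLineMeasure lam] h') :
    holographic lam₁ lam₂ n h =ᵐ[quadrantMeasure lam₁ lam₂] holographic lam₁ lam₂ n h' := by
  have := (quadrantMeasure_absolutelyContinuous lam₁ lam₂).ae_le
    (ae_quadrant_add ((absolutelyContinuous_halfLineMeasure lam).ae_le hh))
  filter_upwards [this] with p hp
  rw [holographic, holographic, hp]

/-- The holographic operator on `L²`. -/
noncomputable def holographicL2 (h₁ : 1 < lam₁) (h₂ : 1 < lam₂) (n : ℕ) :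
    HalfLineL2 (lam₁ + lam₂ + 2 * n) →ₗ[ℂ] QuadrantL2 lam₁ lam₂ where
  toFun h := (memLp_holographic h₁ h₂ n h).toLp _
  map_add' h h' := by
    rw [← MemLp.toLp_add]
    apply MemLp.toLp_congr
    filter_upwards [holographic_congr_ae (lam₁ := lam₁) (lam₂ := lam₂) n (Lp.coeFn_add h h')]
      with p hp
    rw [hp, Pi.add_apply, holographic, holographic, holographic, Pi.add_apply, mul_add]
  map_smul' c h := by
    rw [RingHom.id_apply, ← MemLp.toLp_const_smul]
    apply MemLp.toLp_congr
    filter_upwards [holographic_congr_ae (lam₁ := lam₁) (lam₂ := lam₂) n (Lp.coeFn_smul c h)]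
      with p hp
    rw [hp, Pi.smul_apply, holographic, holographic, Pi.smul_apply, mul_smul_comm]

variable (h₁ : 1 < lam₁) (h₂ : 1 < lam₂)

theorem coeFn_holographicL2 (n : ℕ) (h : HalfLineL2 (lam₁ + lam₂ + 2 * n)) :
    holographicL2 h₁ h₂ n h =ᵐ[quadrantMeasure lam₁ lam₂] holographic lam₁ lam₂ n h :=
  MemLp.coeFn_toLp (memLp_holographic h₁ h₂ n h)

theorem inner_holographicL2_holographicL2 (m n : ℕ) (h : HalfLineL2 (lam₁ + lam₂ + 2 * n))
    (h' : HalfLineL2 (lam₁ + lam₂ + 2 * m)) :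
    inner ℂ (holographicL2 h₁ h₂ n h) (holographicL2 h₁ h₂ m h') =
      (∫ t in Ioi (0 : ℝ), ((t ^ (1 - (lam₁ + lam₂ + n + m)) : ℝ) : ℂ) * (conj (h t) * h' t)) *
      (((∫ v in (-1 : ℝ)..1, (1 - v) ^ (lam₁ - 1) * (1 + v) ^ (lam₂ - 1) *
        jacobiP n (lam₁ - 1) (lam₂ - 1) v * jacobiP m (lam₁ - 1) (lam₂ - 1) v) /
          2 ^ (lam₁ + lam₂ - 1) : ℝ) : ℂ) := by
  rw [← integral_conj_holographic_mul_holographic, L2.inner_def]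
  refine integral_congr_ae ?_
  filter_upwards [coeFn_holographicL2 h₁ h₂ n h, coeFn_holographicL2 h₁ h₂ m h'] with p hp hp'
  rw [hp, hp', RCLike.inner_apply']

theorem inner_holographicL2_of_ne {m n : ℕ} (hmn : n ≠ m) (h : HalfLineL2 (lam₁ + lam₂ + 2 * n))
    (h' : HalfLineL2 (lam₁ + lam₂ + 2 * m)) :
    inner ℂ (holographicL2 h₁ h₂ n h) (holographicL2 h₁ h₂ m h') = 0 := by
  have hz : ∫ v in (-1 : ℝ)..1, (1 - v) ^ (lam₁ - 1) * (1 + v) ^ (lam₂ - 1) *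
      jacobiP n (lam₁ - 1) (lam₂ - 1) v * jacobiP m (lam₁ - 1) (lam₂ - 1) v = 0 := by
    rcases le_total m n with hle | hle
    · rw [integral_jacobiP_mul_jacobiP hle (by linarith) (by linarith), if_neg hmn.symm]
    · have := integral_jacobiP_mul_jacobiP hle (α := lam₁ - 1) (β := lam₂ - 1) (by linarith)
        (by linarith)
      rw [if_neg hmn] at this
      rw [← this]
      refine intervalIntegral.integral_congr fun v _ => ?_
      ring
  rw [inner_holographicL2_holographicL2, hz]
  simp

theorem inner_holographicL2_self (n : ℕ) (h h' : HalfLineL2 (lam₁ + lam₂ + 2 * n)) :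
    inner ℂ (holographicL2 h₁ h₂ n h) (holographicL2 h₁ h₂ n h') =
      (planchWeight lam₁ lam₂ n : ℂ) * inner ℂ h h' := by
  have h2 := (Real.rpow_pos_of_pos two_pos (lam₁ + lam₂ - 1)).ne'
  rw [inner_holographicL2_holographicL2, integral_jacobiP_sq_eq_planchWeight h₁ h₂,
    mul_div_cancel_left₀ _ h2, L2.inner_def, integral_halfLineMeasure, mul_comm]
  congr 1
  refine setIntegral_congr_fun measurableSet_Ioi fun t _ => ?_
  simp only [RCLike.inner_apply']
  congr 4
  ring

theorem norm_holographicL2 (n : ℕ) (h : HalfLineL2 (lam₁ + lam₂ + 2 * n)) :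
    ‖holographicL2 h₁ h₂ n h‖ = √(planchWeight lam₁ lam₂ n) * ‖h‖ := by
  rw [@norm_eq_sqrt_re_inner ℂ, inner_holographicL2_self, RCLike.re_to_complex,
    Complex.re_ofReal_mul, Real.sqrt_mul (planchWeight_pos h₁ h₂ n).le,
    @norm_eq_sqrt_re_inner ℂ _ _ _ _ h]
  rfl

theorem inner_holographicL2 (n : ℕ) (h : HalfLineL2 (lam₁ + lam₂ + 2 * n))
    (F : QuadrantL2 lam₁ lam₂) :
    inner ℂ (holographicL2 h₁ h₂ n h) F = ∫ p in Ioi (0 : ℝ) ×ˢ Ioo (-1 : ℝ) 1,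
      ((p.1 ^ (2 - lam₁ - lam₂ - n) / 2 * jacobiP n (lam₁ - 1) (lam₂ - 1) p.2 : ℝ) : ℂ) *
        (conj (h p.1) * F (quadrantCoord p)) := by
  have e : inner ℂ (holographicL2 h₁ h₂ n h) F =
      ∫ p, conj (holographic lam₁ lam₂ n h p) * F p ∂(quadrantMeasure lam₁ lam₂) := by
    rw [L2.inner_def]
    refine integral_congr_ae ?_
    filter_upwards [coeFn_holographicL2 h₁ h₂ n h] with p hp
    rw [hp, RCLike.inner_apply']
  rw [e, integral_quadrantMeasure, integral_quadrant]
  exact setIntegral_congr_fun measurableSet_strip fun p hp =>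
    density_mul_conj_holographic_mul n h F hp

theorem ae_strip_fst {P : ℝ → Prop} (h : ∀ᵐ x ∂(volume.restrict (Ioi (0 : ℝ))), P x) :
    ∀ᵐ p ∂(volume.restrict (Ioi (0 : ℝ) ×ˢ Ioo (-1 : ℝ) 1)), P p.1 := by
  rw [volume_restrict_strip]
  exact Measure.quasiMeasurePreserving_fst.ae h

theorem memLp_rpow_mul_cexp {lam s : ℝ} (hs : 0 < 2 * s + 2 - lam) {A : ℂ} (hA : 0 < A.re) :
    MemLp (fun x : ℝ => ((x ^ s : ℝ) : ℂ) * Complex.exp (-A * x)) 2 (halfLineMeasure lam) := by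
  rw [memLp_two_iff_integrable_sq_norm ((aestronglyMeasurable_rpow_mul_cexp _ _).mono_ac
    (halfLineMeasure_absolutelyContinuous lam)), integrable_halfLineMeasure_iff_real]
  refine (integrableOn_rpow_mul_exp_neg_mul hs (show 0 < 2 * A.re by linarith)).congr_fun
    (fun x hx => ?_) measurableSet_Ioi
  have hx' : 0 < x := hx
  simp only
  rw [norm_rpow_mul_cexp hx', mul_pow, ← Real.exp_nat_mul, ← mul_assoc, ← Real.rpow_mul_natCast hx'.le,
    ← Real.rpow_add hx']
  congr 2
  · push_cast
    ring
  · push_cast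
    ring

/-- The density in the coordinates `(t, v)` that detects the vanishing of `F`. -/
noncomputable def stripFun (F : ℝ × ℝ → ℂ) (p : ℝ × ℝ) : ℂ :=
  (p.1 / 2) • (F (quadrantCoord p) * Complex.exp (-p.1))

theorem cexp_quadrantCoord (p : ℝ × ℝ) :
    Complex.exp (Complex.I * ((UpperHalfPlane.I : ℂ) * ((quadrantCoord p).1 : ℂ) +
      (UpperHalfPlane.I : ℂ) * ((quadrantCoord p).2 : ℂ))) = Complex.exp (-p.1) := by
  rw [← quadrantCoord_fst_add_snd p, UpperHalfPlane.coe_I]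
  congr 1
  push_cast
  linear_combination (((quadrantCoord p).1 : ℂ) + ((quadrantCoord p).2 : ℂ)) * Complex.I_mul_I

theorem integrableOn_stripFun {lam₁ lam₂ : ℝ} (h₁ : 1 < lam₁) (h₂ : 1 < lam₂)
    (F : QuadrantL2 lam₁ lam₂) :
    IntegrableOn (stripFun F) (Ioi (0 : ℝ) ×ˢ Ioo (-1 : ℝ) 1) := by
  have := integrableOn_mul_cexp₂ (zero_lt_one.trans h₁) (zero_lt_one.trans h₂)
    (UpperHalfPlane.I, UpperHalfPlane.I) F
  rw [integrableOn_quadrant_iff] at this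
  simp only [cexp_quadrantCoord] at this
  exact this

/-- The test function is `h(t) = t ^ (lam₁ + lam₂ + n - 1) e ^ (-(1 + iξ) t)`. Its power of `t`
turns `t ^ (2 - lam₁ - lam₂ - n)` into the Jacobian factor `t`, and its conjugate supplies `e ^
(iξt)` together with the damping `e ^ (-t)`. -/
theorem integral_jacobiP_mul_stripFun {F : QuadrantL2 lam₁ lam₂}
    (hF : ∀ n h, inner ℂ (holographicL2 h₁ h₂ n h) F = 0) (n : ℕ) (ξ : ℝ) :
    ∫ p in Ioi (0 : ℝ) ×ˢ Ioo (-1 : ℝ) 1, ((jacobiP n (lam₁ - 1) (lam₂ - 1) p.2 : ℝ) : ℂ) *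
      (Complex.exp (ξ * p.1 * Complex.I) * stripFun F p) = 0 := by
  have hm := memLp_rpow_mul_cexp (lam := lam₁ + lam₂ + 2 * n) (s := lam₁ + lam₂ + n - 1)
    (by linarith) (A := 1 + ξ * Complex.I) (by simp)
  have := hF n (hm.toLp _)
  rw [inner_holographicL2] at this
  rw [← this]
  refine integral_congr_ae ?_
  filter_upwards [ae_strip_fst ((absolutelyContinuous_halfLineMeasure _).ae_le hm.coeFn_toLp),
    ae_restrict_mem measurableSet_strip] with p hp hps
  have h0 : 0 < p.1 := hps.1
  rw [hp, map_mul, Complex.conj_ofReal, ← Complex.exp_conj, stripFun, Complex.real_smul]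
  have e1 : (conj (-(1 + ξ * Complex.I) * (p.1 : ℂ))) = -p.1 + ξ * p.1 * Complex.I := by
    simp only [map_mul, map_neg, map_add, map_one, Complex.conj_ofReal, Complex.conj_I]
    ring
  have e2 : p.1 ^ (2 - lam₁ - lam₂ - n) * p.1 ^ (lam₁ + lam₂ + n - 1) = p.1 := by
    rw [← Real.rpow_add h0]
    ring_nf
    exact Real.rpow_one _
  rw [e1, Complex.exp_add]
  have e3 : ((p.1 / 2 : ℝ) : ℂ) = (((p.1 ^ (2 - lam₁ - lam₂ - n) : ℝ) : ℂ) *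
      ((p.1 ^ (lam₁ + lam₂ + n - 1) : ℝ) : ℂ)) / 2 := by
    rw [← Complex.ofReal_mul, e2]
    push_cast
    ring
  rw [e3]
  push_cast
  ring

theorem norm_sub_one_div_two_pow_le {v : ℝ} (hv : v ∈ Ioo (-1 : ℝ) 1) (m : ℕ) :
    ‖((((v - 1) / 2) ^ m : ℝ) : ℂ)‖ ≤ 1 := by
  rw [Complex.norm_real, norm_pow]
  refine pow_le_one₀ (norm_nonneg _) ?_
  rw [Real.norm_eq_abs, abs_le]
  constructor <;> linarith [hv.1, hv.2]

theorem integrableOn_pow_mul_strip {g : ℝ × ℝ → ℂ}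
    (hg : IntegrableOn g (Ioi (0 : ℝ) ×ˢ Ioo (-1 : ℝ) 1)) (m : ℕ) :
    IntegrableOn (fun p => ((((p.2 - 1) / 2) ^ m : ℝ) : ℂ) * g p)
      (Ioi (0 : ℝ) ×ˢ Ioo (-1 : ℝ) 1) := by
  refine Integrable.mono hg (AEStronglyMeasurable.mul ?_ hg.1) ?_
  · apply Measurable.aestronglyMeasurable
    fun_prop
  · filter_upwards [ae_restrict_mem measurableSet_strip] with p hp
    rw [norm_mul]
    exact mul_le_of_le_one_left (norm_nonneg _) (norm_sub_one_div_two_pow_le hp.2 m)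

theorem jacobiCoeff_self_pos {α β : ℝ} (hα : 0 ≤ α) (hβ : 0 ≤ β) (n : ℕ) :
    0 < jacobiCoeff n α β n := by
  have := ascPochhammer_pos n (α + β + n + 1) (by positivity)
  rw [jacobiCoeff, Nat.sub_self]
  simp only [ascPochhammer_zero, Polynomial.eval_one]
  positivity

/-- Orthogonality to all Jacobi polynomials implies orthogonality to all powers. -/
theorem integral_pow_mul_eq_zero {α β : ℝ} (hα : 0 ≤ α) (hβ : 0 ≤ β) {g : ℝ × ℝ → ℂ}
    (hg : IntegrableOn g (Ioi (0 : ℝ) ×ˢ Ioo (-1 : ℝ) 1))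
    (h : ∀ n, ∫ p in Ioi (0 : ℝ) ×ˢ Ioo (-1 : ℝ) 1, ((jacobiP n α β p.2 : ℝ) : ℂ) * g p = 0)
    (m : ℕ) :
    ∫ p in Ioi (0 : ℝ) ×ˢ Ioo (-1 : ℝ) 1, ((((p.2 - 1) / 2) ^ m : ℝ) : ℂ) * g p = 0 := by
  induction m using Nat.strong_induction_on with
  | _ m ih =>
    have e : ∀ p : ℝ × ℝ, ((jacobiP m α β p.2 : ℝ) : ℂ) * g p = ∑ j ∈ Finset.range (m + 1),
        (jacobiCoeff m α β j : ℂ) * (((((p.2 - 1) / 2) ^ j : ℝ) : ℂ) * g p) := fun p => by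
      rw [jacobiP_eq_sum, Complex.ofReal_sum, Finset.sum_mul]
      refine Finset.sum_congr rfl fun j _ => ?_
      rw [Complex.ofReal_mul, mul_assoc]
    have hm := h m
    simp only [e] at hm
    -- By induction only the top power survives, and its coefficient is nonzero.
    rw [integral_finsetSum _ fun j _ => (integrableOn_pow_mul_strip hg j).const_mul _,
      Finset.sum_range_succ, Finset.sum_eq_zero fun j hj => ?_, zero_add, integral_const_mul] at hm
    · rcases mul_eq_zero.1 hm with h0 | h0
      · exact absurd (Complex.ofReal_eq_zero.1 h0) (jacobiCoeff_self_pos hα hβ m).ne'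
      · exact h0
    · rw [integral_const_mul, ih j (Finset.mem_range.1 hj), mul_zero]

/-- Since `e ^ (iηv) = e ^ (iη) ∑ (2iη) ^ m / m! ((v - 1) / 2) ^ m` and `|(v - 1) / 2| ≤ 1` on the
strip, the series may be integrated termwise. -/
theorem integral_cexp_mul_eq_zero_of_moments {g : ℝ × ℝ → ℂ}
    (hg : IntegrableOn g (Ioi (0 : ℝ) ×ˢ Ioo (-1 : ℝ) 1))
    (h : ∀ m : ℕ, ∫ p in Ioi (0 : ℝ) ×ˢ Ioo (-1 : ℝ) 1,
      ((((p.2 - 1) / 2) ^ m : ℝ) : ℂ) * g p = 0) (η : ℝ) :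
    ∫ p in Ioi (0 : ℝ) ×ˢ Ioo (-1 : ℝ) 1, Complex.exp (η * p.2 * Complex.I) * g p = 0 := by
  set μ := (volume : Measure (ℝ × ℝ)).restrict (Ioi (0 : ℝ) ×ˢ Ioo (-1 : ℝ) 1)
  let c : ℕ → ℂ := fun m => (2 * η * Complex.I) ^ m / m.factorial
  let f : ℕ → ℝ × ℝ → ℂ := fun m p => c m * (((((p.2 - 1) / 2) ^ m : ℝ) : ℂ) * g p)
  have hf : ∀ m, Integrable (f m) μ := fun m => (integrableOn_pow_mul_strip hg m).const_mul _
  have hc : Summable fun m => ‖c m‖ := by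
    have := Real.summable_pow_div_factorial ‖2 * η * Complex.I‖
    refine this.congr fun m => ?_
    simp only [c, norm_div, norm_pow, Complex.norm_natCast]
  have hs : Summable fun m => ∫ p, ‖f m p‖ ∂μ := by
    refine Summable.of_nonneg_of_le (fun m => integral_nonneg fun p => norm_nonneg _) (fun m => ?_)
      (hc.mul_right (∫ p, ‖g p‖ ∂μ))
    rw [← integral_const_mul]
    refine integral_mono_ae (hf m).norm (hg.norm.const_mul _) ?_
    filter_upwards [ae_restrict_mem measurableSet_strip] with p hp
    simp only [f, norm_mul]
    refine mul_le_mul_of_nonneg_left ?_ (norm_nonneg _)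
    exact mul_le_of_le_one_left (norm_nonneg _) (norm_sub_one_div_two_pow_le hp.2 m)
  have key := hasSum_integral_of_summable_integral_norm hf hs
  have hz : ∀ m, ∫ p, f m p ∂μ = 0 := fun m => by
    simp only [f]
    rw [integral_const_mul, h m, mul_zero]
  simp only [hz] at key
  have h0 := key.unique hasSum_zero
  have e : ∀ p : ℝ × ℝ, Complex.exp (η * p.2 * Complex.I) * g p =
      Complex.exp (η * Complex.I) * ∑' m, f m p := fun p => by
    have hs' : HasSum (fun m => f m p)
        (Complex.exp (2 * η * Complex.I * (((p.2 - 1) / 2 : ℝ) : ℂ)) * g p) := by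
      rw [Complex.exp_eq_exp_ℂ]
      refine ((NormedSpace.expSeries_div_hasSum_exp
        (2 * η * Complex.I * (((p.2 - 1) / 2 : ℝ) : ℂ))).mul_right (g p)).congr_fun fun m => ?_
      simp only [f, c]
      rw [mul_pow (2 * (η : ℂ) * Complex.I) (((p.2 - 1) / 2 : ℝ) : ℂ), Complex.ofReal_pow]
      ring
    rw [hs'.tsum_eq, ← mul_assoc, ← Complex.exp_add]
    congr 2
    push_cast
    ring
  simp only [e]
  rw [integral_const_mul, h0, mul_zero]

theorem eq_zero_of_inner_holographicL2_eq_zero {F : QuadrantL2 lam₁ lam₂}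
    (hF : ∀ n h, inner ℂ (holographicL2 h₁ h₂ n h) F = 0) : F = 0 := by
  have hG := integrableOn_stripFun h₁ h₂ F
  have h0 : stripFun F =ᵐ[volume.restrict (Ioi (0 : ℝ) ×ˢ Ioo (-1 : ℝ) 1)] 0 := by
    refine ae_eq_zero_of_forall_integral_cexp hG fun L => ?_
    have hL : ∀ p : ℝ × ℝ, L p = L (1, 0) * p.1 + L (0, 1) * p.2 := fun p => by
      have e : p = p.1 • ((1 : ℝ), (0 : ℝ)) + p.2 • ((0 : ℝ), (1 : ℝ)) := by ext <;> simp
      conv_lhs => rw [e]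
      rw [map_add, map_smul, map_smul, smul_eq_mul, smul_eq_mul]
      ring
    have hg : IntegrableOn (fun p : ℝ × ℝ => Complex.exp (L (1, 0) * p.1 * Complex.I) *
        stripFun F p) (Ioi (0 : ℝ) ×ˢ Ioo (-1 : ℝ) 1) := by
      have := integrable_cexp_mul hG ((L (1, 0)) • ContinuousLinearMap.fst ℝ ℝ ℝ)
      simpa [IntegrableOn] using this
    rw [← integral_cexp_mul_eq_zero_of_moments hg (integral_pow_mul_eq_zero
      (show 0 ≤ lam₁ - 1 by linarith) (show 0 ≤ lam₂ - 1 by linarith) hg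
      fun n => integral_jacobiP_mul_stripFun h₁ h₂ hF n _) (L (0, 1))]
    refine integral_congr_ae (Filter.Eventually.of_forall fun p => ?_)
    simp only [hL p]
    rw [← mul_assoc, ← Complex.exp_add]
    congr 2
    push_cast
    ring
  have hi := integrableOn_mul_cexp₂ (zero_lt_one.trans h₁) (zero_lt_one.trans h₂)
    (UpperHalfPlane.I, UpperHalfPlane.I) F
  -- Vanishing on the strip is carried back to the quadrant by applying the change of variables to
  -- the integral of the norm.
  have hn : ∫ p in Ioi (0 : ℝ) ×ˢ Ioi (0 : ℝ), ‖F p * Complex.exp (Complex.I *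
      ((UpperHalfPlane.I : ℂ) * (p.1 : ℂ) + (UpperHalfPlane.I : ℂ) * (p.2 : ℂ)))‖ = 0 := by
    rw [integral_quadrant]
    refine (integral_congr_ae (g := fun _ => (0 : ℝ)) ?_).trans (by simp)
    filter_upwards [h0, ae_restrict_mem measurableSet_strip] with p hp hps
    have hp1 : 0 < p.1 := hps.1
    rw [cexp_quadrantCoord]
    have : ‖stripFun F p‖ = 0 := by rw [hp, Pi.zero_apply, norm_zero]
    rw [stripFun, norm_smul, Real.norm_of_nonneg (by positivity)] at this
    exact this
  rw [integral_eq_zero_iff_of_nonneg (fun p => norm_nonneg _) hi.norm] at hn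
  apply Lp.ext
  filter_upwards [(quadrantMeasure_absolutelyContinuous lam₁ lam₂).ae_le hn,
    Lp.coeFn_zero ℂ 2 (quadrantMeasure lam₁ lam₂)] with p hp hp0
  rw [hp0]
  simpa using hp

end HolographicOperatorL2

/-! ### The holographic operators on reproducing kernels, and equivariance. -/

section HolographicKernel

variable {lam₁ lam₂ : ℝ}

theorem cexp_quadrantCoord_eq (A B : ℂ) (p : ℝ × ℝ) :
    Complex.exp (-A * (quadrantCoord p).1) * Complex.exp (-B * (quadrantCoord p).2) =
      Complex.exp (-(A + B) * p.1 / 2) * Complex.exp ((A - B) * p.1 / 2 * p.2) := by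
  rw [← Complex.exp_add, ← Complex.exp_add]
  congr 1
  simp only [quadrantCoord]
  push_cast
  ring

theorem quadrantCoord_rpow {p : ℝ × ℝ} (hp : p ∈ Ioi (0 : ℝ) ×ˢ Ioo (-1 : ℝ) 1) (a b : ℝ) :
    (p.1 / 2) * ((quadrantCoord p).1 ^ a * (quadrantCoord p).2 ^ b) =
      p.1 ^ (a + b + 1) / 2 ^ (a + b + 1) * ((1 - p.2) ^ a * (1 + p.2) ^ b) := by
  have h0 : 0 < p.1 := hp.1
  have h1 : 0 < 1 - p.2 := by linarith [hp.2.2]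
  have h2 : 0 < 1 + p.2 := by linarith [hp.2.1]
  simp only [quadrantCoord]
  rw [mul_div_assoc p.1 (1 - p.2), mul_div_assoc p.1 (1 + p.2), Real.mul_rpow h0.le (by positivity),
    Real.mul_rpow h0.le (by positivity), Real.div_rpow h1.le two_pos.le,
    Real.div_rpow h2.le two_pos.le, Real.rpow_add_one h0.ne', Real.rpow_add_one two_ne_zero,
    Real.rpow_add h0, Real.rpow_add two_pos]
  field_simp

/-- The integrated Rodrigues formula for exponentials. -/
theorem integral_jacobiP_smul_cexp (n : ℕ) {α β : ℝ} (hα : 0 ≤ α) (hβ : 0 ≤ β) (c : ℂ) :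
    ∫ v in (-1 : ℝ)..1, (((1 - v) ^ α * (1 + v) ^ β * jacobiP n α β v : ℝ) : ℂ) *
        Complex.exp (c * v) =
      c ^ n / (2 ^ n * n.factorial) * ∫ v in (-1 : ℝ)..1,
        (((1 - v) ^ (α + n) * (1 + v) ^ (β + n) : ℝ) : ℂ) * Complex.exp (c * v) := by
  have hφ : ∀ (k : ℕ) (v : ℝ), HasDerivAt (fun v : ℝ => c ^ k * Complex.exp (c * v))
      (c ^ (k + 1) * Complex.exp (c * v)) v := fun k v => by
    have h1 : HasDerivAt (fun v : ℝ => c * (v : ℂ)) (c * 1) v :=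
      (hasDerivAt_id v).ofReal_comp.const_mul c
    refine (h1.cexp.const_mul (c ^ k)).congr_deriv ?_
    ring
  have key := integral_jacobiP_smul n hα hβ hφ
  simp only [Complex.real_smul, pow_zero, one_mul] at key
  rw [key, ← intervalIntegral.integral_const_mul, ← intervalIntegral.integral_const_mul]
  refine intervalIntegral.integral_congr fun v _ => ?_
  push_cast
  ring

/-- In the coordinates `(t, v)` the exponential is `e ^ (-(A + B) t / 2) e ^ ((A - B) t v / 2)`.
Rodrigues in `v` produces `((A - B) t / 2) ^ n` and raises both exponents of the weight by `n`. With
the factor `t ^ n` already present this amounts to `(A - B) ^ n / n!` times `(x y) ^ n`, after which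
the integral is a product of two Gamma integrals. The integrability hypothesis serves Fubini. -/
theorem integral_holographic_cexp (n : ℕ) (h₁ : 1 < lam₁) (h₂ : 1 < lam₂) {A B : ℂ}
    (hA : 0 < A.re) (hB : 0 < B.re)
    (hf : IntegrableOn (fun p : ℝ × ℝ => ((p.1 ^ (lam₁ - 1) * p.2 ^ (lam₂ - 1) * (p.1 + p.2) ^ n *
      jacobiP n (lam₁ - 1) (lam₂ - 1) ((p.2 - p.1) / (p.1 + p.2)) : ℝ) : ℂ) *
      (Complex.exp (-A * p.1) * Complex.exp (-B * p.2))) (Ioi (0 : ℝ) ×ˢ Ioi (0 : ℝ))) :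
    ∫ p in Ioi (0 : ℝ) ×ˢ Ioi (0 : ℝ), ((p.1 ^ (lam₁ - 1) * p.2 ^ (lam₂ - 1) * (p.1 + p.2) ^ n *
      jacobiP n (lam₁ - 1) (lam₂ - 1) ((p.2 - p.1) / (p.1 + p.2)) : ℝ) : ℂ) *
      (Complex.exp (-A * p.1) * Complex.exp (-B * p.2)) =
    (A - B) ^ n / n.factorial * ((Real.Gamma (lam₁ + n) *
      Complex.exp (-((lam₁ + n : ℝ) : ℂ) * Complex.log A)) *
      (Real.Gamma (lam₂ + n) * Complex.exp (-((lam₂ + n : ℝ) : ℂ) * Complex.log B))) := by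
  have ha : 0 < lam₁ + n := by positivity
  have hb : 0 < lam₂ + n := by positivity
  have hg : IntegrableOn (fun p : ℝ × ℝ => (((p.1 ^ (lam₁ + n - 1) : ℝ) : ℂ) *
      Complex.exp (-A * p.1)) * (((p.2 ^ (lam₂ + n - 1) : ℝ) : ℂ) * Complex.exp (-B * p.2)))
      (Ioi (0 : ℝ) ×ˢ Ioi (0 : ℝ)) := by
    rw [IntegrableOn, Measure.volume_eq_prod, ← Measure.prod_restrict]
    exact (integrableOn_rpow_mul_cexp_neg_mul ha hA).mul_prod
      (integrableOn_rpow_mul_cexp_neg_mul hb hB)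
  rw [← integral_rpow_mul_cexp_neg_mul ha hA, ← integral_rpow_mul_cexp_neg_mul hb hB,
    ← setIntegral_prod_mul (fun x : ℝ => ((x ^ (lam₁ + n - 1) : ℝ) : ℂ) * Complex.exp (-A * x))
      (fun y : ℝ => ((y ^ (lam₂ + n - 1) : ℝ) : ℂ) * Complex.exp (-B * y)),
    ← Measure.volume_eq_prod, integral_quadrant, integral_quadrant]
  rw [integrableOn_quadrant_iff] at hf hg
  have e1 : ∀ p ∈ Ioi (0 : ℝ) ×ˢ Ioo (-1 : ℝ) 1, (p.1 / 2) •
      ((((quadrantCoord p).1 ^ (lam₁ - 1) * (quadrantCoord p).2 ^ (lam₂ - 1) *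
      ((quadrantCoord p).1 + (quadrantCoord p).2) ^ n * jacobiP n (lam₁ - 1) (lam₂ - 1)
      (((quadrantCoord p).2 - (quadrantCoord p).1) /
        ((quadrantCoord p).1 + (quadrantCoord p).2)) : ℝ) : ℂ) *
      (Complex.exp (-A * (quadrantCoord p).1) * Complex.exp (-B * (quadrantCoord p).2))) =
      (((p.1 ^ (lam₁ + lam₂ - 1) / 2 ^ (lam₁ + lam₂ - 1) * p.1 ^ n : ℝ) : ℂ) *
        Complex.exp (-(A + B) * p.1 / 2)) * ((((1 - p.2) ^ (lam₁ - 1) * (1 + p.2) ^ (lam₂ - 1) *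
        jacobiP n (lam₁ - 1) (lam₂ - 1) p.2 : ℝ) : ℂ) *
        Complex.exp ((A - B) * p.1 / 2 * p.2)) := by
    intro p hp
    have h0 : 0 < p.1 := hp.1
    rw [quadrantCoord_fst_add_snd, quadrantCoord_snd_sub_fst, mul_div_cancel_left₀ _ h0.ne',
      cexp_quadrantCoord_eq, Complex.real_smul, ← mul_assoc, ← Complex.ofReal_mul, mul_assoc
      ((quadrantCoord p).1 ^ (lam₁ - 1) * _), ← mul_assoc (p.1 / 2), quadrantCoord_rpow hp,
      show lam₁ - 1 + (lam₂ - 1) + 1 = lam₁ + lam₂ - 1 by ring]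
    push_cast
    ring
  have e2 : ∀ p ∈ Ioi (0 : ℝ) ×ˢ Ioo (-1 : ℝ) 1, (p.1 / 2) •
      (((((quadrantCoord p).1 ^ (lam₁ + n - 1) : ℝ) : ℂ) *
        Complex.exp (-A * (quadrantCoord p).1)) * ((((quadrantCoord p).2 ^ (lam₂ + n - 1) : ℝ) : ℂ) *
        Complex.exp (-B * (quadrantCoord p).2))) =
      (((p.1 ^ (lam₁ + lam₂ - 1) / 2 ^ (lam₁ + lam₂ - 1) * (p.1 / 2) ^ (2 * n) : ℝ) : ℂ) *
        Complex.exp (-(A + B) * p.1 / 2)) *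
        ((((1 - p.2) ^ (lam₁ - 1 + n) * (1 + p.2) ^ (lam₂ - 1 + n) : ℝ) : ℂ) *
        Complex.exp ((A - B) * p.1 / 2 * p.2)) := by
    intro p hp
    have h0 : 0 < p.1 := hp.1
    rw [mul_mul_mul_comm, cexp_quadrantCoord_eq, Complex.real_smul, ← Complex.ofReal_mul, ← mul_assoc,
      ← Complex.ofReal_mul, quadrantCoord_rpow hp,
      show lam₁ + n - 1 + (lam₂ + n - 1) + 1 = lam₁ + lam₂ - 1 + ((2 * n : ℕ) : ℝ) by
        push_cast; ring, Real.rpow_add_natCast h0.ne', Real.rpow_add_natCast two_ne_zero,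
      show lam₁ + n - 1 = lam₁ - 1 + n by ring, show lam₂ + n - 1 = lam₂ - 1 + n by ring, div_pow]
    push_cast
    ring
  rw [integrableOn_congr_fun e1 measurableSet_strip, IntegrableOn, volume_restrict_strip] at hf
  rw [integrableOn_congr_fun e2 measurableSet_strip, IntegrableOn, volume_restrict_strip] at hg
  rw [setIntegral_congr_fun measurableSet_strip e1, setIntegral_congr_fun measurableSet_strip e2,
    volume_restrict_strip, integral_prod _ hf, integral_prod _ hg, ← integral_const_mul]
  refine integral_congr_ae (Filter.Eventually.of_forall fun t => ?_)
  simp only [integral_const_mul]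
  -- Rodrigues is applied for fixed `t`, with `c = (A - B) t / 2`.
  rw [integral_Ioo_eq_intervalIntegral, integral_Ioo_eq_intervalIntegral,
    integral_jacobiP_smul_cexp n (by linarith) (by linarith)]
  simp only [← mul_assoc]
  congr 1
  have : (n.factorial : ℂ) ≠ 0 := Nat.cast_ne_zero.2 n.factorial_ne_zero
  rw [pow_mul', sq]
  push_cast
  simp only [div_pow, mul_pow]
  field_simp

variable (h₁ : 1 < lam₁) (h₂ : 1 < lam₂)

theorem holographicKernel_pos {lam₁ lam₂ : ℝ} (h₁ : 1 < lam₁) (h₂ : 1 < lam₂) (n : ℕ) :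
    0 < lam₁ + lam₂ + 2 * (n : ℝ) := by positivity

/-- The `(𝓕 ⊗ 𝓕)`-transform of the holographic operator applied to a reproducing kernel. -/
theorem inner_laplaceKernel₂_holographicL2 (n : ℕ) (z : ℍ × ℍ) (w : ℍ) :
    inner ℂ (laplaceKernel₂ (zero_lt_one.trans h₁) (zero_lt_one.trans h₂) z)
      (holographicL2 h₁ h₂ n (laplaceKernel (holographicKernel_pos h₁ h₂ n) w)) =
    (Complex.I * ((z.2 : ℂ) - z.1)) ^ n / n.factorial *
      ((Real.Gamma (lam₁ + n) * powKernel (lam₁ + n) z.1 w) *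
        (Real.Gamma (lam₂ + n) * powKernel (lam₂ + n) z.2 w)) := by
  set Φk := holographicL2 h₁ h₂ n (laplaceKernel (holographicKernel_pos h₁ h₂ n) w) with hΦk
  have hae : Φk =ᵐ[volume.restrict (Ioi (0 : ℝ) ×ˢ Ioi (0 : ℝ))]
      holographic lam₁ lam₂ n (laplaceKernelFun (lam₁ + lam₂ + 2 * n) w) :=
    (absolutelyContinuous_quadrantMeasure lam₁ lam₂).ae_le
      ((coeFn_holographicL2 h₁ h₂ n _).trans (holographic_congr_ae n (coeFn_laplaceKernel _ w)))
  have key : (fun p : ℝ × ℝ => Φk p * Complex.exp (Complex.I * ((z.1 : ℂ) * (p.1 : ℂ) +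
      (z.2 : ℂ) * (p.2 : ℂ)))) =ᵐ[volume.restrict (Ioi (0 : ℝ) ×ˢ Ioi (0 : ℝ))] fun p =>
      ((p.1 ^ (lam₁ - 1) * p.2 ^ (lam₂ - 1) * (p.1 + p.2) ^ n *
        jacobiP n (lam₁ - 1) (lam₂ - 1) ((p.2 - p.1) / (p.1 + p.2)) : ℝ) : ℂ) *
      (Complex.exp (-(-Complex.I * ((z.1 : ℂ) - conj (w : ℂ))) * p.1) *
        Complex.exp (-(-Complex.I * ((z.2 : ℂ) - conj (w : ℂ))) * p.2)) := by
    filter_upwards [hae, ae_restrict_mem measurableSet_quadrant] with p hp hpq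
    have hs : 0 < p.1 + p.2 := add_pos hpq.1 hpq.2
    rw [hp, holographic, laplaceKernelFun, ← mul_assoc, ← Complex.ofReal_mul, mul_assoc,
      ← Complex.exp_add, ← Complex.exp_add]
    congr 2
    -- The power of `x + y` in the kernel exceeds the one in the denominator of the operator by
    -- exactly `n`.
    · rw [show lam₁ + lam₂ + 2 * (n : ℝ) - 1 = lam₁ + lam₂ + n - 1 + n by ring,
        Real.rpow_add_natCast hs.ne']
      have := Real.rpow_pos_of_pos hs (lam₁ + lam₂ + n - 1)
      field_simp
    · push_cast
      ring
  have hi := integrableOn_mul_cexp₂ (zero_lt_one.trans h₁) (zero_lt_one.trans h₂) z Φk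
  rw [inner_laplaceKernel₂, fourierLaplace₂, integral_congr_ae key, integral_holographic_cexp n h₁ h₂
    (re_neg_I_mul_sub_conj_pos z.1 w) (re_neg_I_mul_sub_conj_pos z.2 w)
    (Integrable.congr hi key)]
  congr 2
  ring

theorem continuous_holographicL2 (n : ℕ) : Continuous (holographicL2 h₁ h₂ n) :=
  AddMonoidHomClass.continuous_of_bound (holographicL2 h₁ h₂ n) _
    fun h => (norm_holographicL2 h₁ h₂ n h).le

theorem conj_multiplier_inv (lam : ℝ) (g : SLTilde) (w : ℍ) :
    conj (multiplier lam g⁻¹ w) = Complex.exp (lam * conj (g⁻¹.logDenom (g.toSL • w))) := by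
  rw [multiplier, inv_inv, ← Complex.exp_conj, SLTilde.inv_logDenom, inv_smul_smul]
  simp

/-- Paired with `laplaceKernel₂`, both sides are explicit products whose factors transform by
`powKernel_smul_smul` and `coe_smul_sub_coe_smul`. -/
theorem holographicL2_l2Model_laplaceKernel (n : ℕ) (g : SLTilde) (w : ℍ) :
    holographicL2 h₁ h₂ n (l2Model (lam₁ + lam₂ + 2 * n) g
      (laplaceKernel (holographicKernel_pos h₁ h₂ n) w)) =
    l2Model₂ lam₁ lam₂ (g, g)
      (holographicL2 h₁ h₂ n (laplaceKernel (holographicKernel_pos h₁ h₂ n) w)) := by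
  refine eq_of_forall_inner_eq (laplaceKernel₂_total (zero_lt_one.trans h₁) (zero_lt_one.trans h₂))
    fun z => ?_
  -- With `w = g⁻¹ u`, all three points are moved by the same element `g⁻¹`.
  obtain ⟨u, hu⟩ : ∃ u : ℍ, u = g.toSL • w := ⟨_, rfl⟩
  have hw : w = g⁻¹.toSL • u := by rw [hu, SLTilde.inv_toSL, inv_smul_smul]
  rw [inner_laplaceKernel₂_l2Model₂, l2Model_laplaceKernel, map_smul, inner_smul_right,
    inner_laplaceKernel₂_holographicL2, inner_laplaceKernel₂_holographicL2, conj_multiplier_inv, ← hu,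
    hw, powKernel_smul_smul, powKernel_smul_smul, ← g⁻¹.coe_smul_sub_coe_smul z.2 z.1,
    multiplier, multiplier]
  simp only
  rw [← mul_assoc Complex.I, mul_pow _ (Complex.exp _ * Complex.exp _), mul_pow (Complex.exp _),
    ← Complex.exp_nat_mul, ← Complex.exp_nat_mul]
  set X := (Complex.I * (((g⁻¹.toSL • z.2 : ℍ) : ℂ) - ((g⁻¹.toSL • z.1 : ℍ) : ℂ))) ^ n
  -- The balance of multipliers: the `n` contributed by `(z₂ - z₁) ^ n` at each of `z₁`, `z₂`
  -- offsets the shifts `lam₁ + n`, `lam₂ + n`, while at `u` these add up to `lam₁ + lam₂ + 2 n`.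
  have hexp : Complex.exp (((lam₁ + lam₂ + 2 * n : ℝ) : ℂ) * conj (g⁻¹.logDenom u)) *
      (Complex.exp (n * g⁻¹.logDenom z.2) * Complex.exp (n * g⁻¹.logDenom z.1)) =
      Complex.exp (-lam₁ * g⁻¹.logDenom z.1) * Complex.exp (-lam₂ * g⁻¹.logDenom z.2) *
      ((Complex.exp (((lam₁ + n : ℝ) : ℂ) * g⁻¹.logDenom z.1) *
        Complex.exp (((lam₁ + n : ℝ) : ℂ) * conj (g⁻¹.logDenom u))) *
      (Complex.exp (((lam₂ + n : ℝ) : ℂ) * g⁻¹.logDenom z.2) *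
        Complex.exp (((lam₂ + n : ℝ) : ℂ) * conj (g⁻¹.logDenom u)))) := by
    simp only [← Complex.exp_add]
    congr 1
    push_cast
    ring
  linear_combination (X / n.factorial * ((Real.Gamma (lam₁ + n) * powKernel (lam₁ + n) z.1 u) *
    (Real.Gamma (lam₂ + n) * powKernel (lam₂ + n) z.2 u))) * hexp

/-- The holographic operators intertwine the group actions. -/
theorem holographicL2_l2Model (n : ℕ) (g : SLTilde) (h : HalfLineL2 (lam₁ + lam₂ + 2 * n)) :
    holographicL2 h₁ h₂ n (l2Model (lam₁ + lam₂ + 2 * n) g h) =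
      l2Model₂ lam₁ lam₂ (g, g) (holographicL2 h₁ h₂ n h) := by
  have hc := continuous_holographicL2 h₁ h₂ n
  refine (denseRange_linearCombination (laplaceKernel_total (holographicKernel_pos h₁ h₂ n))
    ).induction_on (p := fun h => holographicL2 h₁ h₂ n (l2Model (lam₁ + lam₂ + 2 * n) g h) =
      l2Model₂ lam₁ lam₂ (g, g) (holographicL2 h₁ h₂ n h)) h
    (isClosed_eq (hc.comp (LinearIsometryEquiv.continuous _))
      ((LinearIsometryEquiv.continuous _).comp hc)) fun c => ?_
  simp only [Finsupp.linearCombination_apply, Finsupp.sum, map_sum, map_smul,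
    holographicL2_l2Model_laplaceKernel]

end HolographicKernel

/-! ### The weighted Hilbert sum and the holographic transform. -/

section HilbertSumDecomposition

/-- Rescaling identifies the Hilbert sum with weights `a n` with the `ℓ²`-sum. -/
theorem exists_weightedHilbertSum_equiv {a : ℕ → ℝ} (ha : ∀ n, 0 < a n) (V : ℕ → Type*)
    [∀ n, NormedAddCommGroup (V n)] [∀ n, InnerProductSpace ℂ (V n)] :
    ∃ S : WeightedHilbertSum a ha V ≃ₗᵢ[ℂ] lp V 2, ∀ v n, S v n = (√(a n) : ℂ) • v n := by
  have hs : ∀ n, (√(a n) : ℂ) ≠ 0 := fun n =>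
    Complex.ofReal_ne_zero.2 (Real.sqrt_pos.2 (ha n)).ne'
  have hsq : ∀ (n : ℕ) (x : V n), ‖(√(a n) : ℂ) • x‖ ^ 2 = a n * ‖x‖ ^ 2 := fun n x => by
    rw [norm_smul, mul_pow, Complex.norm_real, Real.norm_of_nonneg (Real.sqrt_nonneg _),
      Real.sq_sqrt (ha n).le]
  have hsum : ∀ w : lp V 2, Summable fun n => ‖w n‖ ^ 2 := fun w => by
    have := (lp.memℓp w).summable (by norm_num)
    simpa using this
  let e : WeightedHilbertSum a ha V ≃ₗ[ℂ] lp V 2 :=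
    { toFun := fun v => ⟨fun n => (√(a n) : ℂ) • v n, memℓp_gen (by
        refine v.summable_sq.congr fun n => ?_
        have := hsq n (v n)
        simpa using this.symm)⟩
      map_add' := fun v w => by
        ext n
        exact smul_add (√(a n) : ℂ) (v n) (w n)
      map_smul' := fun c v => by
        ext n
        exact smul_comm (√(a n) : ℂ) c (v n)
      invFun := fun w => ⟨fun n => (√(a n) : ℂ)⁻¹ • w n, by
        refine (hsum w).congr fun n => ?_
        rw [← hsq, smul_inv_smul₀ (hs n)]⟩
      left_inv := fun v => by
        ext n
        exact inv_smul_smul₀ (hs n) _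
      right_inv := fun w => by
        ext n
        exact smul_inv_smul₀ (hs n) _ }
  have he : ∀ v n, e v n = (√(a n) : ℂ) • v n := fun v n => rfl
  refine ⟨e.isometryOfInner fun v w => ?_, he⟩
  rw [lp.inner_eq_tsum, WeightedHilbertSum.inner_def]
  refine tsum_congr fun n => ?_
  rw [he, he, inner_smul_left, inner_smul_right, Complex.conj_ofReal, ← mul_assoc,
    ← Complex.ofReal_mul, Real.mul_self_sqrt (ha n).le]

variable {lam₁ lam₂ : ℝ} (h₁ : 1 < lam₁) (h₂ : 1 < lam₂)

theorem sqrt_planchWeight_ne_zero {lam₁ lam₂ : ℝ} (h₁ : 1 < lam₁) (h₂ : 1 < lam₂) (n : ℕ) :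
    (√(planchWeight lam₁ lam₂ n) : ℂ) ≠ 0 :=
  Complex.ofReal_ne_zero.2 (Real.sqrt_pos.2 (planchWeight_pos h₁ h₂ n)).ne'

/-- The normalized holographic operator. -/
noncomputable def holographicIsometry (n : ℕ) :
    HalfLineL2 (lam₁ + lam₂ + 2 * n) →ₗᵢ[ℂ] QuadrantL2 lam₁ lam₂ where
  toLinearMap := (√(planchWeight lam₁ lam₂ n) : ℂ)⁻¹ • holographicL2 h₁ h₂ n
  norm_map' h := by
    have hs := Real.sqrt_pos.2 (planchWeight_pos h₁ h₂ n)
    rw [LinearMap.smul_apply, norm_smul, norm_holographicL2, norm_inv, Complex.norm_real,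
      Real.norm_of_nonneg hs.le, inv_mul_cancel_left₀ hs.ne']

theorem holographicIsometry_apply (n : ℕ) (h : HalfLineL2 (lam₁ + lam₂ + 2 * n)) :
    holographicIsometry h₁ h₂ n h =
      (√(planchWeight lam₁ lam₂ n) : ℂ)⁻¹ • holographicL2 h₁ h₂ n h := rfl

theorem isHilbertSum_holographicIsometry :
    IsHilbertSum ℂ (fun n : ℕ => HalfLineL2 (lam₁ + lam₂ + 2 * n))
      (holographicIsometry h₁ h₂) := by
  refine IsHilbertSum.mk (fun m n hmn v w => ?_) ?_
  · rw [holographicIsometry_apply, holographicIsometry_apply, inner_smul_left, inner_smul_right,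
      inner_holographicL2_of_ne h₁ h₂ hmn, mul_zero, mul_zero]
  · rw [top_le_iff, Submodule.topologicalClosure_eq_top_iff, Submodule.eq_bot_iff]
    refine fun F hF => eq_zero_of_inner_holographicL2_eq_zero h₁ h₂ fun n h => ?_
    refine hF _ (Submodule.mem_iSup_of_mem n
      ⟨(√(planchWeight lam₁ lam₂ n) : ℂ) • h, ?_⟩)
    change holographicIsometry h₁ h₂ n _ = _
    rw [holographicIsometry_apply, map_smul, inv_smul_smul₀ (sqrt_planchWeight_ne_zero h₁ h₂ n)]

/-- The rescaling by the square roots of the weights and the normalization of `holographicIsometry`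
cancel, so the series consists of the unnormalized operators. -/
theorem exists_holographicTransform :
    ∃ Φ : WeightedHilbertSum (planchWeight lam₁ lam₂) (planchWeight_pos h₁ h₂)
        (fun n : ℕ => HalfLineL2 (lam₁ + lam₂ + 2 * n)) ≃ₗᵢ[ℂ] QuadrantL2 lam₁ lam₂,
      (∀ n u, Φ (WeightedHilbertSum.single n u) = holographicL2 h₁ h₂ n u) ∧
      ∀ h, HasSum (fun n => holographicL2 h₁ h₂ n (h n)) (Φ h) := by
  obtain ⟨S, hS⟩ := exists_weightedHilbertSum_equiv (planchWeight_pos h₁ h₂)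
    (fun n : ℕ => HalfLineL2 (lam₁ + lam₂ + 2 * n))
  set hV := isHilbertSum_holographicIsometry h₁ h₂
  have hsum : ∀ h, HasSum (fun n => holographicL2 h₁ h₂ n (h n))
      ((S.trans hV.linearIsometryEquiv.symm) h) := fun h => by
    refine (hV.hasSum_linearIsometryEquiv_symm (S h)).congr_fun fun n => ?_
    rw [hS, holographicIsometry_apply, map_smul, inv_smul_smul₀ (sqrt_planchWeight_ne_zero h₁ h₂ n)]
  refine ⟨S.trans hV.linearIsometryEquiv.symm, fun n u => ?_, hsum⟩
  refine (hsum (WeightedHilbertSum.single n u)).unique ?_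
  have := hasSum_single (f := fun m => holographicL2 h₁ h₂ m
    ((WeightedHilbertSum.single n u : WeightedHilbertSum (planchWeight lam₁ lam₂)
      (planchWeight_pos h₁ h₂) (fun n : ℕ => HalfLineL2 (lam₁ + lam₂ + 2 * n))) m)) n
    fun m hm => by
      change holographicL2 h₁ h₂ m
        ((Pi.single n u : ∀ m : ℕ, HalfLineL2 (lam₁ + lam₂ + 2 * m)) m) = 0
      rw [Pi.single_eq_of_ne hm, map_zero]
  have e : (WeightedHilbertSum.single n u : WeightedHilbertSum (planchWeight lam₁ lam₂)
      (planchWeight_pos h₁ h₂) (fun n : ℕ => HalfLineL2 (lam₁ + lam₂ + 2 * n))) n = u :=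
    Pi.single_eq_same (M := fun m : ℕ => HalfLineL2 (lam₁ + lam₂ + 2 * m)) n u
  rwa [e] at this

end HilbertSumDecomposition

/-! ### The Plancherel formula and the final assembly. -/

theorem WeightedHilbertSum.norm_sq_eq_tsum {a : ℕ → ℝ} {ha : ∀ n, 0 < a n} {V : ℕ → Type*}
    [∀ n, NormedAddCommGroup (V n)] [∀ n, InnerProductSpace ℂ (V n)]
    (v : WeightedHilbertSum a ha V) : ‖v‖ ^ 2 = ∑' n, a n * ‖v n‖ ^ 2 := by
  rw [@norm_sq_eq_re_inner ℂ, WeightedHilbertSum.inner_self_eq]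
  rfl

theorem mainTheorem7 (lam₁ lam₂ : ℝ) (h₁ : 1 < lam₁) (h₂ : 1 < lam₂) :
    -- the weights are the normalized squared norms of the Jacobi polynomials
    (∀ n : ℕ, planchWeight lam₁ lam₂ n =
      1 / 2 ^ (lam₁ + lam₂ - 1) * ∫ v in (-1 : ℝ)..1, jacobiP n (lam₁ - 1) (lam₂ - 1) v ^ 2 *
        (1 - v) ^ (lam₁ - 1) * (1 + v) ^ (lam₂ - 1)) ∧
    -- the representations in the `L²`-model are well defined
    (∀ lam : ℝ, 1 < lam → ∃! ρ, IsL2Model lam ρ) ∧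
    (∃! ρ, IsL2Model₂ lam₁ lam₂ ρ) ∧
    -- the completed tensor product is the `L²`-space of the quadrant, equivariantly
    (∃ T : UniformSpace.Completion (HalfLineL2 lam₁ ⊗[ℂ] HalfLineL2 lam₂) ≃ₗᵢ[ℂ]
        QuadrantL2 lam₁ lam₂,
      (∀ (u : HalfLineL2 lam₁) (v : HalfLineL2 lam₂),
        T ((u ⊗ₜ[ℂ] v : HalfLineL2 lam₁ ⊗[ℂ] HalfLineL2 lam₂) : UniformSpace.Completion _)
          =ᵐ[quadrantMeasure lam₁ lam₂] fun p => u p.1 * v p.2) ∧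
      ∀ (g₁ g₂ : SLTilde) (u : HalfLineL2 lam₁) (v : HalfLineL2 lam₂),
        T ((l2Model lam₁ g₁ u ⊗ₜ[ℂ] l2Model lam₂ g₂ v :
            HalfLineL2 lam₁ ⊗[ℂ] HalfLineL2 lam₂) : UniformSpace.Completion _) =
          l2Model₂ lam₁ lam₂ (g₁, g₂)
            (T ((u ⊗ₜ[ℂ] v : HalfLineL2 lam₁ ⊗[ℂ] HalfLineL2 lam₂) :
              UniformSpace.Completion _))) ∧
    -- the holographic transform is an equivariant unitary operator onto it
    ∃ Φ : WeightedHilbertSum (planchWeight lam₁ lam₂) (planchWeight_pos h₁ h₂)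
        (fun n : ℕ => HalfLineL2 (lam₁ + lam₂ + 2 * n)) ≃ₗᵢ[ℂ] QuadrantL2 lam₁ lam₂,
      (∀ (n : ℕ) (u : HalfLineL2 (lam₁ + lam₂ + 2 * n)),
        Φ (WeightedHilbertSum.single n u) =ᵐ[quadrantMeasure lam₁ lam₂]
          holographic lam₁ lam₂ n u) ∧
      (∀ h, HasSum (fun n => Φ (WeightedHilbertSum.single n (h n))) (Φ h)) ∧
      (∀ h, HasSum (fun n => planchWeight lam₁ lam₂ n * ‖h n‖ ^ 2) (‖Φ h‖ ^ 2)) ∧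
      ∀ (g : SLTilde) h,
        Φ (WeightedHilbertSum.map (fun n : ℕ => l2Model (lam₁ + lam₂ + 2 * n) g) h) =
          l2Model₂ lam₁ lam₂ (g, g) (Φ h) := by
  have p₁ : 0 < lam₁ := zero_lt_one.trans h₁
  have p₂ : 0 < lam₂ := zero_lt_one.trans h₂
  refine ⟨fun n => ?_, fun lam h => existsUnique_isL2Model (zero_lt_one.trans h),
    existsUnique_isL2Model₂ p₁ p₂, ?_, ?_⟩
  · have e := integral_jacobiP_sq_eq_planchWeight h₁ h₂ n
    have h0 := (Real.rpow_pos_of_pos two_pos (lam₁ + lam₂ - 1)).ne'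
    rw [eq_comm, one_div, inv_mul_eq_iff_eq_mul₀ h0, ← e]
    refine intervalIntegral.integral_congr fun v _ => ?_
    ring
  · obtain ⟨T, hT⟩ := exists_completedTensorProduct_equiv p₁ p₂
    refine ⟨T, fun u v => ?_, fun g₁ g₂ u v => ?_⟩
    · rw [hT]
      exact coeFn_quadrantTensor u v
    · rw [hT, hT, quadrantTensor_l2Model p₁ p₂]
  · obtain ⟨Φ, hsingle, hsum⟩ := exists_holographicTransform h₁ h₂
    refine ⟨Φ, fun n u => ?_, fun h => ?_, fun h => ?_, fun g h => ?_⟩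
    · rw [hsingle]
      exact coeFn_holographicL2 h₁ h₂ n u
    · simp only [hsingle]
      exact hsum h
    · rw [Φ.norm_map, WeightedHilbertSum.norm_sq_eq_tsum]
      exact h.summable_sq.hasSum
    -- The group acts by continuous linear maps, so it passes inside the sum, where each summand is
    -- equivariant.
    · refine (hsum _).unique ?_
      refine HasSum.congr_fun (((l2Model₂ lam₁ lam₂ (g, g)).toContinuousLinearEquiv.hasSum').2
        (hsum h)) fun n => ?_
      exact holographicL2_l2Model h₁ h₂ n g (h n)
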